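/- **Setting.** Let $G$ be a finite directed plane graph with source $s$ and sink $t$ such that: the embedding has no clockwise (directed, simple) cycle; $s$ has no incoming arc and exactly one outgoing arc; every vertex other than $s$ and $t$ has degree (indegree plus outdegree) exactly $3$; and $t$ lies on the unbounded face. An arc is *useful* if it lies on some simple directed $s,t$-path, and *useless* otherwise. Let $C$ be a strongly connected component of $G$ with $t\notin V(C)$ such that $s$ lies in the unbounded face of $C$ (the outside case). A vertex $v$ of $C$ is an *entrance* (*exit*) if there is an $s,v$-path (a $v,t$-path) meeting $C$ only in $v$. Let the boundary of $C$ (the arcs of $C$ on the unbounded face of $C$) be the cycle that consists of a path $F^*$ from an entrance $s_C$ to an exit $t_C$ followed by a path $Q_2$ from $t_C$ back to $s_C$ none of whose internal vertices is an entrance or an exit. Let $U^*=(s_C,u^*,t_C)$ be a dummy ceiling, where $u^*$ is a new vertex, drawn outside $C$ alongside $Q_2$. So $C$ becomes a strip with ceiling $U^*$ and floor $F^*$, in which the arcs of $Q_2$ are inner arcs. **Strips.** A strip $C_{U,F}$ consists of the vertices and arcs of $C$ in the closed region enclosed by two paths $U$ (ceiling) and $F$ (floor) with the same start $s'$ and the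 same end $t'$. Its *boundary arcs* are the arcs of $U$ and $F$ (those of the dummy ceiling are not arcs of $G$), and its other arcs are its *inner arcs*. A *slicing path* is a simple path $P$ in $C_{U,F}$, consisting of inner arcs and without boundary vertices other than its ends, from a vertex $u\neq t'$ of $F$ to either a vertex $v$ that is after $u$ on $F$ (a forward path) or an internal vertex $v$ of $U$ (an up-cross path). If $P$ is a forward path, slicing by $P$ gives the up-strip with ceiling $U$ and with floor $F$ in which the $u,v$-subpath is replaced by $P$, and the down-strip with ceiling $P$ and with the $u,v$-subpath of $F$ as floor. If $P$ is an up-cross path, it gives the up-strip with ceiling $U[s',v]$ and floor $F[s',u]\cdot P$, and the down-strip with ceiling $P\cdot U[v,t']$ and floor $F[u,t']$. **Decomposition.** The strip-slicing decomposition starts with $C_{U^*,F^*}$. If the current strip has a slicing path, the algorithm chooses a floor vertex $u$ at which a slicing path starts, slices the strip by the right-most slicing path that starts at $u$ (the one preferred by right-first search: no slicing path from $u$ branches off to its right), and recurses on the up-strip and the down-strip. Otherwise it outputs the current strip. Let $\mathcal S$ be the collection of output strips of any run. **Claim.** For every strip $C_{U,F}\in\mathcal S$, every inner arc of $C_{U,F}$,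 i.e. every $e\in E(C_{U,F})\setminus E(U\cup F)$, is useless. Consequently only boundary arcs of strips can be useful: every useful arc of $C$ is a boundary arc of some strip in $\mathcal S$. -/

import Mathlib

/-- A directed plane graph with vertex set `V`, arc set `A` and face set `Φ` (loops and parallel
arcs are allowed, and the graph need not be connected), given by the counterclockwise order of the
arcs around every vertex and by its faces.

A pair `(a, b) : A × Bool` is a *dart*: `(a, true)` is the arc `a` traversed from its tail to its
head, `(a, false)` is `a` traversed from its head to its tail. A dart is *based* at the vertex from
which it points away. `rot d` is the dart that follows `d` in the counterclockwise order around the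
vertex at which `d` is based, and `face d` is the face on the left-hand side of `d`.
Planarity is Euler's formula `|V| - |A| + |Φ| = 1 + #components`. -/
structure PlaneDigraph (V A Φ : Type*) where
  tail : A → V
  head : A → V
  rot : Equiv.Perm (A × Bool)
  face : A × Bool → Φ
  /-- the unbounded face -/
  outer : Φ
  /-- the cycles of `rot` are exactly the sets of darts based at a common vertex -/
  rot_sameCycle : ∀ d e : A × Bool, rot.SameCycle d e ↔
    (if d.2 then tail d.1 else head d.1) = (if e.2 then tail e.1 else head e.1)
  /-- the corner between `d` and `rot d` is on the left of `d` and on the right of `rot d` -/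
  face_rot : ∀ d : A × Bool, face ((rot d).1, !(rot d).2) = face d
  /-- any two faces are joined by a sequence of faces that are consecutively adjacent -/
  face_connected : ∀ f g : Φ,
    Relation.ReflTransGen (fun x y => ∃ d : A × Bool, face d = x ∧ face (d.1, !d.2) = y) f g
  euler : Nat.card V + Nat.card Φ =
    Nat.card A + 1 + Nat.card (Quot fun x y : V => ∃ a : A, tail a = x ∧ head a = y)

/-- The combinatorial data of a strip: its common start vertex and end vertex, its ceiling and its
floor, both as lists of arcs. The ceiling `none` is the dummy ceiling: a path from `start` to
`finish` through one new vertex that is not a vertex of the graph, whose two arcs are not arcs of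
the graph either. -/
structure Strip (V A : Type*) where
  start : V
  finish : V
  ceiling : Option (List A)
  floor : List A

namespace PlaneDigraph

variable {V A Φ : Type*} (G : PlaneDigraph V A Φ)

/-! ### Walks, paths, cycles, strongly connected components -/

/-- The vertex at which a dart is based. -/
def base (d : A × Bool) : V := if d.2 then G.tail d.1 else G.head d.1

/-- The degree of a vertex: indegree plus outdegree (a loop counts twice). -/
noncomputable def degree (v : V) : ℕ := Nat.card {d : A × Bool // G.base d = v}

/-- `G.IsWalk u p v`: the list of arcs `p` is a directed walk from `u` to `v`. -/
def IsWalk : V → List A → V → Prop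
  | u, [], v => u = v
  | u, a :: p, v => G.tail a = u ∧ IsWalk (G.head a) p v

/-- The list of vertices of a walk `p` that starts at `u`. -/
def verts (u : V) (p : List A) : List V := u :: p.map G.head

/-- The list of the internal vertices of a walk (all vertices but the first and the last one). -/
def internalVerts (p : List A) : List V := (p.map G.head).dropLast

/-- `p` is a simple directed path from `u` to `v`. -/
def IsPath (u : V) (p : List A) (v : V) : Prop := G.IsWalk u p v ∧ (G.verts u p).Nodup

/-- `c` is a (simple, directed) cycle: a closed walk with at least one arc that repeats no vertex
apart from returning to its start. -/
def IsCycle (c : List A) : Prop :=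
  c ≠ [] ∧ (∃ u, G.IsWalk u c u) ∧ (c.map G.tail).Nodup

/-- `v` can be reached from `u` by a directed walk. -/
def Reaches (u v : V) : Prop := ∃ p, G.IsWalk u p v

/-- `C` is the vertex set of a strongly connected component. -/
def IsSCC (C : Set V) : Prop := ∃ v, C = {w | G.Reaches v w ∧ G.Reaches w v}

/-- The arcs of the component with vertex set `C`. -/
def arcsOf (C : Set V) : Set A := {a | G.tail a ∈ C ∧ G.head a ∈ C}

/-- The arc `a` is useful: it is contained in a simple path from `s` to `t`. -/
def Useful (s t : V) (a : A) : Prop := ∃ p, G.IsPath s p t ∧ a ∈ p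

/-! ### Regions -/

/-- The face on the left of an arc. -/
def leftFace (a : A) : Φ := G.face (a, true)

/-- The face on the right of an arc. -/
def rightFace (a : A) : Φ := G.face (a, false)

/-- The face `f` lies in the unbounded region of the plane minus the arcs in `S`: it can be joined
to the unbounded face by crossing only arcs that are not in `S`. -/
def InOuterRegion (S : Set A) (f : Φ) : Prop :=
  Relation.ReflTransGen
    (fun x y => ∃ d : A × Bool, d.1 ∉ S ∧ G.face d = x ∧ G.face (d.1, !d.2) = y) G.outer f

/-- A cycle is clockwise if the unbounded region is on its left-hand side. -/
def IsClockwiseCycle (c : List A) : Prop :=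
  G.IsCycle c ∧ ∀ a ∈ c, G.InOuterRegion {b | b ∈ c} (G.leftFace a)

/-- The vertex `v` is on the unbounded face of the plane graph. -/
def OnOuterFace (v : V) : Prop := ∃ d, G.base d = v ∧ G.face d = G.outer

/-- The vertex `v` (not in `C`) lies in the unbounded face of the component `C`, that is,
`C` does not enclose `v`. -/
def LiesOutside (C : Set V) (v : V) : Prop :=
  v ∉ C ∧ ∃ d, G.base d = v ∧ G.InOuterRegion (G.arcsOf C) (G.face d)

/-- The boundary arcs of the component `C`: its arcs on the unbounded face of `C`. -/
def componentBoundary (C : Set V) : Set A :=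
  {a | a ∈ G.arcsOf C ∧ (G.InOuterRegion (G.arcsOf C) (G.leftFace a) ∨
    G.InOuterRegion (G.arcsOf C) (G.rightFace a))}

/-- `v` is an entrance of `C`: there is a path from `s` to `v` that meets `C` only in `v`. -/
def IsEntrance (s : V) (C : Set V) (v : V) : Prop :=
  v ∈ C ∧ ∃ p, G.IsPath s p v ∧ ∀ x ∈ G.verts s p, x ∈ C → x = v

/-- `v` is an exit of `C`: there is a path from `v` to `t` that meets `C` only in `v`. -/
def IsExit (t : V) (C : Set V) (v : V) : Prop :=
  v ∈ C ∧ ∃ p, G.IsPath v p t ∧ ∀ x ∈ G.verts v p, x ∈ C → x = v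

/-- The boundary of `C` is a cycle that consists of the path `F` from `sC` to `tC` followed by the
path `Q` from `tC` to `sC`, where `sC` is an entrance, `tC` is an exit and no internal vertex of
`Q` is an entrance or an exit. In other words `F` goes along the boundary from the first entrance
to the last exit; it is the lowest floor. -/
def IsLowestFloor (s t : V) (C : Set V) (sC tC : V) (F Q : List A) : Prop :=
  G.IsCycle (F ++ Q) ∧ (∀ a, a ∈ F ++ Q ↔ a ∈ G.componentBoundary C) ∧
  G.IsPath sC F tC ∧ G.IsPath tC Q sC ∧
  G.IsEntrance s C sC ∧ G.IsExit t C tC ∧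
  ∀ x ∈ G.internalVerts Q, ¬ G.IsEntrance s C x ∧ ¬ G.IsExit t C x

/-! ### Strips of a component

Throughout, `C` is the component that is decomposed and `Q` is the part of its boundary above which
the dummy ceiling is drawn: the dummy ceiling encloses the same faces as `Q`, but the arcs of `Q`
are inner arcs of a strip with dummy ceiling. -/

/-- The boundary arcs of a strip (the arcs of its floor and of its ceiling). -/
def boundaryArcs (S : Strip V A) : Set A := {a | a ∈ S.floor ∨ ∃ U ∈ S.ceiling, a ∈ U}

/-- The vertices on the floor. -/
def floorVerts (S : Strip V A) : Set V := {v | v ∈ G.verts S.start S.floor}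

/-- The inner vertices of the ceiling that are vertices of the graph. -/
def ceilingInnerVerts (S : Strip V A) : Set V := {v | ∃ U ∈ S.ceiling, v ∈ G.internalVerts U}

/-- The boundary vertices of a strip. -/
def boundaryVerts (S : Strip V A) : Set V := G.floorVerts S ∪ G.ceilingInnerVerts S

/-- The closed curve that encloses the region of a strip. -/
def stripCurve (Q : List A) (S : Strip V A) : Set A :=
  {a | a ∈ S.floor ∨ a ∈ S.ceiling.getD Q}

/-- The arcs of a strip: the arcs of `C` in the closed region enclosed by its floor and its
ceiling, i.e. those with an enclosed face on at least one of their sides. -/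
def stripArcs (C : Set V) (Q : List A) (S : Strip V A) : Set A :=
  {a | a ∈ G.arcsOf C ∧ (¬ G.InOuterRegion (stripCurve Q S) (G.leftFace a) ∨
    ¬ G.InOuterRegion (stripCurve Q S) (G.rightFace a))}

/-- The inner arcs of a strip. -/
def innerArcs (C : Set V) (Q : List A) (S : Strip V A) : Set A :=
  G.stripArcs C Q S \ boundaryArcs S

/-- `p` is a link from `u` to `v` in the strip `S`: a path inside `S` (without boundary arcs) that
starts and ends at boundary vertices and whose other vertices are inner vertices. -/
def IsLink (C : Set V) (Q : List A) (S : Strip V A) (u : V) (p : List A) (v : V) : Prop :=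
  p ≠ [] ∧ G.IsPath u p v ∧ (∀ a ∈ p, a ∈ G.innerArcs C Q S) ∧
  u ∈ G.boundaryVerts S ∧ v ∈ G.boundaryVerts S ∧
  ∀ x ∈ G.internalVerts p, x ∉ G.boundaryVerts S

/-- `G.Slices C Q S u f p S₁ S₂`: the path `p` is a slicing path (a forward path or an up-cross
path) of the strip `S` that starts at the floor vertex `u`, the floor arc leaving `u` is `f`, and
slicing `S` by `p` yields the up-strip `S₁` and the down-strip `S₂`. -/
inductive Slices (C : Set V) (Q : List A) :
    Strip V A → V → A → List A → Strip V A → Strip V A → Prop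
  /-- `p` is a forward path: it goes from `u` to a vertex `v` after `u` on the floor. -/
  | forward {s' t' u v : V} {U : Option (List A)} {F₁ F₂ F₃ p : List A} {f : A}
      (hp : G.IsLink C Q ⟨s', t', U, F₁ ++ (f :: F₂) ++ F₃⟩ u p v)
      (h₁ : G.IsWalk s' F₁ u) (h₂ : G.IsWalk u (f :: F₂) v) (h₃ : G.IsWalk v F₃ t') :
      Slices C Q ⟨s', t', U, F₁ ++ (f :: F₂) ++ F₃⟩ u f p
        ⟨s', t', U, F₁ ++ p ++ F₃⟩ ⟨u, v, some p, f :: F₂⟩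
  /-- `p` is an up-cross path: it goes from the floor vertex `u` to an inner vertex `v` of the
  ceiling. -/
  | upCross {s' t' u v : V} {U₁ U₂ F₁ F₂ p : List A} {f : A}
      (hp : G.IsLink C Q ⟨s', t', some (U₁ ++ U₂), F₁ ++ (f :: F₂)⟩ u p v)
      (h₁ : G.IsWalk s' F₁ u) (h₂ : G.IsWalk u (f :: F₂) t')
      (k₁ : G.IsWalk s' U₁ v) (k₂ : G.IsWalk v U₂ t') (n₁ : U₁ ≠ []) (n₂ : U₂ ≠ []) :
      Slices C Q ⟨s', t', some (U₁ ++ U₂), F₁ ++ (f :: F₂)⟩ u f p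
        ⟨s', v, some U₁, F₁ ++ p⟩ ⟨u, t', some (p ++ U₂), f :: F₂⟩

/-- When turning counterclockwise around a vertex, starting from the dart `d`, one meets the dart
`x` strictly before the dart `y` (and `y` before returning to `d`). -/
def CcwBefore (d x y : A × Bool) : Prop :=
  ∃ j k : ℕ, 0 < j ∧ j < k ∧ (G.rot ^ j) d = x ∧ (G.rot ^ k) d = y ∧
    ∀ i, 0 < i → i ≤ k → (G.rot ^ i) d ≠ d

/-- The path `p'` branches off to the right of the path `p`, where both start at the tail of the
floor arc `f`: after a common initial part `c`, the next arc `b'` of `p'` precedes the next arc `b`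
of `p` in the counterclockwise order around their common tail that starts with the arc through
which this vertex has been entered (with the floor arc `f` if `c` is empty). -/
def BranchesRight (f : A) (p' p : List A) : Prop :=
  ∃ (c r r' : List A) (b b' : A), p' = c ++ b' :: r' ∧ p = c ++ b :: r ∧
    G.CcwBefore ((c.getLast?.map fun a => (a, false)).getD (f, true)) (b', true) (b, true)

/-- `p` slices `S` into `S₁` and `S₂` and is the right-most slicing path with its start vertex. -/
def RightmostSlices (C : Set V) (Q : List A) (S : Strip V A) (p : List A) (S₁ S₂ : Strip V A) :
    Prop :=
  ∃ u f, G.Slices C Q S u f p S₁ S₂ ∧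
    ∀ p' T₁ T₂, G.Slices C Q S u f p' T₁ T₂ → ¬ G.BranchesRight f p' p

/-- `G.Decomposition C Q S 𝒮`: some run of the strip-slicing decomposition algorithm on the strip
`S` outputs the collection `𝒮`. A strip without a slicing path is output as it is; otherwise a
floor vertex is chosen at which a slicing path starts, the strip is sliced by the right-most
slicing path from there, and the two parts are decomposed recursively. -/
inductive Decomposition (C : Set V) (Q : List A) : Strip V A → List (Strip V A) → Prop
  | minimal {S : Strip V A} (h : ∀ u f p S₁ S₂, ¬ G.Slices C Q S u f p S₁ S₂) :
      Decomposition C Q S [S]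
  | slice {S S₁ S₂ : Strip V A} {p : List A} {L₁ L₂ : List (Strip V A)}
      (h : G.RightmostSlices C Q S p S₁ S₂)
      (h₁ : Decomposition C Q S₁ L₁) (h₂ : Decomposition C Q S₂ L₂) :
      Decomposition C Q S (L₁ ++ L₂)

end PlaneDigraph

/-!
A circulation is the jump of a potential on the faces; for a closed walk this potential is the
winding number. Closed walks decompose into cycles, so without clockwise cycles their potentials
are nonnegative.

Let a simple path from `s` to `t` use an inner arc of a strip. The segment around this arc between
boundary vertices of the strip is a link. It does not start on the ceiling: ceilings arise from
right-most slicing paths, and a path that leaves such a ceiling into the strip below it would have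
branched off to the right. So the link starts at a vertex `u` of the floor. If it ends on the
ceiling or after `u` on the floor, it is a slicing path. If it ends before `u` on the floor, the
simple path closes up, with the floor and with the walks that connect the strip to `s` and `t`, to
a closed walk whose potential would have to be negative somewhere. Hence a strip without slicing
paths has no useful inner arcs.
-/

namespace PlaneDigraph

variable {V A Φ : Type*} {G : PlaneDigraph V A Φ}

/-! ### Walks -/

section Walks

variable {u v w x : V} {p q : List A} {a : A}

lemma IsWalk.append (hp : G.IsWalk u p v) (hq : G.IsWalk v q w) : G.IsWalk u (p ++ q) w := by
  induction p generalizing u with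
  | nil => cases hp; exact hq
  | cons a p ih => exact ⟨hp.1, ih hp.2⟩

lemma isWalk_append : G.IsWalk u (p ++ q) w ↔ ∃ v, G.IsWalk u p v ∧ G.IsWalk v q w := by
  refine ⟨fun h => ?_, fun ⟨v, hp, hq⟩ => hp.append hq⟩
  induction p generalizing u with
  | nil => exact ⟨u, rfl, h⟩
  | cons a p ih =>
    obtain ⟨v, hp, hq⟩ := ih h.2
    exact ⟨v, ⟨h.1, hp⟩, hq⟩

lemma isWalk_concat : G.IsWalk u (p ++ [a]) v ↔ G.IsWalk u p (G.tail a) ∧ G.head a = v := by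
  rw [isWalk_append]
  constructor
  · rintro ⟨x, h, rfl, h'⟩; exact ⟨h, h'⟩
  · rintro ⟨h, h'⟩; exact ⟨_, h, rfl, h'⟩

lemma IsWalk.end_unique (h : G.IsWalk u p v) (h' : G.IsWalk u p w) : v = w := by
  induction p generalizing u with
  | nil => exact h.symm.trans h'
  | cons a p ih => exact ih h.2 h'.2

lemma IsWalk.exists_cons_of_ne (h : G.IsWalk u p v) (huv : u ≠ v) :
    ∃ a q, p = a :: q ∧ G.tail a = u ∧ G.IsWalk (G.head a) q v := by
  cases p with
  | nil => exact absurd h huv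
  | cons a q => exact ⟨a, q, rfl, h.1, h.2⟩

lemma IsWalk.exists_concat_of_ne_nil (h : G.IsWalk u p v) (hp : p ≠ []) :
    ∃ q a, p = q ++ [a] ∧ G.IsWalk u q (G.tail a) ∧ G.head a = v := by
  obtain ⟨q, a, rfl⟩ := (List.eq_nil_or_concat' p).resolve_left hp
  exact ⟨q, a, rfl, isWalk_concat.1 h⟩

lemma IsWalk.verts_eq (h : G.IsWalk u p v) : G.verts u p = p.map G.tail ++ [v] := by
  induction p generalizing u with
  | nil => cases h; rfl
  | cons a p ih => exact congrArg₂ List.cons h.1.symm (ih h.2)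

lemma verts_append : G.verts u (p ++ q) = G.verts u p ++ q.map G.head := by simp [verts]

lemma mem_verts_iff_head : x ∈ G.verts u p ↔ x = u ∨ ∃ a ∈ p, G.head a = x := by simp [verts]

lemma IsWalk.mem_verts_iff_tail (h : G.IsWalk u p v) :
    x ∈ G.verts u p ↔ x = v ∨ ∃ a ∈ p, G.tail a = x := by
  rw [h.verts_eq]; simp [or_comm]

lemma start_mem_verts : u ∈ G.verts u p := List.mem_cons_self

lemma IsWalk.end_mem_verts (h : G.IsWalk u p v) : v ∈ G.verts u p :=
  h.mem_verts_iff_tail.2 (Or.inl rfl)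

lemma head_mem_verts (ha : a ∈ p) : G.head a ∈ G.verts u p :=
  mem_verts_iff_head.2 (Or.inr ⟨a, ha, rfl⟩)

lemma IsWalk.tail_mem_verts (h : G.IsWalk u p v) (ha : a ∈ p) : G.tail a ∈ G.verts u p :=
  h.mem_verts_iff_tail.2 (Or.inr ⟨a, ha, rfl⟩)

lemma IsWalk.mem_verts_append (hp : G.IsWalk u p v) :
    x ∈ G.verts u (p ++ q) ↔ x ∈ G.verts u p ∨ x ∈ G.verts v q := by
  have hv := hp.end_mem_verts
  simp only [verts, List.mem_cons, List.map_append, List.mem_append, List.mem_map] at hv ⊢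
  grind

lemma IsWalk.exists_split_of_mem (h : G.IsWalk u p v) (hx : x ∈ G.verts u p) :
    ∃ p₁ p₂, p = p₁ ++ p₂ ∧ G.IsWalk u p₁ x ∧ G.IsWalk x p₂ v := by
  rcases mem_verts_iff_head.1 hx with rfl | ⟨a, ha, rfl⟩
  · exact ⟨[], p, rfl, rfl, h⟩
  · obtain ⟨p₁, p₂, rfl⟩ := List.append_of_mem ha
    obtain ⟨y, h₁, h₂⟩ := isWalk_append.1 h
    exact ⟨p₁ ++ [a], p₂, by simp, h₁.append ⟨h₂.1, rfl⟩, h₂.2⟩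

lemma IsWalk.exists_split_at_first (h : G.IsWalk u p v) (P : V → Prop) (hv : P v) :
    ∃ p₁ p₂ y, p = p₁ ++ p₂ ∧ G.IsWalk u p₁ y ∧ G.IsWalk y p₂ v ∧ P y ∧
      ∀ a ∈ p₁, ¬ P (G.tail a) := by
  induction p generalizing u with
  | nil => cases h; exact ⟨[], [], _, rfl, rfl, rfl, hv, by simp⟩
  | cons a p ih =>
    by_cases hu : P u
    · exact ⟨[], a :: p, u, rfl, rfl, h, hu, by simp⟩
    · obtain ⟨p₁, p₂, y, rfl, h₁, h₂, hy, hp⟩ := ih h.2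
      exact ⟨a :: p₁, p₂, y, rfl, ⟨h.1, h₁⟩, h₂, hy, List.forall_mem_cons.2 ⟨h.1 ▸ hu, hp⟩⟩

lemma IsWalk.exists_split_at_last (h : G.IsWalk u p v) (P : V → Prop) (hu : P u) :
    ∃ p₁ p₂ y, p = p₁ ++ p₂ ∧ G.IsWalk u p₁ y ∧ G.IsWalk y p₂ v ∧ P y ∧
      ∀ a ∈ p₂, ¬ P (G.head a) := by
  induction p using List.reverseRecOn generalizing v with
  | nil => cases h; exact ⟨[], [], u, rfl, rfl, rfl, hu, by simp⟩
  | append_singleton p a ih =>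
    obtain ⟨h₁, rfl⟩ := isWalk_concat.1 h
    by_cases hv : P (G.head a)
    · exact ⟨p ++ [a], [], _, by simp, h, rfl, hv, by simp⟩
    · obtain ⟨p₁, p₂, y, rfl, k₁, k₂, hy, hp⟩ := ih h₁
      exact ⟨p₁, p₂ ++ [a], y, by simp, k₁, isWalk_concat.2 ⟨k₂, rfl⟩, hy,
        List.forall_mem_append.2 ⟨hp, List.forall_mem_singleton.2 hv⟩⟩

lemma IsWalk.exists_suffix_of_mem (h : G.IsWalk u p v) (ha : a ∈ p) :
    ∃ p₁ p₂, p = p₁ ++ p₂ ∧ p₂ ≠ [] ∧ G.IsWalk (G.tail a) p₂ v := by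
  obtain ⟨p₁, p₂, rfl⟩ := List.append_of_mem ha
  obtain ⟨x, -, h₂⟩ := isWalk_append.1 h
  exact ⟨p₁, a :: p₂, rfl, List.cons_ne_nil a p₂, rfl, h₂.2⟩

lemma IsWalk.exists_prefix_of_mem (h : G.IsWalk u p v) (ha : a ∈ p) :
    ∃ p₁ p₂, p = p₁ ++ p₂ ∧ p₁ ≠ [] ∧ G.IsWalk u p₁ (G.head a) := by
  obtain ⟨p₁, p₂, rfl⟩ := List.append_of_mem ha
  obtain ⟨x, h₁, h₂⟩ := isWalk_append.1 h
  exact ⟨p₁ ++ [a], p₂, by simp, by simp, h₁.append ⟨h₂.1, rfl⟩⟩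

lemma IsWalk.notMem_of_base {d : A × Bool} (h : G.IsWalk u p v) (hx : x ∉ G.verts u p)
    (hd : G.base d = x) : d.1 ∉ p := by
  obtain ⟨a, b⟩ := d
  subst hd
  intro ha
  cases b
  exacts [hx (head_mem_verts ha), hx (h.tail_mem_verts ha)]

end Walks

/-! ### Paths -/

section Paths

variable {u v w x : V} {p q : List A} {a b : A}

lemma IsPath.of_append_left (h : G.IsPath u (p ++ q) w) (hp : G.IsWalk u p v) :
    G.IsPath u p v :=
  ⟨hp, (verts_append ▸ h.2).of_append_left⟩

lemma IsWalk.verts_append_eq (hp : G.IsWalk u p v) :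
    G.verts u (p ++ q) = p.map G.tail ++ G.verts v q := by
  rw [verts_append, hp.verts_eq, List.append_assoc]
  rfl

lemma IsPath.of_append_right (h : G.IsPath u (p ++ q) w) (hp : G.IsWalk u p v) :
    G.IsPath v q w := by
  obtain ⟨v', hp', hq⟩ := isWalk_append.1 h.1
  cases hp.end_unique hp'
  exact ⟨hq, (hp.verts_append_eq ▸ h.2).of_append_right⟩

lemma IsPath.append (hp : G.IsPath u p v) (hq : G.IsPath v q w)
    (h : ∀ a ∈ q, G.head a ∉ G.verts u p) : G.IsPath u (p ++ q) w := by
  refine ⟨hp.1.append hq.1, ?_⟩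
  rw [verts_append, List.nodup_append]
  refine ⟨hp.2, (List.nodup_cons.1 hq.2).2, ?_⟩
  rintro x hx y hy rfl
  obtain ⟨a, ha, rfl⟩ := List.mem_map.1 hy
  exact h a ha hx

lemma IsPath.head_notMem_of_append (h : G.IsPath u (p ++ q) w) (ha : a ∈ q) :
    G.head a ∉ G.verts u p := fun hx =>
  (List.nodup_append.1 (verts_append ▸ h.2)).2.2 _ hx _ (List.mem_map_of_mem ha) rfl

lemma IsPath.tail_notMem_of_append (h : G.IsPath u (p ++ q) w) (hp : G.IsWalk u p v)
    (ha : a ∈ p) : G.tail a ∉ G.verts v q := fun hx =>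
  (List.nodup_append.1 (hp.verts_append_eq ▸ h.2)).2.2 _ (List.mem_map_of_mem ha) _ hx rfl

lemma IsPath.eq_of_mem_of_mem (h : G.IsPath u (p ++ q) w) (hp : x ∈ G.verts u p)
    (hq : x ∈ G.verts v q) : x = v := by
  rcases mem_verts_iff_head.1 hq with rfl | ⟨a, ha, rfl⟩
  · rfl
  · exact absurd hp (h.head_notMem_of_append ha)

lemma IsPath.nodup (h : G.IsPath u p v) : p.Nodup :=
  List.Nodup.of_map _ (List.nodup_cons.1 h.2).2

lemma IsPath.nodup_tail (h : G.IsPath u p v) : (p.map G.tail).Nodup :=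
  (h.1.verts_eq ▸ h.2).of_append_left

lemma IsPath.eq_of_tail (h : G.IsPath u p v) (ha : a ∈ p) (hb : b ∈ p)
    (hab : G.tail a = G.tail b) : a = b :=
  List.inj_on_of_nodup_map h.nodup_tail ha hb hab

lemma IsPath.eq_of_head (h : G.IsPath u p v) (ha : a ∈ p) (hb : b ∈ p)
    (hab : G.head a = G.head b) : a = b :=
  List.inj_on_of_nodup_map (List.nodup_cons.1 h.2).2 ha hb hab

lemma IsPath.head_ne_start (h : G.IsPath u p v) (ha : a ∈ p) : G.head a ≠ u := fun e =>
  (List.nodup_cons.1 h.2).1 (e ▸ List.mem_map_of_mem ha)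

lemma IsPath.tail_ne_end (h : G.IsPath u p v) (ha : a ∈ p) : G.tail a ≠ v :=
  (List.nodup_append.1 (h.1.verts_eq ▸ h.2)).2.2 _ (List.mem_map_of_mem ha) _
    (List.mem_singleton_self v)

lemma IsPath.ne (h : G.IsPath u p v) (hp : p ≠ []) : u ≠ v := by
  obtain ⟨q, a, rfl, -, rfl⟩ := h.1.exists_concat_of_ne_nil hp
  exact (h.head_ne_start (by simp)).symm

lemma IsWalk.exists_isPath (h : G.IsWalk u p v) : ∃ q, G.IsPath u q v ∧ ∀ a ∈ q, a ∈ p := by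
  induction p generalizing u with
  | nil => exact ⟨[], ⟨h, by simp [verts]⟩, by simp⟩
  | cons a p ih =>
    obtain ⟨q, hq, hqp⟩ := ih h.2
    by_cases hu : u ∈ G.verts (G.head a) q
    · obtain ⟨q₁, q₂, rfl, h₁, -⟩ := hq.1.exists_split_of_mem hu
      exact ⟨q₂, hq.of_append_right h₁, fun b hb => by simp [hqp b (by simp [hb])]⟩
    · exact ⟨a :: q, ⟨⟨h.1, hq.1⟩, List.nodup_cons.2 ⟨hu, hq.2⟩⟩,
        fun b hb => List.mem_cons.2 ((List.mem_cons.1 hb).imp_right (hqp b))⟩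

end Paths

/-! ### Internal vertices -/

section InternalVerts

variable {u v w x : V} {p q : List A} {a : A}

lemma internalVerts_concat : G.internalVerts (p ++ [a]) = p.map G.head := by simp [internalVerts]

lemma IsWalk.mem_internalVerts (h : G.IsWalk u p v) :
    x ∈ G.internalVerts p ↔ ∃ p₁ p₂, p₁ ≠ [] ∧ p₂ ≠ [] ∧ p = p₁ ++ p₂ ∧ G.IsWalk u p₁ x ∧
      G.IsWalk x p₂ v := by
  rcases List.eq_nil_or_concat' p with rfl | ⟨q, a, rfl⟩
  · simp [internalVerts]
  obtain ⟨h₁, h₂⟩ := isWalk_concat.1 h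
  rw [internalVerts_concat, List.mem_map]
  constructor
  · rintro ⟨b, hb, rfl⟩
    obtain ⟨q₁, q₂, rfl⟩ := List.append_of_mem hb
    obtain ⟨y, k₁, k₂⟩ := isWalk_append.1 h₁
    exact ⟨q₁ ++ [b], q₂ ++ [a], by simp, by simp, by simp, k₁.append ⟨k₂.1, rfl⟩,
      isWalk_concat.2 ⟨k₂.2, h₂⟩⟩
  · rintro ⟨p₁, p₂, n₁, n₂, e, k₁, k₂⟩
    obtain ⟨p₃, b, rfl, -, rfl⟩ := k₁.exists_concat_of_ne_nil n₁
    obtain ⟨p₄, c, rfl⟩ := (List.eq_nil_or_concat' p₂).resolve_left n₂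
    rw [← List.append_assoc] at e
    exact ⟨b, by simp [(List.append_inj' e rfl).1], rfl⟩

lemma head_mem_internalVerts (hq : q ≠ []) (ha : a ∈ p) :
    G.head a ∈ G.internalVerts (p ++ q) := by
  obtain ⟨r, b, rfl⟩ := (List.eq_nil_or_concat' q).resolve_left hq
  rw [← List.append_assoc, internalVerts_concat, List.map_append]
  exact List.mem_append_left _ (List.mem_map_of_mem ha)

lemma IsWalk.mem_verts_iff_internalVerts (h : G.IsWalk u p v) :
    x ∈ G.verts u p ↔ x = u ∨ x = v ∨ x ∈ G.internalVerts p := by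
  rcases List.eq_nil_or_concat' p with rfl | ⟨q, a, rfl⟩
  · cases h; simp [verts, internalVerts]
  · rw [internalVerts_concat, ← (isWalk_concat.1 h).2]
    simp only [verts, List.map_append, List.map_cons, List.map_nil, List.mem_cons,
      List.mem_append, List.not_mem_nil, or_false]
    grind

lemma IsWalk.head_eq_or_mem_internalVerts (h : G.IsWalk u p v) (ha : a ∈ p) :
    G.head a = v ∨ G.head a ∈ G.internalVerts p := by
  obtain ⟨q, b, rfl, -, rfl⟩ := h.exists_concat_of_ne_nil (List.ne_nil_of_mem ha)
  rcases List.mem_append.1 ha with ha | ha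
  · exact Or.inr (head_mem_internalVerts (by simp) ha)
  · exact Or.inl (List.mem_singleton.1 ha ▸ rfl)

lemma IsWalk.tail_eq_or_mem_internalVerts (h : G.IsWalk u p v) (ha : a ∈ p) :
    G.tail a = u ∨ G.tail a ∈ G.internalVerts p := by
  obtain ⟨p₁, p₂, rfl⟩ := List.append_of_mem ha
  obtain ⟨_, h₁, rfl, -⟩ := isWalk_append.1 h
  rcases p₁.eq_nil_or_concat' with rfl | ⟨q, b, rfl⟩
  · exact Or.inl (Eq.symm h₁)
  · rw [← (isWalk_concat.1 h₁).2]
    exact Or.inr (head_mem_internalVerts (by simp) (by simp))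

lemma IsPath.ne_ends_of_mem_internalVerts (h : G.IsPath u p v) (hx : x ∈ G.internalVerts p) :
    x ≠ u ∧ x ≠ v := by
  obtain ⟨p₁, p₂, n₁, n₂, rfl, k₁, -⟩ := h.1.mem_internalVerts.1 hx
  exact ⟨((h.of_append_left k₁).ne n₁).symm, (h.of_append_right k₁).ne n₂⟩

lemma IsWalk.exists_consecutive_of_mem_internalVerts (h : G.IsWalk u p v)
    (hx : x ∈ G.internalVerts p) :
    ∃ p₁ a b p₂, p = p₁ ++ a :: b :: p₂ ∧ G.head a = x ∧ G.tail b = x := by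
  obtain ⟨p₁, p₂, n₁, n₂, rfl, h₁, h₂⟩ := h.mem_internalVerts.1 hx
  obtain ⟨q, a, rfl, -, ha⟩ := h₁.exists_concat_of_ne_nil n₁
  obtain ⟨b, r, rfl⟩ := List.exists_cons_of_ne_nil n₂
  exact ⟨q, a, b, r, by simp, ha, h₂.1⟩

lemma mem_internalVerts_append_left (hx : x ∈ G.internalVerts p) :
    x ∈ G.internalVerts (p ++ q) := by
  rcases eq_or_ne q [] with rfl | hq
  · rwa [List.append_nil]
  · rw [internalVerts, List.map_append, List.dropLast_append_of_ne_nil (by simpa using hq)]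
    exact List.mem_append_left _ (List.mem_of_mem_dropLast hx)

lemma mem_internalVerts_append_right (hx : x ∈ G.internalVerts q) :
    x ∈ G.internalVerts (p ++ q) := by
  rcases eq_or_ne q [] with rfl | hq
  · simp [internalVerts] at hx
  · rw [internalVerts, List.map_append, List.dropLast_append_of_ne_nil (by simpa using hq)]
    exact List.mem_append_right _ hx

lemma IsWalk.end_mem_internalVerts_append (hp : G.IsWalk u p v) (hp' : p ≠ []) (hq : q ≠ []) :
    v ∈ G.internalVerts (p ++ q) := by
  obtain ⟨r, a, rfl, -, rfl⟩ := hp.exists_concat_of_ne_nil hp'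
  exact head_mem_internalVerts hq (by simp)

lemma IsWalk.mem_internalVerts_of_append (hp : G.IsWalk u p v) (hx : x ∈ G.internalVerts (p ++ q)) :
    x ∈ G.internalVerts p ∨ x = v ∨ x ∈ G.internalVerts q := by
  rcases eq_or_ne q [] with rfl | hq
  · exact Or.inl (by rwa [List.append_nil] at hx)
  · rw [internalVerts, List.map_append, List.dropLast_append_of_ne_nil (by simpa using hq)] at hx
    rcases List.mem_append.1 hx with hx | hx
    · obtain ⟨a, ha, rfl⟩ := List.mem_map.1 hx
      exact (hp.head_eq_or_mem_internalVerts ha).elim (Or.inr ∘ Or.inl) Or.inl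
    · exact Or.inr (Or.inr hx)

lemma IsPath.append_of_internalVerts (hp : G.IsPath u p v) (hq : G.IsPath v q w)
    (hw : w ∉ G.verts u p) (hi : ∀ x ∈ G.internalVerts q, x ∉ G.verts u p) :
    G.IsPath u (p ++ q) w :=
  hp.append hq fun _ ha hx => (hq.1.head_eq_or_mem_internalVerts ha).elim
    (fun h => hw (h ▸ hx)) fun h => hi _ h hx

end InternalVerts

/-! ### Strongly connected components -/

section Components

variable {u v w x y z : V} {p : List A} {a : A} {C : Set V}

lemma IsWalk.reaches_of_mem (h : G.IsWalk u p v) (hx : x ∈ G.verts u p) :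
    G.Reaches u x ∧ G.Reaches x v := by
  obtain ⟨p₁, p₂, -, h₁, h₂⟩ := h.exists_split_of_mem hx
  exact ⟨⟨_, h₁⟩, ⟨_, h₂⟩⟩

lemma Reaches.trans (h : G.Reaches u v) (h' : G.Reaches v w) : G.Reaches u w := by
  obtain ⟨p, hp⟩ := h
  obtain ⟨q, hq⟩ := h'
  exact ⟨_, hp.append hq⟩

lemma IsSCC.reaches (h : G.IsSCC C) (hx : x ∈ C) (hy : y ∈ C) : G.Reaches x y := by
  obtain ⟨v, rfl⟩ := h
  exact hx.2.trans hy.1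

lemma IsSCC.mem_of_reaches (h : G.IsSCC C) (hx : x ∈ C) (hz : z ∈ C) (hxy : G.Reaches x y)
    (hyz : G.Reaches y z) : y ∈ C := by
  obtain ⟨v, rfl⟩ := h
  exact ⟨hx.1.trans hxy, hyz.trans hz.2⟩

lemma IsSCC.mem_of_walk (h : G.IsSCC C) (hp : G.IsWalk x p z) (hx : x ∈ C) (hz : z ∈ C)
    (hy : y ∈ G.verts x p) : y ∈ C :=
  h.mem_of_reaches hx hz (hp.reaches_of_mem hy).1 (hp.reaches_of_mem hy).2

lemma IsSCC.mem_arcsOf_of_walk (h : G.IsSCC C) (hp : G.IsWalk x p z) (hx : x ∈ C) (hz : z ∈ C)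
    (ha : a ∈ p) : a ∈ G.arcsOf C :=
  ⟨h.mem_of_walk hp hx hz (hp.tail_mem_verts ha), h.mem_of_walk hp hx hz (head_mem_verts ha)⟩

end Components

/-! ### Faces and regions -/

section Regions

variable {K L : Set A} {f g k : Φ} {d e : A × Bool} {a : A} {u v x : V} {p : List A}
  {α : Type*} {φ : Φ → α}

/-- The dart `d` traversed in the opposite direction. -/
abbrev rev (d : A × Bool) : A × Bool := (d.1, !d.2)

@[simp] lemma rev_rev (d : A × Bool) : rev (rev d) = d := Prod.ext rfl (Bool.not_not _)

lemma base_true (a : A) : G.base (a, true) = G.tail a := rfl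

lemma base_false (a : A) : G.base (a, false) = G.head a := rfl

/-- The face `g` can be reached from the face `f` without crossing an arc in `K`. -/
def Joined (G : PlaneDigraph V A Φ) (K : Set A) (f g : Φ) : Prop :=
  Relation.ReflTransGen
    (fun x y => ∃ d : A × Bool, d.1 ∉ K ∧ G.face d = x ∧ G.face (rev d) = y) f g

lemma Joined.symm (h : G.Joined K f g) : G.Joined K g f := by
  induction h with
  | refl => exact .refl
  | tail _ hd ih =>
    obtain ⟨d, hd, rfl, rfl⟩ := hd
    exact .head ⟨rev d, hd, rfl, by rw [rev_rev]⟩ ih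

lemma Joined.trans (h : G.Joined K f g) (h' : G.Joined K g k) : G.Joined K f k :=
  Relation.ReflTransGen.trans h h'

lemma joined_rev (hd : d.1 ∉ K) : G.Joined K (G.face d) (G.face (rev d)) :=
  .single ⟨d, hd, rfl, rfl⟩

lemma joined_empty (f g : Φ) : G.Joined ∅ f g :=
  Relation.ReflTransGen.mono (fun _ _ ⟨d, h⟩ => ⟨d, Set.notMem_empty _, h⟩) f g
    (G.face_connected f g)

lemma Joined.apply_eq (h : G.Joined K f g)
    (hφ : ∀ a ∉ K, φ (G.leftFace a) = φ (G.rightFace a)) : φ f = φ g := by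
  induction h with
  | refl => rfl
  | tail _ hd ih =>
    obtain ⟨⟨a, b⟩, ha, rfl, rfl⟩ := hd
    rw [ih]
    cases b
    · exact (hφ a ha).symm
    · exact hφ a ha

lemma inOuterRegion_outer (K : Set A) : G.InOuterRegion K G.outer := Relation.ReflTransGen.refl

lemma inOuterRegion_rev (hd : d.1 ∉ K) :
    G.InOuterRegion K (G.face d) ↔ G.InOuterRegion K (G.face (rev d)) :=
  ⟨fun h => Joined.trans h (joined_rev hd), fun h => Joined.trans h (joined_rev hd).symm⟩

lemma inOuterRegion_left_iff_right (ha : a ∉ K) :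
    G.InOuterRegion K (G.leftFace a) ↔ G.InOuterRegion K (G.rightFace a) :=
  inOuterRegion_rev (d := (a, true)) ha

lemma InOuterRegion.mono (h : G.InOuterRegion K f)
    (hL : ∀ a ∈ L, a ∉ K → ¬ G.InOuterRegion K (G.leftFace a) ∨
      ¬ G.InOuterRegion K (G.rightFace a)) : G.InOuterRegion L f := by
  induction h with
  | refl => exact inOuterRegion_outer L
  | @tail x y hx hd ih =>
    obtain ⟨d, hK, rfl, rfl⟩ := hd
    have hx' : G.InOuterRegion K (G.face d) := hx
    refine (inOuterRegion_rev fun hdL => ?_).1 ih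
    have hy := (inOuterRegion_rev hK).1 hx'
    obtain ⟨a, b⟩ := d
    rcases hL a hdL hK with h | h <;> cases b
    exacts [h hy, h hx', h hx', h hy]

/-! ### Turning around a vertex -/

lemma base_rot (d : A × Bool) : G.base (G.rot d) = G.base d :=
  ((G.rot_sameCycle d (G.rot d)).1 (Equiv.Perm.sameCycle_apply_right.2 (.refl _ _))).symm

lemma base_rot_pow (n : ℕ) (d : A × Bool) : G.base ((G.rot ^ n) d) = G.base d := by
  induction n with
  | zero => rfl
  | succ n ih => rw [pow_succ', Equiv.Perm.mul_apply, base_rot, ih]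

lemma sameCycle_of_base (h : G.base d = G.base e) : G.rot.SameCycle d e :=
  (G.rot_sameCycle d e).2 h

lemma face_rev_rot_pow_eq {n : ℕ}
    (h : ∀ i, 0 < i → i ≤ n →
      φ (G.face ((G.rot ^ i) d)) = φ (G.face (rev ((G.rot ^ i) d)))) :
    φ (G.face (rev ((G.rot ^ (n + 1)) d))) = φ (G.face d) := by
  induction n with
  | zero => exact congrArg φ (G.face_rot d)
  | succ n ih =>
    rw [← ih fun i hi hin => h i hi (by omega), ← h (n + 1) (by omega) le_rfl, pow_succ' _ (n + 1)]
    exact congrArg φ (G.face_rot _)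

lemma face_eq_of_two [Finite A] (hb : G.base d = G.base e) (hne : d ≠ e)
    (hflat : ∀ x, G.base x = G.base d → x ≠ d → x ≠ e → φ (G.face x) = φ (G.face (rev x))) :
    φ (G.face d) = φ (G.face (rev e)) := by
  classical
  have hex : ∃ m : ℕ, (G.rot ^ m) d = e := (sameCycle_of_base hb).exists_nat_pow_eq
  obtain ⟨n, hn, hmin⟩ : ∃ n : ℕ, (G.rot ^ n) d = e ∧ ∀ j < n, (G.rot ^ j) d ≠ e :=
    ⟨Nat.find hex, Nat.find_spec hex, fun j hj => Nat.find_min hex hj⟩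
  obtain ⟨k, rfl⟩ := Nat.exists_eq_succ_of_ne_zero fun h : n = 0 => hne (by rwa [h] at hn)
  refine (hn ▸ face_rev_rot_pow_eq fun i hi hik => ?_).symm
  refine hflat _ (base_rot_pow _ _) (fun h => ?_) (hmin _ (by omega))
  refine hmin (k + 1 - i) (by omega) ?_
  rw [← hn, show k.succ = k + 1 - i + i by omega, pow_add, Equiv.Perm.mul_apply, h]

/-- No arc at the vertex `x` separates faces with different values of `φ`. -/
def Flat (G : PlaneDigraph V A Φ) (φ : Φ → α) (x : V) : Prop :=
  ∀ d, G.base d = x → φ (G.face d) = φ (G.face (rev d))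

lemma Flat.of_notMem (h : ∀ d, G.base d = x → d.1 ∉ K) : G.Flat (G.InOuterRegion K) x :=
  fun d hd => propext (inOuterRegion_rev (h d hd))

lemma Flat.face_eq [Finite A] (h : G.Flat φ x) (hd : G.base d = x) (he : G.base e = x) :
    φ (G.face d) = φ (G.face e) := by
  by_cases hne : d = e
  · rw [hne]
  · rw [h e he]
    exact face_eq_of_two (hd.trans he.symm) hne fun y hy _ _ => h y (hy.trans hd)

lemma Flat.face_rev_eq [Finite A] (h : G.Flat φ x) (hd : G.base d = x) (he : G.base e = x) :
    φ (G.face d) = φ (G.face (rev e)) := by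
  rw [← h e he]
  exact h.face_eq hd he

lemma IsWalk.flat_tails [Finite A] (hp : G.IsWalk u p v) (h : ∀ a ∈ p, G.Flat φ (G.tail a))
    (hd : G.base d = u) :
    ∀ a ∈ p, φ (G.leftFace a) = φ (G.face d) ∧ φ (G.rightFace a) = φ (G.face d) := by
  induction p generalizing u d with
  | nil => simp only [List.not_mem_nil, false_implies, implies_true]
  | cons b p ih =>
    have hb : G.Flat φ u := hp.1 ▸ h b List.mem_cons_self
    have left : φ (G.leftFace b) = φ (G.face d) := hb.face_eq hp.1 hd
    have right : φ (G.rightFace b) = φ (G.face d) :=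
      (hb.face_rev_eq hd (e := (b, true)) hp.1).symm
    rintro a (_ | ⟨_, ha⟩)
    · exact ⟨left, right⟩
    · obtain ⟨left', right'⟩ :=
        ih hp.2 (fun a ha => h a (List.mem_cons_of_mem b ha)) (d := (b, false)) rfl a ha
      exact ⟨left'.trans right, right'.trans right⟩

lemma IsWalk.flat_heads [Finite A] (hp : G.IsWalk u p v) (h : ∀ a ∈ p, G.Flat φ (G.head a))
    (hd : G.base d = v) :
    ∀ a ∈ p, φ (G.leftFace a) = φ (G.face d) ∧ φ (G.rightFace a) = φ (G.face d) := by
  induction p using List.reverseRecOn generalizing v d with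
  | nil => simp only [List.not_mem_nil, false_implies, implies_true]
  | append_singleton p b ih =>
    obtain ⟨hp', hbv⟩ := isWalk_concat.1 hp
    have hb : G.Flat φ v := hbv ▸ h b List.mem_concat_self
    have right : φ (G.rightFace b) = φ (G.face d) := hb.face_eq hbv hd
    have left : φ (G.leftFace b) = φ (G.face d) :=
      (hb.face_rev_eq hd (e := (b, false)) hbv).symm
    intro a ha
    rcases List.mem_append.1 ha with ha | ha
    · obtain ⟨left', right'⟩ :=
        ih hp' (fun a ha => h a (List.mem_append_left _ ha)) (d := (b, true)) rfl a ha
      exact ⟨left'.trans left, right'.trans left⟩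
    · rw [List.mem_singleton.1 ha]
      exact ⟨left, right⟩

end Regions

/-! ### Multiplicities -/

section Multiplicities

variable {p q : List A} {a b : A}

open Classical in
/-- The number of times that the walk `p` uses the arc `a`; it is a rational number so that
linear algebra applies to the functions `mult p`. -/
noncomputable def mult (p : List A) (a : A) : ℚ := p.count a

@[simp] lemma mult_nil (a : A) : mult [] a = 0 := rfl

lemma mult_append (p q : List A) (a : A) : mult (p ++ q) a = mult p a + mult q a := by
  classical
  rw [mult, List.count_append, Nat.cast_add]
  rfl

open Classical in
lemma mult_cons (b : A) (p : List A) (a : A) :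
    mult (b :: p) a = (if b = a then 1 else 0) + mult p a := by
  simp only [mult, List.count_cons, beq_iff_eq, Nat.cast_add, Nat.cast_ite, Nat.cast_one,
    Nat.cast_zero, add_comm]

lemma mult_of_notMem (h : a ∉ p) : mult p a = 0 := by
  classical
  rw [mult, List.count_eq_zero_of_not_mem h, Nat.cast_zero]

lemma one_le_mult (h : a ∈ p) : 1 ≤ mult p a := by
  classical
  exact Nat.one_le_cast.2 (List.one_le_count_iff.2 h)

lemma mult_of_mem (hp : p.Nodup) (h : a ∈ p) : mult p a = 1 := by
  classical
  rw [mult, List.count_eq_one_of_mem hp h, Nat.cast_one]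

end Multiplicities

/-! ### Potentials -/

section Potentials

variable {h h' : Φ → ℚ} {c c' : A → ℚ} {u v x : V} {p q : List A}

open Classical in
/-- The incidence matrix; it maps a flow on the arcs to the net inflow at every vertex. -/
noncomputable def incidence (G : PlaneDigraph V A Φ) : Matrix V A ℚ :=
  fun x a => (if G.head a = x then 1 else 0) - (if G.tail a = x then 1 else 0)

open Classical in
lemma incidence_mulVec_apply [Fintype A] (c : A → ℚ) (x : V) :
    (G.incidence.mulVec c) x =
      ∑ a, ((if G.head a = x then 1 else 0) - (if G.tail a = x then 1 else 0)) * c a := rfl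

open Classical in
lemma IsWalk.incidence_mulVec_mult [Fintype A] (hp : G.IsWalk u p v) :
    G.incidence.mulVec (mult p) = Pi.single v 1 - Pi.single u 1 := by
  funext x
  rw [incidence_mulVec_apply, Pi.sub_apply, Pi.single_apply, Pi.single_apply]
  induction p generalizing u with
  | nil =>
    cases hp
    simp only [mult_nil, mul_zero, Finset.sum_const_zero, sub_self]
  | cons a p ih =>
    simp only [mult_cons, mul_add, Finset.sum_add_distrib, ih hp.2, mul_ite, mul_one, mul_zero,
      Finset.sum_ite_eq, Finset.mem_univ, if_true, hp.1, eq_comm (a := x)]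
    ring

/-- The jumps of a function on the faces from the right to the left of every arc. -/
def jump (G : PlaneDigraph V A Φ) : (Φ → ℚ) →ₗ[ℚ] A → ℚ :=
  LinearMap.funLeft ℚ ℚ G.leftFace - LinearMap.funLeft ℚ ℚ G.rightFace

lemma jump_apply (h : Φ → ℚ) (a : A) :
    G.jump h a = h (G.leftFace a) - h (G.rightFace a) := rfl

lemma incidence_mulVec_jump [Fintype A] (h : Φ → ℚ) : G.incidence.mulVec (G.jump h) = 0 := by
  classical
  funext x
  have turn : ∑ d : A × Bool, (if G.base d = x then h (G.face d) else 0) =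
      ∑ d : A × Bool, (if G.base d = x then h (G.face (rev d)) else 0) := by
    rw [← Equiv.sum_comp G.rot (fun d => if G.base d = x then h (G.face (rev d)) else 0)]
    exact Finset.sum_congr rfl fun d _ => by rw [base_rot, G.face_rot]
  rw [Fintype.sum_prod_type, Fintype.sum_prod_type] at turn
  simp only [Fintype.sum_bool, base_true, base_false, rev, Bool.not_true, Bool.not_false] at turn
  rw [← sub_eq_zero, ← Finset.sum_sub_distrib, ← neg_eq_zero, ← Finset.sum_neg_distrib] at turn
  rw [incidence_mulVec_apply]
  refine Eq.trans (Finset.sum_congr rfl fun a _ => ?_) turn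
  by_cases hh : G.head a = x <;> by_cases ht : G.tail a = x <;>
    simp only [jump_apply, leftFace, rightFace, hh, ht, if_true, if_false] <;> ring

lemma eq_of_jump_eq_zero (hh : G.jump h = 0) (f g : Φ) : h f = h g :=
  (joined_empty f g).apply_eq fun a _ => sub_eq_zero.1 (congrFun hh a)

lemma finrank_ker_jump_le_one : Module.finrank ℚ (LinearMap.ker G.jump) ≤ 1 := by
  have constant : LinearMap.ker G.jump ≤ Submodule.span ℚ {fun _ => (1 : ℚ)} := fun h hh =>
    Submodule.mem_span_singleton.2 ⟨h G.outer, funext fun f =>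
      (mul_one _).trans (eq_of_jump_eq_zero (LinearMap.mem_ker.1 hh) G.outer f)⟩
  exact (Submodule.finrank_mono constant).trans
    (finrank_span_singleton fun h₀ => one_ne_zero (congrFun h₀ G.outer)).le

lemma finrank_ker_transpose_incidence_le [Fintype V] :
    Module.finrank ℚ (LinearMap.ker G.incidence.transpose.mulVecLin) ≤
      Nat.card (Quot fun x y : V => ∃ a : A, G.tail a = x ∧ G.head a = y) := by
  classical
  let r := fun x y : V => ∃ a : A, G.tail a = x ∧ G.head a = y
  have constant : LinearMap.ker G.incidence.transpose.mulVecLin ≤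
      LinearMap.range (LinearMap.funLeft ℚ ℚ (Quot.mk r)) := by
    intro g hg
    have hga (a : A) : g (G.head a) - g (G.tail a) = 0 := by
      have : ∑ x, ((if G.head a = x then 1 else 0) - (if G.tail a = x then (1 : ℚ) else 0)) *
          g x = 0 := congrFun (LinearMap.mem_ker.1 hg) a
      simpa only [sub_mul, Finset.sum_sub_distrib, ite_mul, one_mul, zero_mul, Finset.sum_ite_eq,
        Finset.mem_univ, if_true] using this
    refine ⟨Quot.lift g ?_, rfl⟩
    rintro _ _ ⟨a, rfl, rfl⟩
    exact (sub_eq_zero.1 (hga a)).symm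
  have := Fintype.ofFinite (Quot r)
  calc _ ≤ _ := Submodule.finrank_mono constant
    _ ≤ _ := LinearMap.finrank_range_le _
    _ = Nat.card (Quot r) := by
      rw [Module.finrank_fintype_fun_eq_card, Nat.card_eq_fintype_card]

lemma range_jump_eq_ker_incidence [Finite V] [Fintype A] [Finite Φ] :
    LinearMap.range G.jump = LinearMap.ker G.incidence.mulVecLin := by
  have := Fintype.ofFinite V
  have := Fintype.ofFinite Φ
  have hle : LinearMap.range G.jump ≤ LinearMap.ker G.incidence.mulVecLin := by
    rintro _ ⟨h, rfl⟩
    exact LinearMap.mem_ker.2 (incidence_mulVec_jump h)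
  have rank_jump := LinearMap.finrank_range_add_finrank_ker G.jump
  have rank_inc := LinearMap.finrank_range_add_finrank_ker G.incidence.mulVecLin
  have rank_transpose := LinearMap.finrank_range_add_finrank_ker G.incidence.transpose.mulVecLin
  have row_rank : Module.finrank ℚ (LinearMap.range G.incidence.transpose.mulVecLin) =
      Module.finrank ℚ (LinearMap.range G.incidence.mulVecLin) := G.incidence.rank_transpose
  have ker_jump := G.finrank_ker_jump_le_one
  have ker_transpose := G.finrank_ker_transpose_incidence_le
  have euler := G.euler
  rw [Nat.card_eq_fintype_card, Nat.card_eq_fintype_card, Nat.card_eq_fintype_card] at euler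
  rw [Module.finrank_fintype_fun_eq_card] at rank_jump rank_inc rank_transpose
  exact Submodule.eq_of_le_of_finrank_le hle (by omega)

/-- `h` is the potential on the faces, normalized by `h G.outer = 0`, whose jump from the right to
the left of the arc `a` is `c a`. If `c = mult p` for a closed walk `p`, then `h` is its winding
number. -/
def IsPotential (G : PlaneDigraph V A Φ) (h : Φ → ℚ) (c : A → ℚ) : Prop :=
  h G.outer = 0 ∧ ∀ a, h (G.leftFace a) - h (G.rightFace a) = c a

lemma IsPotential.add (H : G.IsPotential h c) (H' : G.IsPotential h' c') :
    G.IsPotential (h + h') (c + c') := by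
  refine ⟨by rw [Pi.add_apply, H.1, H'.1, add_zero], fun a => ?_⟩
  rw [Pi.add_apply, Pi.add_apply, Pi.add_apply, add_sub_add_comm, H.2, H'.2]

lemma IsPotential.unique (H : G.IsPotential h c) (H' : G.IsPotential h' c) : h = h' := by
  have hjump : G.jump (h - h') = 0 := by
    rw [map_sub, sub_eq_zero]
    exact (funext H.2).trans (funext H'.2).symm
  funext f
  have := eq_of_jump_eq_zero hjump f G.outer
  rwa [Pi.sub_apply, Pi.sub_apply, H.1, H'.1, sub_self, sub_eq_zero] at this

lemma IsPotential.flat (H : G.IsPotential h c) (hx : ∀ d, G.base d = x → c d.1 = 0) :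
    G.Flat h x := by
  rintro ⟨a, b⟩ hd
  have ha := sub_eq_zero.1 ((H.2 a).trans (hx _ hd))
  cases b
  exacts [ha.symm, ha]

lemma exists_potential_of_circulation [Finite V] [Fintype A] [Finite Φ]
    (hc : G.incidence.mulVec c = 0) : ∃ h, G.IsPotential h c := by
  obtain ⟨h, rfl⟩ : c ∈ LinearMap.range G.jump := by
    rwa [range_jump_eq_ker_incidence, LinearMap.mem_ker, Matrix.mulVecLin_apply]
  exact ⟨fun f => h f - h G.outer, sub_self _, fun a => sub_sub_sub_cancel_right _ _ _⟩

lemma exists_potential [Finite V] [Finite A] [Finite Φ]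
    (hp : G.IsWalk u p v) (hq : G.IsWalk u q v) :
    ∃ h, G.IsPotential h (fun a => mult p a - mult q a) := by
  have := Fintype.ofFinite A
  refine exists_potential_of_circulation (c := mult p - mult q) ?_
  rw [Matrix.mulVec_sub, hp.incidence_mulVec_mult, hq.incidence_mulVec_mult, sub_self]

lemma exists_potential_closed [Finite V] [Finite A] [Finite Φ] (hp : G.IsWalk u p u) :
    ∃ h, G.IsPotential h (mult p) := by
  obtain ⟨h, hh⟩ := exists_potential hp (show G.IsWalk u [] u from rfl)
  exact ⟨h, hh.1, fun a => (hh.2 a).trans (sub_zero _)⟩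

end Potentials

/-! ### The Jordan curve theorem -/

section Jordan

variable {u v w : V} {p : List A} {D E : List (A × Bool)} {d e x : A × Bool} {K : Set A}
  {h : Φ → ℚ}

/-- The list of darts `D` is a walk from `u` to `v`. Unlike in `IsWalk`, the arcs may be traversed
in either direction. -/
def IsDartWalk (G : PlaneDigraph V A Φ) : V → List (A × Bool) → V → Prop
  | u, [], v => u = v
  | u, d :: D, v => G.base d = u ∧ IsDartWalk G (G.base (rev d)) D v

lemma IsDartWalk.append (hD : G.IsDartWalk u D v) (hE : G.IsDartWalk v E w) :
    G.IsDartWalk u (D ++ E) w := by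
  induction D generalizing u with
  | nil =>
    cases hD
    exact hE
  | cons d D ih => exact ⟨hD.1, ih hD.2⟩

lemma IsWalk.darts (hp : G.IsWalk u p v) : G.IsDartWalk u (p.map fun a => (a, true)) v := by
  induction p generalizing u with
  | nil => exact hp
  | cons a p ih => exact ⟨hp.1, ih hp.2⟩

lemma IsWalk.darts_reverse (hp : G.IsWalk u p v) :
    G.IsDartWalk v (p.reverse.map fun a => (a, false)) u := by
  induction p generalizing u with
  | nil => exact hp.symm
  | cons a p ih =>
    rw [List.reverse_cons, List.map_append]
    exact (ih hp.2).append ⟨rfl, hp.1⟩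

lemma IsDartWalk.bases_eq (hD : G.IsDartWalk u D v) :
    u :: D.map (fun d => G.base (rev d)) = D.map G.base ++ [v] := by
  induction D generalizing u with
  | nil =>
    cases hD
    rfl
  | cons d D ih =>
    rw [List.map_cons, List.map_cons, ih hD.2, hD.1]
    rfl

/-- `D` is a simple closed curve: a nonempty closed walk that may traverse arcs backwards and
repeats neither vertices nor arcs. The latter excludes the curve that traverses one arc back and
forth. -/
structure IsDartCycle (G : PlaneDigraph V A Φ) (D : List (A × Bool)) : Prop where
  ne_nil : D ≠ []
  closed : ∃ u, G.IsDartWalk u D u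
  nodup_base : (D.map G.base).Nodup
  nodup_arc : (D.map Prod.fst).Nodup

lemma eq_or_eq_rev_of_fst_eq (h : d.1 = e.1) : d = e ∨ d = rev e := by
  obtain ⟨a, b⟩ := d
  obtain ⟨a', b'⟩ := e
  cases h
  cases b <;> cases b' <;> simp only [rev, Bool.not_true, Bool.not_false, true_or, or_true]

lemma joined_of_two [Finite A] (hb : G.base d = G.base e) (hne : d ≠ e)
    (h : ∀ x, G.base x = G.base d → x ≠ d → x ≠ e → x.1 ∉ K) :
    G.Joined K (G.face d) (G.face (rev e)) := by
  rw [← face_eq_of_two (φ := G.Joined K (G.face d)) hb hne fun x hx hxd hxe => ?_]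
  · exact .refl
  · have hK := h x hx hxd hxe
    exact propext ⟨fun h => h.trans (joined_rev hK), fun h => h.trans (joined_rev hK).symm⟩

namespace IsDartCycle

variable (hD : G.IsDartCycle D)

include hD

lemma nodup_base_rev : (D.map fun d => G.base (rev d)).Nodup := by
  obtain ⟨u, hw⟩ := hD.closed
  have hperm : (u :: D.map fun d => G.base (rev d)).Perm (u :: D.map G.base) :=
    hw.bases_eq ▸ List.perm_append_singleton _ _
  exact hperm.cons_inv.nodup_iff.2 hD.nodup_base

lemma rev_ne (hd : d ∈ D) (he : e ∈ D) : rev d ≠ e := by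
  rintro rfl
  have := congrArg Prod.snd (List.inj_on_of_nodup_map hD.nodup_arc hd he rfl)
  exact Bool.self_ne_not _ this

variable (hK : ∀ a, a ∈ K ↔ ∃ d ∈ D, d.1 = a)

include hK

lemma notMem_of_base (hd : d ∈ D) (he : e ∈ D) (hde : G.base (rev d) = G.base e)
    (hx : G.base x = G.base e) (hxe : x ≠ e) (hxd : x ≠ rev d) : x.1 ∉ K := by
  intro hxK
  obtain ⟨y, hy, hyx⟩ := (hK _).1 hxK
  rcases eq_or_eq_rev_of_fst_eq hyx.symm with rfl | rfl
  · exact hxe (List.inj_on_of_nodup_map hD.nodup_base hy he hx)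
  · exact hxd (congrArg rev
      (List.inj_on_of_nodup_map hD.nodup_base_rev hy hd (hx.trans hde.symm)))

lemma joined_next [Finite A] (hd : d ∈ D) (he : e ∈ D) (hde : G.base (rev d) = G.base e) :
    G.Joined K (G.face d) (G.face e) ∧ G.Joined K (G.face (rev d)) (G.face (rev e)) := by
  constructor
  · have := joined_of_two hde.symm (hD.rev_ne hd he).symm fun x hx hxe hxd =>
      hD.notMem_of_base hK hd he hde hx hxe hxd
    rw [rev_rev] at this
    exact this.symm
  · exact joined_of_two hde (hD.rev_ne hd he) fun x hx hxd hxe =>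
      hD.notMem_of_base hK hd he hde (hx.trans hde) hxe hxd

lemma joined_of_dartWalk [Finite A] (hd : d ∈ D) (hE : G.IsDartWalk (G.base (rev d)) E v)
    (hED : E ⊆ D) :
    ∀ e ∈ E, G.Joined K (G.face d) (G.face e) ∧
      G.Joined K (G.face (rev d)) (G.face (rev e)) := by
  induction E generalizing d with
  | nil => simp only [List.not_mem_nil, false_implies, implies_true]
  | cons b E ih =>
    have hb : b ∈ D := hED List.mem_cons_self
    obtain ⟨left, right⟩ := hD.joined_next hK hd hb hE.1.symm
    rintro e (_ | ⟨_, he⟩)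
    · exact ⟨left, right⟩
    · exact (ih hb hE.2 (fun e he => hED (List.mem_cons_of_mem b he)) e he).imp left.trans
        right.trans

lemma exists_sides [Finite A] :
    ∃ d ∈ D, ∀ e ∈ D, G.Joined K (G.face d) (G.face e) ∧
      G.Joined K (G.face (rev d)) (G.face (rev e)) := by
  obtain ⟨d, E, rfl⟩ := List.exists_cons_of_ne_nil hD.ne_nil
  obtain ⟨u, hw⟩ := hD.closed
  refine ⟨d, List.mem_cons_self, ?_⟩
  rintro e (_ | ⟨_, he⟩)
  · exact ⟨.refl, .refl⟩
  · exact hD.joined_of_dartWalk hK List.mem_cons_self hw.2 (List.subset_cons_self d E) e he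

lemma exists_joined_or_joined [Finite A] :
    ∃ d ∈ D, ∀ f, G.Joined K f (G.face d) ∨ G.Joined K f (G.face (rev d)) := by
  obtain ⟨d, hd, sides⟩ := hD.exists_sides hK
  refine ⟨d, hd, fun f => ?_⟩
  induction G.face_connected (G.face d) f with
  | refl => exact .inl .refl
  | tail _ hx ih =>
    obtain ⟨x, rfl, rfl⟩ := hx
    by_cases hxK : x.1 ∈ K
    · obtain ⟨e, he, hex⟩ := (hK _).1 hxK
      rcases eq_or_eq_rev_of_fst_eq hex.symm with rfl | rfl
      · exact .inr (sides x he).2.symm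
      · refine .inl ?_
        rw [show ((rev e).1, !(rev e).2) = e from rev_rev e]
        exact (sides e he).1.symm
    · exact ih.imp (joined_rev hxK).symm.trans (joined_rev hxK).symm.trans

theorem jordan [Finite A] (h₀ : h G.outer = 0)
    (h₁ : ∀ d ∈ D, h (G.face d) - h (G.face (rev d)) = 1)
    (h₂ : ∀ a ∉ K, h (G.leftFace a) = h (G.rightFace a)) :
    (∀ f, h f = 0 ↔ G.InOuterRegion K f) ∧
      ((∀ f, h f = 0 ∨ h f = 1) ∨ ∀ f, h f = 0 ∨ h f = -1) := by
  obtain ⟨d, hd, sides⟩ := hD.exists_joined_or_joined hK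
  have h_eq {f g} (hfg : G.Joined K f g) : h f = h g := hfg.apply_eq h₂
  have hne : h (G.face d) ≠ h (G.face (rev d)) := fun heq => by
    have := h₁ d hd
    rw [heq, sub_self] at this
    exact zero_ne_one this
  refine ⟨fun f => ⟨fun hf => ?_, fun hf => (h_eq hf).symm.trans h₀⟩, ?_⟩
  · have hfo : h f = h G.outer := hf.trans h₀.symm
    rcases sides f with left | right <;> rcases sides G.outer with left' | right'
    · exact left'.trans left.symm
    · exact absurd ((h_eq left).symm.trans (hfo.trans (h_eq right'))) hne
    · exact absurd ((h_eq left').symm.trans (hfo.symm.trans (h_eq right))) hne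
    · exact right'.trans right.symm
  · rcases sides G.outer with left | right
    · refine .inr fun f => (sides f).imp (fun hf => ?_) (fun hf => ?_) <;>
        linarith [h_eq hf, h_eq left, h₁ d hd]
    · refine .inl fun f => (sides f).symm.imp (fun hf => ?_) (fun hf => ?_) <;>
        linarith [h_eq hf, h_eq right, h₁ d hd]

end IsDartCycle

end Jordan

/-! ### Nonnegative potentials -/

section NoClockwise

variable {u v : V} {p c : List A} {h : Φ → ℚ}

lemma IsCycle.isDartCycle (hc : G.IsCycle c) : G.IsDartCycle (c.map fun a => (a, true)) where
  ne_nil := mt List.map_eq_nil_iff.1 hc.1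
  closed := hc.2.1.imp fun _ => IsWalk.darts
  nodup_base := by
    rw [List.map_map]
    exact hc.2.2
  nodup_arc := by
    rw [List.map_map]
    exact (List.map_id c).symm ▸ hc.2.2.of_map

theorem IsCycle.potential_eq_zero_or_one [Finite A]
    (no_clockwise : ∀ c : List A, ¬ G.IsClockwiseCycle c) (hc : G.IsCycle c)
    (H : G.IsPotential h (mult c)) (f : Φ) : h f = 0 ∨ h f = 1 := by
  have jump_one : ∀ a ∈ c, h (G.leftFace a) - h (G.rightFace a) = 1 := fun a ha => by
    rw [H.2, mult_of_mem hc.2.2.of_map ha]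
  have jump_zero : ∀ a ∉ c, h (G.leftFace a) = h (G.rightFace a) := fun a ha =>
    sub_eq_zero.1 ((H.2 a).trans (mult_of_notMem ha))
  obtain ⟨zero_iff, values⟩ := hc.isDartCycle.jordan (K := {a | a ∈ c})
    (fun a => by simp only [Set.mem_ofPred_eq, List.mem_map, exists_exists_and_eq_and,
      exists_eq_right]) H.1 (List.forall_mem_map.2 jump_one) jump_zero
  refine values.resolve_right (fun neg => no_clockwise c ⟨hc, fun a ha => ?_⟩) f
  rw [← zero_iff]
  have := jump_one a ha
  rcases neg (G.leftFace a) with hl | hl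
  · exact hl
  · rcases neg (G.rightFace a) with hr | hr <;> rw [hl, hr] at this <;> norm_num at this

lemma IsWalk.exists_closed_subwalk (hp : G.IsWalk u p v) (hnd : ¬ (p.map G.tail).Nodup) :
    ∃ x p₁ p₂ p₃, p = p₁ ++ p₂ ++ p₃ ∧ G.IsWalk u p₁ x ∧ G.IsWalk x p₂ x ∧ G.IsWalk x p₃ v ∧
      p₂ ≠ [] ∧ p₃ ≠ [] := by
  induction p generalizing u with
  | nil => exact absurd List.nodup_nil hnd
  | cons a p ih =>
    by_cases ha : G.tail a ∈ p.map G.tail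
    · obtain ⟨b, hb, hba⟩ := List.mem_map.1 ha
      obtain ⟨q, r, rfl⟩ := List.append_of_mem hb
      obtain ⟨x, hq, hr⟩ := isWalk_append.1 hp.2
      obtain rfl : x = u := hr.1.symm.trans (hba.trans hp.1)
      exact ⟨x, [], a :: q, b :: r, rfl, rfl, ⟨hp.1, hq⟩, hr, List.cons_ne_nil _ _,
        List.cons_ne_nil _ _⟩
    · obtain ⟨x, p₁, p₂, p₃, rfl, hp₁, hrest⟩ :=
        ih hp.2 fun hnd' => hnd (List.nodup_cons.2 ⟨ha, hnd'⟩)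
      exact ⟨x, a :: p₁, p₂, p₃, rfl, ⟨hp.1, hp₁⟩, hrest⟩

theorem IsWalk.exists_nonneg_potential [Finite V] [Finite A] [Finite Φ]
    (no_clockwise : ∀ c : List A, ¬ G.IsClockwiseCycle c) (hp : G.IsWalk u p u) :
    ∃ h, G.IsPotential h (mult p) ∧ ∀ f, 0 ≤ h f := by
  induction hn : p.length using Nat.strong_induction_on generalizing u p with
  | _ n ih =>
    subst hn
    by_cases hnd : (p.map G.tail).Nodup
    · obtain ⟨h, H⟩ := exists_potential_closed hp
      refine ⟨h, H, fun f => ?_⟩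
      rcases eq_or_ne p [] with rfl | hne
      · exact (congrFun (H.unique (h' := 0) ⟨rfl, fun _ => sub_self 0⟩) f).ge
      · rcases IsCycle.potential_eq_zero_or_one no_clockwise ⟨hne, ⟨u, hp⟩, hnd⟩ H f with
          hf | hf <;> rw [hf]
        exact zero_le_one
    · obtain ⟨x, p₁, p₂, p₃, rfl, h₁, h₂, h₃, hne₂, hne₃⟩ := hp.exists_closed_subwalk hnd
      have hlen₂ := List.length_pos_iff.2 hne₂
      have hlen₃ := List.length_pos_iff.2 hne₃
      simp only [List.length_append] at ih
      obtain ⟨h, H, hh⟩ := ih _ (by omega) h₂ rfl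
      obtain ⟨h', H', hh'⟩ := ih (p₁ ++ p₃).length
        (by rw [List.length_append]; omega) (h₁.append h₃) rfl
      refine ⟨h + h', ?_, fun f => add_nonneg (hh f) (hh' f)⟩
      convert H.add H' using 1
      funext a
      simp only [mult_append, Pi.add_apply]
      ring

end NoClockwise

/-! ### Paths that run through a link backwards -/

section BackwardLinks

variable {s t u v x y z : V} {C : Set V} {p q r r₁ r₂ L I O P₁ P₂ : List A} {a b l l' i o : A}
  {h : Φ → ℚ} {c : A → ℚ}

lemma LiesOutside.exists_dart (hs : G.LiesOutside C s) :
    ∃ d, G.base d = s ∧ ∀ (h : Φ → ℚ) (c : A → ℚ), G.IsPotential h c →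
      (∀ a ∉ G.arcsOf C, c a = 0) → h (G.face d) = 0 := by
  obtain ⟨-, d, hd, ho⟩ := hs
  refine ⟨d, hd, fun h c H hc => ?_⟩
  rw [← H.1]
  exact (Joined.apply_eq ho fun a ha => sub_eq_zero.1 ((H.2 a).trans (hc a ha))).symm

lemma IsSCC.mult_eq_zero (hC : G.IsSCC C) (hx : x ∈ C) (hp : G.IsWalk x p x)
    (ha : a ∉ G.arcsOf C) : mult p a = 0 :=
  mult_of_notMem fun h => ha (hC.mem_arcsOf_of_walk hp hx hx h)

lemma IsPotential.apply_leftFace_eq [Finite A] (H : G.IsPotential h c) (hp : G.IsPath u p v)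
    (hc : ∀ d, G.base d ∈ G.internalVerts p → d.1 ∉ p → c d.1 = 0) (ha : a ∈ p) (hb : b ∈ p) :
    h (G.leftFace a) = h (G.leftFace b) := by
  let R : A → A → Prop := fun a b => h (G.leftFace a) = h (G.leftFace b)
  have : Std.Symm R := ⟨fun _ _ => Eq.symm⟩
  have : IsTrans A R := ⟨fun _ _ _ => Eq.trans⟩
  have step : p.IsChain R := by
    refine List.isChain_iff_forall_rel_of_append_cons_cons.2 fun a b p₁ p₂ e => ?_
    have ha : a ∈ p := by simp [e]
    have hb : b ∈ p := by simp [e]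
    obtain ⟨hab, hx⟩ : G.tail b = G.head a ∧ G.head a ∈ G.internalVerts p := by
      have e' : p = (p₁ ++ [a]) ++ (b :: p₂) := by simp [e]
      obtain ⟨x, h₁, h₂⟩ := isWalk_append.1 (e' ▸ hp.1)
      exact ⟨h₂.1.trans (isWalk_concat.1 h₁).2.symm,
        e' ▸ head_mem_internalVerts (List.cons_ne_nil b p₂) List.mem_concat_self⟩
    refine (face_eq_of_two (φ := h) (d := (b, true)) (e := (a, false)) hab (by simp) ?_).symm
    rintro ⟨k, β⟩ hk hkb hka
    have hkp : k ∉ p := fun hkp => by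
      cases β
      · exact hka (by rw [hp.eq_of_head hkp ha (hk.trans hab)])
      · exact hkb (by rw [hp.eq_of_tail hkp hb hk])
    have := sub_eq_zero.1 ((H.2 k).trans (hc (k, β) ((hk.trans hab).symm ▸ hx) hkp))
    cases β
    exacts [this.symm, this]
  exact step.pairwise.forall_of_forall (R := R) (fun _ _ => rfl) ha hb

/-- A path `L` from `u` to `v` on the left of a walk from `s` to `v` with last arc `i` and of a
disjoint walk from `u` to `t` with first arc `o`: a path from `s` to `t` through `L` would have to
run backwards between these two walks. The last three fields describe the order of the arcs around
`u` and around `v`; `l` and `l'` are the first and the last arc of `L`. -/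
structure IsBackwardLink (G : PlaneDigraph V A Φ) (s t u v : V) (L I O : List A)
    (l l' i o : A) : Prop where
  walk_in : G.IsWalk s (I ++ [i]) v
  walk_out : G.IsWalk u (o :: O) t
  disjoint : ∀ x ∈ G.verts s (I ++ [i]), x ∉ G.verts u (o :: O)
  tail_ne : ∀ a ∈ I ++ [i], G.tail a ≠ v
  first_mem : l ∈ L
  last_mem : l' ∈ L
  head_last : G.head l' = v
  internal_in : ∀ x ∈ G.internalVerts L, x ∉ G.verts s (I ++ [i])
  internal_out : ∀ x ∈ G.internalVerts L, x ∉ G.verts u (o :: O)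
  left_start : ∀ k, G.head k = u → G.leftFace l = G.leftFace k
  right_start : G.rightFace l = G.leftFace o
  right_end : G.rightFace l' = G.leftFace i

namespace IsBackwardLink

lemma start_notMem_in (B : G.IsBackwardLink s t u v L I O l l' i o) :
    u ∉ G.verts s (I ++ [i]) := fun h => B.disjoint _ h start_mem_verts

lemma end_notMem_out (B : G.IsBackwardLink s t u v L I O l l' i o) :
    v ∉ G.verts u (o :: O) := B.disjoint _ B.walk_in.end_mem_verts

lemma tail_mem_in (B : G.IsBackwardLink s t u v L I O l l' i o) (ha : a ∈ I ++ [i]) :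
    G.tail a ∈ G.verts s (I ++ [i]) := B.walk_in.tail_mem_verts ha

lemma tail_notMem_out (B : G.IsBackwardLink s t u v L I O l l' i o) (ha : a ∈ I ++ [i]) :
    G.tail a ∉ G.verts u (o :: O) := B.disjoint _ (B.tail_mem_in ha)

lemma head_notMem_in (B : G.IsBackwardLink s t u v L I O l l' i o) (ha : a ∈ o :: O) :
    G.head a ∉ G.verts s (I ++ [i]) := fun h => B.disjoint _ h (head_mem_verts ha)

variable (G I O i o) in
/-- The vertex `x` lies on the walk from `s` before `v` or on the walk to `t` after `u`. -/
def Hit (x : V) : Prop := (∃ a ∈ I ++ [i], G.tail a = x) ∨ ∃ a ∈ o :: O, G.head a = x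

lemma hit_source (B : G.IsBackwardLink s t u v L I O l l' i o) : Hit G I O i o s := by
  obtain ⟨a, q, e⟩ := List.exists_cons_of_ne_nil (List.concat_ne_nil i I)
  exact Or.inl ⟨a, e ▸ List.mem_cons_self, (e ▸ B.walk_in).1⟩

lemma hit_sink (B : G.IsBackwardLink s t u v L I O l l' i o) : Hit G I O i o t := by
  obtain ⟨q, a, e, -, h⟩ := B.walk_out.exists_concat_of_ne_nil (List.cons_ne_nil o O)
  exact Or.inr ⟨a, e ▸ List.mem_concat_self, h⟩

lemma eq_or_not_hit_of_head (hq : ∀ a ∈ q, ¬ Hit G I O i o (G.head a)) (hx : x ∈ G.verts z q) :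
    x = z ∨ ¬ Hit G I O i o x :=
  (mem_verts_iff_head.1 hx).imp_right fun ⟨a, ha, hax⟩ => hax ▸ hq a ha

lemma eq_or_not_hit_of_tail (hp : ∀ a ∈ p, ¬ Hit G I O i o (G.tail a)) (hp' : G.IsWalk v p y)
    (hx : x ∈ G.verts v p) : x = y ∨ ¬ Hit G I O i o x :=
  (hp'.mem_verts_iff_tail.1 hx).imp_right fun ⟨a, ha, hax⟩ => hax ▸ hp a ha

lemma leftFace_last_eq [Finite A] (B : G.IsBackwardLink s t u v L I O l l' i o)
    (hL : G.IsWalk u L v) (hLp : G.IsPath u (L ++ p) y) (hr : ∀ a ∈ r, a ∈ o :: O)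
    (H : G.IsPotential h fun a => mult r a - mult (L ++ p) a) :
    h (G.leftFace l') = h (G.leftFace l) := by
  refine H.apply_leftFace_eq (hLp.of_append_left hL) (fun d hd hdL => ?_) B.last_mem B.first_mem
  have hdv := hL.mem_verts_iff_internalVerts.2 (Or.inr (Or.inr hd))
  have hdp : d.1 ∉ p := (hLp.of_append_right hL).1.notMem_of_base (fun hdp =>
    ((hLp.of_append_left hL).ne_ends_of_mem_internalVerts hd).2
      (hLp.eq_of_mem_of_mem hdv hdp)) rfl
  have hdr : d.1 ∉ r := fun hm =>
    B.walk_out.notMem_of_base (B.internal_out _ hd) rfl (hr _ hm)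
  rw [mult_of_notMem hdr, mult_append, mult_of_notMem hdL, mult_of_notMem hdp, add_zero, sub_self]

variable [Finite V] [Finite A] [Finite Φ]

/- The closed walk `r₁ ++ q` has a nonnegative potential. It vanishes along the walk from `s` and
then along `L`, that is, on the left of `o`, although it decreases from the left to the right
of `o`. -/
lemma false_of_walk_to_start (B : G.IsBackwardLink s t u v L I O l l' i o)
    (no_clockwise : ∀ c : List A, ¬ G.IsClockwiseCycle c) (hC : G.IsSCC C) (hu : u ∈ C)
    (hs : G.LiesOutside C s) (hL : G.IsWalk u L v) (hr : o :: O = r₁ ++ r₂) (hr₀ : r₁ ≠ [])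
    (hr₁ : G.IsWalk u r₁ z) (hq : G.IsWalk z q u)
    (hqI : ∀ a ∈ I ++ [i], G.tail a ∉ G.verts z q) (hqL : ∀ a ∈ L, G.head a ∉ G.verts z q) :
    False := by
  have ho : o ∈ r₁ := List.mem_of_mem_head? <| by
    rw [← List.head?_append_of_ne_nil _ hr₀, ← hr, List.head?_cons]
    exact rfl
  obtain ⟨h, H, hpos⟩ := (hr₁.append hq).exists_nonneg_potential no_clockwise
  have flat : ∀ x, x ∉ G.verts u (o :: O) → x ∉ G.verts z q → G.Flat h x := fun x hxO hxq =>
    H.flat fun d hd => mult_of_notMem fun hm => (List.mem_append.1 hm).elim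
      (fun hm => B.walk_out.notMem_of_base hxO hd (hr ▸ List.mem_append_left _ hm))
      (hq.notMem_of_base hxq hd)
  obtain ⟨d, hd, hd₀⟩ := hs.exists_dart
  have zero : h (G.face d) = 0 :=
    hd₀ h _ H fun a => hC.mult_eq_zero hu (hr₁.append hq)
  have along_in := B.walk_in.flat_tails (φ := h)
    (fun a ha => flat _ (B.tail_notMem_out ha) (hqI a ha)) hd i List.mem_concat_self
  have along_link := hL.flat_heads (φ := h) (d := (i, false))
    (fun a ha => flat _ ((hL.head_eq_or_mem_internalVerts ha).elim
      (fun e => e ▸ B.end_notMem_out) (B.internal_out _)) (hqL a ha))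
    (isWalk_concat.1 B.walk_in).2 l B.first_mem
  have jump := H.2 o
  rw [← B.right_start, along_link.2, ← rightFace, along_in.2, zero] at jump
  have := one_le_mult (List.mem_append_left q ho)
  linarith [hpos (G.rightFace o)]

/- The closed walk `p ++ r₂` has a nonnegative potential. It vanishes along the walk to `t` and
then along `L`, that is, on the left of `i`, although it decreases from the left to the right
of `i`. -/
lemma false_of_walk_from_end (B : G.IsBackwardLink s t u v L I O l l' i o)
    (no_clockwise : ∀ c : List A, ¬ G.IsClockwiseCycle c) (hC : G.IsSCC C) (hv : v ∈ C)
    (ht : G.LiesOutside C t) (hL : G.IsWalk u L v) (hr : I ++ [i] = r₁ ++ r₂) (hr₀ : r₂ ≠ [])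
    (hr₂ : G.IsWalk y r₂ v) (hp : G.IsWalk v p y)
    (hpO : ∀ a ∈ o :: O, G.head a ∉ G.verts v p) (hpL : ∀ a ∈ L, G.tail a ∉ G.verts v p) :
    False := by
  have hi : i ∈ r₂ := List.mem_of_getLast? <| by
    rw [← List.getLast?_append_of_ne_nil r₁ hr₀, ← hr, List.getLast?_concat]
  obtain ⟨h, H, hpos⟩ := (hp.append hr₂).exists_nonneg_potential no_clockwise
  have flat : ∀ x, x ∉ G.verts s (I ++ [i]) → x ∉ G.verts v p → G.Flat h x := fun x hxI hxp =>
    H.flat fun d hd => mult_of_notMem fun hm => (List.mem_append.1 hm).elim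
      (hp.notMem_of_base hxp hd)
      (fun hm => B.walk_in.notMem_of_base hxI hd (hr ▸ List.mem_append_right _ hm))
  obtain ⟨d, hd, hd₀⟩ := ht.exists_dart
  have zero : h (G.face d) = 0 :=
    hd₀ h _ H fun a => hC.mult_eq_zero hv (hp.append hr₂)
  have along_out := B.walk_out.flat_heads (φ := h)
    (fun a ha => flat _ (B.head_notMem_in ha) (hpO a ha)) hd o List.mem_cons_self
  have along_link := hL.flat_tails (φ := h) (d := (o, true))
    (fun a ha => flat _ ((hL.tail_eq_or_mem_internalVerts ha).elim
      (fun e => e ▸ B.start_notMem_in) (B.internal_in _)) (hpL a ha))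
    B.walk_out.1 l' B.last_mem
  have jump := H.2 i
  rw [← B.right_end, along_link.2, ← leftFace, along_out.1, zero] at jump
  have := one_le_mult (List.mem_append_right p hi)
  linarith [hpos (G.rightFace i)]

/- The potential of the closed curve that consists of `r₁` and of `L ++ p` has the same value at
`z`, on the left of `L` and, along the end of the walk from `s`, on the right of `L`; but `L`
is a part of that curve. -/
lemma false_of_walks (B : G.IsBackwardLink s t u v L I O l l' i o) (hL : G.IsWalk u L v)
    (hLp : G.IsPath u (L ++ p) y) (hr : o :: O = r₁ ++ r₂) (hr₁ : G.IsWalk u r₁ y)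
    (ha : a ∈ I ++ [i]) (hq : G.IsWalk (G.tail a) q u)
    (hqO : ∀ b ∈ q, G.tail b ∉ G.verts u (o :: O))
    (hqL : ∀ b ∈ q, G.tail b ∉ G.verts u (L ++ p))
    (hpI : ∀ b ∈ I ++ [i], G.tail b ∉ G.verts v p) : False := by
  obtain ⟨I₁, I₂, hI, hI₀, hI₂⟩ := B.walk_in.exists_suffix_of_mem ha
  have hi : i ∈ I₂ := List.mem_of_getLast? <| by
    rw [← List.getLast?_append_of_ne_nil I₁ hI₀, ← hI, List.getLast?_concat]
  have sub : ∀ b ∈ I₂, b ∈ I ++ [i] := fun b hb => hI ▸ List.mem_append_right _ hb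
  obtain ⟨h, H⟩ := exists_potential hr₁ hLp.1
  have zero_out : ∀ {d}, G.base d ∉ G.verts u (o :: O) → mult r₁ d.1 = 0 := fun hd =>
    mult_of_notMem fun hm =>
      B.walk_out.notMem_of_base hd rfl (hr ▸ List.mem_append_left _ hm)
  have flat : ∀ x, x ∉ G.verts u (o :: O) → x ∉ G.verts u (L ++ p) → G.Flat h x := by
    refine fun x hxO hxL => H.flat fun d hd => ?_
    rw [zero_out (hd ▸ hxO), mult_of_notMem (hLp.1.notMem_of_base hxL hd), sub_self]
  have hua : G.tail a ≠ u := fun e => B.start_notMem_in (e ▸ B.tail_mem_in ha)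
  obtain ⟨q', k, rfl, -, hk⟩ := hq.exists_concat_of_ne_nil (by rintro rfl; exact hua hq)
  have left_first : h (G.leftFace l) = h (G.leftFace a) := by
    rw [B.left_start k hk]
    exact (hq.flat_tails (φ := h) (fun b hb => flat _ (hqO b hb) (hqL b hb))
      (d := (a, true)) rfl k List.mem_concat_self).1
  have right_last : h (G.rightFace l') = h (G.leftFace a) := by
    rw [B.right_end]
    refine (hI₂.flat_tails (φ := h) (fun b hb => flat _ (B.tail_notMem_out (sub b hb)) ?_)
      (d := (a, true)) rfl i hi).1
    rw [IsWalk.mem_verts_append hL, hL.mem_verts_iff_internalVerts]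
    rintro ((e | e | hb') | hb')
    exacts [B.start_notMem_in (e ▸ B.tail_mem_in (sub b hb)), B.tail_ne b (sub b hb) e,
      B.internal_in _ hb' (B.tail_mem_in (sub b hb)), hpI b (sub b hb) hb']
  have left_last := B.leftFace_last_eq hL hLp (fun b hb => hr ▸ List.mem_append_left _ hb) H
  have jump : _ = mult r₁ l' - mult (L ++ p) l' := H.2 l'
  have hl' : G.base (l', false) ∉ G.verts u (o :: O) :=
    (congrArg (· ∉ G.verts u (o :: O)) B.head_last).mpr B.end_notMem_out
  rw [show mult r₁ l' = 0 from zero_out hl',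
    mult_of_mem hLp.nodup (List.mem_append_left _ B.last_mem)] at jump
  linarith

lemma last_hit_mem_in (B : G.IsBackwardLink s t u v L I O l l' i o)
    (no_clockwise : ∀ c : List A, ¬ G.IsClockwiseCycle c) (hC : G.IsSCC C) (hu : u ∈ C)
    (hs : G.LiesOutside C s) (hL : G.IsWalk u L v) (hq : G.IsWalk z q u) (hz : Hit G I O i o z)
    (hqH : ∀ a ∈ q, ¬ Hit G I O i o (G.head a)) (hqL : ∀ a ∈ L, G.head a ∉ G.verts z q) :
    ∃ a ∈ I ++ [i], G.tail a = z := by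
  refine hz.resolve_right ?_
  rintro ⟨a, ha, rfl⟩
  obtain ⟨r₁, r₂, hr, hr₀, hr₁⟩ := B.walk_out.exists_prefix_of_mem ha
  refine B.false_of_walk_to_start no_clockwise hC hu hs hL hr hr₀ hr₁ hq (fun b hb hbq => ?_) hqL
  exact (eq_or_not_hit_of_head hqH hbq).elim
    (fun e => B.tail_notMem_out hb (e ▸ head_mem_verts ha)) (· (Or.inl ⟨b, hb, rfl⟩))

lemma first_hit_mem_out (B : G.IsBackwardLink s t u v L I O l l' i o)
    (no_clockwise : ∀ c : List A, ¬ G.IsClockwiseCycle c) (hC : G.IsSCC C) (hv : v ∈ C)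
    (ht : G.LiesOutside C t) (hL : G.IsWalk u L v) (hp : G.IsWalk v p y) (hy : Hit G I O i o y)
    (hpH : ∀ a ∈ p, ¬ Hit G I O i o (G.tail a)) (hpL : ∀ a ∈ L, G.tail a ∉ G.verts v p) :
    ∃ a ∈ o :: O, G.head a = y := by
  refine hy.resolve_left ?_
  rintro ⟨a, ha, rfl⟩
  obtain ⟨r₁, r₂, hr, hr₀, hr₂⟩ := B.walk_in.exists_suffix_of_mem ha
  refine B.false_of_walk_from_end no_clockwise hC hv ht hL hr hr₀ hr₂ hp (fun b hb hbp => ?_) hpL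
  exact (eq_or_not_hit_of_tail hpH hp hbp).elim
    (fun e => B.head_notMem_in hb (e ▸ B.tail_mem_in ha)) (· (Or.inr ⟨b, hb, rfl⟩))

/- The part of the path between its last hit `z` before `u` and its first hit `y` after `v` is
`q₂ ++ L ++ p₁`. -/
theorem not_isPath (B : G.IsBackwardLink s t u v L I O l l' i o)
    (no_clockwise : ∀ c : List A, ¬ G.IsClockwiseCycle c) (hC : G.IsSCC C) (hu : u ∈ C)
    (hv : v ∈ C) (hs : G.LiesOutside C s) (ht : G.LiesOutside C t) (hP₁ : G.IsWalk s P₁ u)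
    (hL : G.IsWalk u L v) (hP₂ : G.IsWalk v P₂ t) : ¬ G.IsPath s (P₁ ++ (L ++ P₂)) t := by
  intro hP
  obtain ⟨q₁, q₂, z, rfl, hq₁, hq₂, hz, hq⟩ := hP₁.exists_split_at_last _ B.hit_source
  obtain ⟨p₁, p₂, y, rfl, hp₁, hp₂, hy, hp⟩ := hP₂.exists_split_at_first _ B.hit_sink
  have hLP : G.IsPath u (L ++ (p₁ ++ p₂)) t := hP.of_append_right hP₁
  obtain ⟨a, ha, rfl⟩ := B.last_hit_mem_in no_clockwise hC hu hs hL hq₂ hz hq fun b hb hbq =>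
    hP.head_notMem_of_append (List.mem_append_left _ hb) (hq₁.mem_verts_append.2 (Or.inr hbq))
  obtain ⟨a', ha', rfl⟩ := B.first_hit_mem_out no_clockwise hC hv ht hL hp₁ hy hp fun b hb hbp =>
    hLP.tail_notMem_of_append hL hb (hp₁.mem_verts_append.2 (Or.inl hbp))
  obtain ⟨r₁, r₂, hr, -, hr₁⟩ := B.walk_out.exists_prefix_of_mem ha'
  rw [← List.append_assoc] at hLP
  refine B.false_of_walks hL (hLP.of_append_left (hL.append hp₁)) hr hr₁ ha hq₂
    (fun b hb hbO => ?_) (fun b hb hbL => ?_) (fun b hb hbp => ?_)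
  · rcases mem_verts_iff_head.1 hbO with hbu | hbO
    · exact (hP.of_append_left hP₁).tail_ne_end (List.mem_append_right _ hb) hbu
    · refine (eq_or_not_hit_of_head hq (hq₂.tail_mem_verts hb)).elim (fun e => ?_) (· (Or.inr hbO))
      obtain ⟨c, hc, hcb⟩ := hbO
      exact B.head_notMem_in hc (hcb ▸ e ▸ B.tail_mem_in ha)
  · refine hP.tail_notMem_of_append hP₁ (List.mem_append_right _ hb) ?_
    rw [← List.append_assoc]
    exact (IsWalk.mem_verts_append (hL.append hp₁)).2 (Or.inl hbL)
  · exact (eq_or_not_hit_of_tail hp hp₁ hbp).elim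
      (fun e => B.tail_notMem_out hb (e ▸ head_mem_verts ha')) (· (Or.inl ⟨b, hb, rfl⟩))

end IsBackwardLink

end BackwardLinks

/-! ### Vertices of degree three -/

section DegreeThree

variable [Finite A] {x : V} {d d₁ d₂ d₃ : A × Bool}

lemma eq_of_three (hx : G.degree x = 3) (h₁ : G.base d₁ = x) (h₂ : G.base d₂ = x)
    (h₃ : G.base d₃ = x) (h₁₂ : d₁ ≠ d₂) (h₁₃ : d₁ ≠ d₃) (h₂₃ : d₂ ≠ d₃) (hd : G.base d = x) :
    d = d₁ ∨ d = d₂ ∨ d = d₃ := by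
  have subset : {d₁, d₂, d₃} ⊆ {d | G.base d = x} := by rintro e (rfl | rfl | rfl) <;> assumption
  have card : {d | G.base d = x}.ncard ≤ ({d₁, d₂, d₃} : Set (A × Bool)).ncard :=
    (hx.trans (Set.ncard_eq_three.2 ⟨d₁, d₂, d₃, h₁₂, h₁₃, h₂₃, rfl⟩).symm).le
  exact (Set.eq_of_subset_of_ncard_le subset card).symm.subset hd

/- The only other cyclic order of the three darts is `d₁`, `d₃`, `d₂`, in which the face on the left
of `d₁` is on the right of `d₃` and the face on the right of `d₂` is on the left of `d₃`. -/
lemma rot_of_three (hx : G.degree x = 3) (h₁ : G.base d₁ = x) (h₂ : G.base d₂ = x)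
    (h₃ : G.base d₃ = x) (h₁₂ : d₁ ≠ d₂) (h₁₃ : d₁ ≠ d₃) (h₂₃ : d₂ ≠ d₃) {R : Φ → Prop}
    (r₁ : R (G.face d₁)) (r₂ : R (G.face (rev d₂)))
    (r₃ : ¬ (R (G.face d₃) ∧ R (G.face (rev d₃)))) :
    G.rot d₁ = d₂ ∧ G.rot d₂ = d₃ ∧ G.rot d₃ = d₁ := by
  have mem : ∀ {d}, G.base d = x → G.rot d = d₁ ∨ G.rot d = d₂ ∨ G.rot d = d₃ := fun hd =>
    eq_of_three hx h₁ h₂ h₃ h₁₂ h₁₃ h₂₃ ((base_rot _).trans hd)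
  have ne : ∀ {d e}, G.base d = x → G.base e = x → d ≠ e → G.rot d ≠ d := fun hd he hde hfix =>
    hde ((sameCycle_of_base (hd.trans he.symm)).eq_of_left hfix)
  have other : ¬ (G.rot d₁ = d₃ ∧ G.rot d₃ = d₂) := fun ⟨e₁, e₃⟩ =>
    r₃ ⟨by rwa [← G.face_rot d₃, e₃], by rwa [← e₁, rev, G.face_rot d₁]⟩
  have inj : ∀ {d e}, d ≠ e → G.rot d ≠ G.rot e := G.rot.injective.ne
  have n₁ := ne h₁ h₂ h₁₂
  have n₂ := ne h₂ h₁ h₁₂.symm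
  have n₃ := ne h₃ h₁ h₁₃.symm
  have i₁₂ := inj h₁₂
  have m₁ := mem h₁
  have m₂ := mem h₂
  have m₃ := mem h₃
  grind

end DegreeThree

/-! ### The curve that encloses a strip -/

/-- The floor and the ceiling of the strip `S` form a simple closed curve in the component `C`; if
the ceiling is the dummy ceiling, its role in that curve is played by `Q`. -/
structure Shape (G : PlaneDigraph V A Φ) (C : Set V) (Q : List A) (S : Strip V A) : Prop where
  floor_path : G.IsPath S.start S.floor S.finish
  floor_ne : S.floor ≠ []
  floor_arcs : ∀ a ∈ S.floor, a ∈ G.arcsOf C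
  some_path : ∀ U, S.ceiling = some U → G.IsPath S.start U S.finish
  some_arcs : ∀ U, S.ceiling = some U → ∀ a ∈ U, a ∈ G.arcsOf C
  some_internal : ∀ U, S.ceiling = some U → ∀ x ∈ G.internalVerts U, x ∉ G.verts S.start S.floor
  some_disjoint : ∀ U, S.ceiling = some U → ∀ a ∈ U, a ∉ S.floor
  none_path : S.ceiling = none → G.IsPath S.finish Q S.start
  none_arcs : ∀ a ∈ Q, a ∈ G.arcsOf C
  none_internal : S.ceiling = none → ∀ x ∈ G.internalVerts Q, x ∉ G.verts S.start S.floor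

/-- The flow once around the strip `S`, forward along the floor and backward along the ceiling. The
dummy ceiling is replaced by `Q`, which runs from the end of the floor to its start. -/
noncomputable def stripJump (Q : List A) (S : Strip V A) (a : A) : ℚ :=
  mult S.floor a + S.ceiling.elim (mult Q a) (fun U => -mult U a)

/-- The curve that encloses the strip `S` runs counterclockwise around it, that is, the strip is on
the left of the floor: the winding number of the curve is `0` outside and `1` inside. -/
def Region (G : PlaneDigraph V A Φ) (Q : List A) (S : Strip V A) : Prop :=
  ∃ h, G.IsPotential h (stripJump Q S) ∧
    (∀ f, h f = 0 ↔ G.InOuterRegion (stripCurve Q S) f) ∧ ∀ f, h f = 0 ∨ h f = 1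

section Curve

variable {C : Set V} {Q U : List A} {S : Strip V A} {a : A} {h : Φ → ℚ}

lemma mem_stripCurve_some (h : S.ceiling = some U) :
    a ∈ stripCurve Q S ↔ a ∈ S.floor ∨ a ∈ U := by simp [stripCurve, h]

lemma mem_stripCurve_none (h : S.ceiling = none) :
    a ∈ stripCurve Q S ↔ a ∈ S.floor ∨ a ∈ Q := by simp [stripCurve, h]

lemma jump_notMem (ha : a ∉ stripCurve Q S) : stripJump Q S a = 0 := by
  rw [stripJump, mult_of_notMem fun h => ha (Or.inl h), zero_add]
  cases hU : S.ceiling with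
  | none => exact mult_of_notMem fun h => ha ((mem_stripCurve_none hU).2 (Or.inr h))
  | some U =>
    exact neg_eq_zero.2 (mult_of_notMem fun h => ha ((mem_stripCurve_some hU).2 (Or.inr h)))

namespace Shape

lemma start_ne (H : G.Shape C Q S) : S.start ≠ S.finish := H.floor_path.ne H.floor_ne

lemma some_ne (H : G.Shape C Q S) (hU : S.ceiling = some U) : U ≠ [] := by
  rintro rfl
  exact H.start_ne (H.some_path _ hU).1

lemma none_ne (H : G.Shape C Q S) (hU : S.ceiling = none) : Q ≠ [] := by
  rintro rfl
  exact H.start_ne (H.none_path hU).1.symm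

lemma curve_arcs (H : G.Shape C Q S) (ha : a ∈ stripCurve Q S) : a ∈ G.arcsOf C := by
  cases hU : S.ceiling with
  | none => exact ((mem_stripCurve_none hU).1 ha).elim (H.floor_arcs a) (H.none_arcs a)
  | some U => exact ((mem_stripCurve_some hU).1 ha).elim (H.floor_arcs a) (H.some_arcs U hU a)

lemma tail_none_ne_tail_floor (H : G.Shape C Q S) (hU : S.ceiling = none) {b : A}
    (ha : a ∈ S.floor) (hb : b ∈ Q) : G.tail a ≠ G.tail b := fun e => by
  rcases (H.none_path hU).1.tail_eq_or_mem_internalVerts hb with h | h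
  · exact H.floor_path.tail_ne_end ha (e.trans h)
  · exact H.none_internal hU _ h (e ▸ H.floor_path.1.tail_mem_verts ha)

lemma tail_floor_ne_head_some (H : G.Shape C Q S) (hU : S.ceiling = some U) {b : A}
    (ha : a ∈ S.floor) (hb : b ∈ U) : G.tail a ≠ G.head b := fun e => by
  rcases (H.some_path U hU).1.head_eq_or_mem_internalVerts hb with h | h
  · exact H.floor_path.tail_ne_end ha (e.trans h)
  · exact H.some_internal U hU _ h (e ▸ H.floor_path.1.tail_mem_verts ha)

lemma none_disjoint (H : G.Shape C Q S) (hU : S.ceiling = none) (ha : a ∈ Q) : a ∉ S.floor :=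
  fun hf => H.tail_none_ne_tail_floor hU hf ha rfl

lemma jump_floor (H : G.Shape C Q S) (ha : a ∈ S.floor) : stripJump Q S a = 1 := by
  rw [stripJump, mult_of_mem H.floor_path.nodup ha]
  cases hU : S.ceiling with
  | none => simp [mult_of_notMem fun h => H.none_disjoint hU h ha]
  | some U => simp [mult_of_notMem fun h => H.some_disjoint U hU a h ha]

lemma jump_some (H : G.Shape C Q S) (hU : S.ceiling = some U) (ha : a ∈ U) :
    stripJump Q S a = -1 := by
  rw [stripJump, mult_of_notMem (H.some_disjoint U hU a ha), hU]
  simp [mult_of_mem (H.some_path U hU).nodup ha]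

lemma jump_none (H : G.Shape C Q S) (hU : S.ceiling = none) (ha : a ∈ Q) :
    stripJump Q S a = 1 := by
  rw [stripJump, mult_of_notMem (H.none_disjoint hU ha), hU]
  simp [mult_of_mem (H.none_path hU).nodup ha]

lemma exists_potential [Finite V] [Finite A] [Finite Φ] (H : G.Shape C Q S) :
    ∃ h, G.IsPotential h (stripJump Q S) := by
  cases hU : S.ceiling with
  | none =>
    obtain ⟨h, hh⟩ := exists_potential_closed (H.floor_path.1.append (H.none_path hU).1)
    exact ⟨h, hh.1, fun a => by rw [hh.2, mult_append, stripJump, hU]; rfl⟩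
  | some U =>
    obtain ⟨h, hh⟩ := PlaneDigraph.exists_potential H.floor_path.1 (H.some_path U hU).1
    exact ⟨h, hh.1, fun a => by rw [hh.2, stripJump, hU]; exact sub_eq_add_neg _ _⟩

lemma isCycle_floor_append (H : G.Shape C Q S) (hU : S.ceiling = none) :
    G.IsCycle (S.floor ++ Q) := by
  refine ⟨by simp [H.floor_ne], ⟨_, H.floor_path.1.append (H.none_path hU).1⟩, ?_⟩
  rw [List.map_append, List.nodup_append]
  refine ⟨H.floor_path.nodup_tail, (H.none_path hU).nodup_tail, ?_⟩
  rintro _ hx _ hy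
  obtain ⟨a, ha, rfl⟩ := List.mem_map.1 hx
  obtain ⟨b, hb, rfl⟩ := List.mem_map.1 hy
  exact H.tail_none_ne_tail_floor hU ha hb

lemma isDartCycle_floor_append (H : G.Shape C Q S) (hU : S.ceiling = some U) :
    G.IsDartCycle (S.floor.map (·, true) ++ U.reverse.map (·, false)) where
  ne_nil := by simp [H.floor_ne]
  closed := ⟨_, H.floor_path.1.darts.append (H.some_path U hU).1.darts_reverse⟩
  nodup_base := by
    simp only [List.map_append, List.map_map, Function.comp_def, base_true, base_false]
    rw [List.nodup_append, List.map_reverse, List.nodup_reverse]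
    refine ⟨H.floor_path.nodup_tail, (List.nodup_cons.1 (H.some_path U hU).2).2, ?_⟩
    rintro _ hx _ hy
    obtain ⟨a, ha, rfl⟩ := List.mem_map.1 hx
    obtain ⟨b, hb, rfl⟩ := List.mem_map.1 (List.mem_reverse.1 hy)
    exact H.tail_floor_ne_head_some hU ha hb
  nodup_arc := by
    simp only [List.map_append, List.map_map, Function.comp_def, List.map_id']
    rw [List.nodup_append]
    refine ⟨H.floor_path.nodup, List.nodup_reverse.2 (H.some_path U hU).nodup, ?_⟩
    rintro a ha _ hb rfl
    exact H.some_disjoint U hU a (List.mem_reverse.1 hb) ha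

theorem jordan [Finite A] (H : G.Shape C Q S) (hh : G.IsPotential h (stripJump Q S)) :
    (∀ f, h f = 0 ↔ G.InOuterRegion (stripCurve Q S) f) ∧
      ((∀ f, h f = 0 ∨ h f = 1) ∨ ∀ f, h f = 0 ∨ h f = -1) := by
  have flat : ∀ a ∉ stripCurve Q S, h (G.leftFace a) = h (G.rightFace a) := fun a ha =>
    sub_eq_zero.1 ((hh.2 a).trans (jump_notMem ha))
  cases hU : S.ceiling with
  | none =>
    refine (H.isCycle_floor_append hU).isDartCycle.jordan (fun a => ?_) hh.1 (fun d hd => ?_) flat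
    · simp [mem_stripCurve_none hU]
    · obtain ⟨a, ha, rfl⟩ := List.mem_map.1 hd
      exact (hh.2 a).trans ((List.mem_append.1 ha).elim H.jump_floor (H.jump_none hU))
  | some U =>
    refine (H.isDartCycle_floor_append hU).jordan (fun a => ?_) hh.1 (fun d hd => ?_) flat
    · simp [mem_stripCurve_some hU, or_comm]
    · rcases List.mem_append.1 hd with hd | hd <;> obtain ⟨a, ha, rfl⟩ := List.mem_map.1 hd
      · exact (hh.2 a).trans (H.jump_floor ha)
      · have jump := (hh.2 a).trans (H.jump_some hU (List.mem_reverse.1 ha))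
        exact (neg_sub _ _).symm.trans (neg_eq_iff_eq_neg.2 jump)

lemma region_of_left [Finite V] [Finite A] [Finite Φ] (H : G.Shape C Q S)
    (ha : stripJump Q S a = 1) (hr : G.InOuterRegion (stripCurve Q S) (G.rightFace a)) :
    G.Region Q S := by
  obtain ⟨h, hh⟩ := H.exists_potential
  obtain ⟨zero_iff, values⟩ := H.jordan hh
  refine ⟨h, hh, zero_iff, values.resolve_right fun neg => ?_⟩
  have jump := hh.2 a
  rw [ha, (zero_iff _).2 hr] at jump
  rcases neg (G.leftFace a) with h' | h' <;> linarith

lemma region_of_right [Finite V] [Finite A] [Finite Φ] (H : G.Shape C Q S)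
    (ha : stripJump Q S a = -1) (hr : G.InOuterRegion (stripCurve Q S) (G.leftFace a)) :
    G.Region Q S := by
  obtain ⟨h, hh⟩ := H.exists_potential
  obtain ⟨zero_iff, values⟩ := H.jordan hh
  refine ⟨h, hh, zero_iff, values.resolve_right fun neg => ?_⟩
  have jump := hh.2 a
  rw [ha, (zero_iff _).2 hr] at jump
  rcases neg (G.rightFace a) with h' | h' <;> linarith

end Shape

lemma Region.of_left (R : G.Region Q S) (ha : stripJump Q S a = 1) :
    G.InOuterRegion (stripCurve Q S) (G.rightFace a) ∧
      ¬ G.InOuterRegion (stripCurve Q S) (G.leftFace a) := by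
  obtain ⟨h, hh, zero_iff, values⟩ := R
  have jump := hh.2 a
  rw [← zero_iff, ← zero_iff]
  constructor <;> rcases values (G.leftFace a) with h' | h' <;>
    rcases values (G.rightFace a) with h'' | h'' <;> linarith

lemma Region.of_right (R : G.Region Q S) (ha : stripJump Q S a = -1) :
    G.InOuterRegion (stripCurve Q S) (G.leftFace a) ∧
      ¬ G.InOuterRegion (stripCurve Q S) (G.rightFace a) := by
  obtain ⟨h, hh, zero_iff, values⟩ := R
  have jump := hh.2 a
  rw [← zero_iff, ← zero_iff]
  constructor <;> rcases values (G.leftFace a) with h' | h' <;>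
    rcases values (G.rightFace a) with h'' | h'' <;> linarith

end Curve

/-! ### Strips and the walks that approach them -/

/-- The hypotheses on the plane digraph `G` and the component `C` that are common to all strips of a
decomposition, where `Q` is the part of the boundary of `C` below the dummy ceiling. -/
structure Setting (G : PlaneDigraph V A Φ) (s t : V) (C : Set V) (Q : List A) : Prop where
  no_clockwise : ∀ c : List A, ¬ G.IsClockwiseCycle c
  degree : ∀ x ∈ C, G.degree x = 3
  scc : G.IsSCC C
  source : G.LiesOutside C s
  sink : G.LiesOutside C t
  internal : ∀ x ∈ G.internalVerts Q, ¬ G.IsEntrance s C x ∧ ¬ G.IsExit t C x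

/-- The vertices of a strip. -/
def stripVerts (G : PlaneDigraph V A Φ) (C : Set V) (Q : List A) (S : Strip V A) : Set V :=
  {x | ∃ d, G.base d = x ∧ d.1 ∈ G.stripArcs C Q S}

/-- The walk `E₀` from `s` to the start of the strip and the walk `E₁` from the end of the strip to
`t` are disjoint and run outside the strip; moreover, they do not have the strip on their right. -/
structure Approach (G : PlaneDigraph V A Φ) (s t : V) (C : Set V) (Q : List A) (S : Strip V A)
    (E₀ E₁ : List A) : Prop where
  walk_in : G.IsWalk s E₀ S.start
  walk_out : G.IsWalk S.finish E₁ t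
  disjoint : ∀ x ∈ G.verts s E₀, x ∉ G.verts S.finish E₁
  tail_notMem : ∀ a ∈ E₀, G.tail a ∉ G.stripVerts C Q S
  head_notMem : ∀ a ∈ E₁, G.head a ∉ G.stripVerts C Q S
  right_in : ∀ a ∈ E₀, G.InOuterRegion (stripCurve Q S) (G.rightFace a)
  right_out : ∀ a ∈ E₁, G.InOuterRegion (stripCurve Q S) (G.rightFace a)

/-- The strip `S` is enclosed by a simple closed curve, with the strip on the left of its floor. -/
structure Solid (G : PlaneDigraph V A Φ) (C : Set V) (Q : List A) (S : Strip V A) : Prop where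
  shape : G.Shape C Q S
  region : G.Region Q S

/-- The properties of a strip that are preserved by every slicing. -/
structure Regular (G : PlaneDigraph V A Φ) (s t : V) (C : Set V) (Q : List A) (S : Strip V A) :
    Prop extends Solid G C Q S where
  none_strip : S.ceiling = none → ∀ x ∈ G.internalVerts Q, ∀ d, G.base d = x →
    d.1 ∈ G.arcsOf C → d.1 ∈ G.stripArcs C Q S
  approach : ∃ E₀ E₁, G.Approach s t C Q S E₀ E₁

section Strips

variable {s t u v x y : V} {C : Set V} {Q U p E₀ E₁ : List A} {S : Strip V A} {a : A}
  {d e : A × Bool}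

lemma mem_boundaryArcs_of_ceiling (hU : S.ceiling = some U) (ha : a ∈ U) : a ∈ boundaryArcs S :=
  Or.inr ⟨U, hU, ha⟩

lemma mem_ceilingInnerVerts :
    x ∈ G.ceilingInnerVerts S ↔ ∃ U, S.ceiling = some U ∧ x ∈ G.internalVerts U := Iff.rfl

lemma boundaryArcs_subset_stripCurve : boundaryArcs S ⊆ stripCurve Q S := by
  rintro a (h | ⟨U, hU, h⟩)
  · exact Or.inl h
  · exact (mem_stripCurve_some hU).2 (Or.inr h)

lemma mem_stripArcs_iff_face : d.1 ∈ G.stripArcs C Q S ↔ d.1 ∈ G.arcsOf C ∧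
    (¬ G.InOuterRegion (stripCurve Q S) (G.face d) ∨
      ¬ G.InOuterRegion (stripCurve Q S) (G.face (rev d))) := by
  obtain ⟨a, _ | _⟩ := d
  · exact and_congr_right' or_comm
  · exact Iff.rfl

lemma stripVerts_subset : G.stripVerts C Q S ⊆ C := by
  rintro _ ⟨⟨a, _ | _⟩, rfl, ha⟩
  exacts [ha.1.2, ha.1.1]

lemma tail_mem_stripVerts (ha : a ∈ G.stripArcs C Q S) : G.tail a ∈ G.stripVerts C Q S :=
  ⟨(a, true), rfl, ha⟩

lemma head_mem_stripVerts (ha : a ∈ G.stripArcs C Q S) : G.head a ∈ G.stripVerts C Q S :=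
  ⟨(a, false), rfl, ha⟩

/- None of the arcs at `x` crosses the curve, so all faces at `x` are on the same side of it. -/
lemma notMem_stripVerts [Finite A] (hx : ∀ d, G.base d = x → d.1 ∉ stripCurve Q S)
    (hd : G.base d = x) (outer : G.InOuterRegion (stripCurve Q S) (G.face d)) :
    x ∉ G.stripVerts C Q S := by
  rintro ⟨e, he, he'⟩
  have flat : G.Flat (G.InOuterRegion (stripCurve Q S)) x := Flat.of_notMem hx
  rcases (mem_stripArcs_iff_face.1 he').2 with h | h
  · exact h (flat.face_eq hd he ▸ outer)
  · exact h (flat.face_rev_eq hd he ▸ outer)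

lemma Shape.base_notMem (H : G.Shape C Q S) (hU : S.ceiling = some U)
    (hf : x ∉ G.verts S.start S.floor) (hc : x ∉ G.verts S.start U) :
    ∀ d, G.base d = x → d.1 ∉ stripCurve Q S := fun _ hd h =>
  ((mem_stripCurve_some hU).1 h).elim (H.floor_path.1.notMem_of_base hf hd)
    ((H.some_path U hU).1.notMem_of_base hc hd)

namespace Approach

lemma eq_start (hE : G.Approach s t C Q S E₀ E₁) (hx : x ∈ G.verts s E₀)
    (hS : x ∈ G.stripVerts C Q S) : x = S.start := by
  rcases hE.walk_in.mem_verts_iff_tail.1 hx with h | ⟨a, ha, rfl⟩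
  · exact h
  · exact absurd hS (hE.tail_notMem a ha)

lemma eq_finish (hE : G.Approach s t C Q S E₀ E₁) (hx : x ∈ G.verts S.finish E₁)
    (hS : x ∈ G.stripVerts C Q S) : x = S.finish := by
  rcases mem_verts_iff_head.1 hx with h | ⟨a, ha, rfl⟩
  · exact h
  · exact absurd hS (hE.head_notMem a ha)

end Approach

namespace Solid

lemma floor_sides (I : G.Solid C Q S) (ha : a ∈ S.floor) :
    G.InOuterRegion (stripCurve Q S) (G.rightFace a) ∧
      ¬ G.InOuterRegion (stripCurve Q S) (G.leftFace a) :=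
  I.region.of_left (I.shape.jump_floor ha)

lemma ceiling_sides (I : G.Solid C Q S) (hU : S.ceiling = some U) (ha : a ∈ U) :
    G.InOuterRegion (stripCurve Q S) (G.leftFace a) ∧
      ¬ G.InOuterRegion (stripCurve Q S) (G.rightFace a) :=
  I.region.of_right (I.shape.jump_some hU ha)

lemma dummy_sides (I : G.Solid C Q S) (hU : S.ceiling = none) (ha : a ∈ Q) :
    G.InOuterRegion (stripCurve Q S) (G.rightFace a) ∧
      ¬ G.InOuterRegion (stripCurve Q S) (G.leftFace a) :=
  I.region.of_left (I.shape.jump_none hU ha)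

lemma stripCurve_subset (I : G.Solid C Q S) : stripCurve Q S ⊆ G.stripArcs C Q S := by
  intro a ha
  refine ⟨I.shape.curve_arcs ha, ?_⟩
  cases hU : S.ceiling with
  | none =>
    exact Or.inl (((mem_stripCurve_none hU).1 ha).elim (fun h => (I.floor_sides h).2)
      fun h => (I.dummy_sides hU h).2)
  | some U =>
    exact ((mem_stripCurve_some hU).1 ha).imp (fun h => (I.floor_sides h).2)
      fun h => (I.ceiling_sides hU h).2

lemma boundaryArcs_subset (I : G.Solid C Q S) : boundaryArcs S ⊆ G.stripArcs C Q S :=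
  boundaryArcs_subset_stripCurve.trans I.stripCurve_subset

lemma floorVerts_subset (I : G.Solid C Q S) : G.floorVerts S ⊆ G.stripVerts C Q S := by
  intro x hx
  rcases mem_verts_iff_head.1 hx with rfl | ⟨a, ha, rfl⟩
  · obtain ⟨a, p, e, h, -⟩ := I.shape.floor_path.1.exists_cons_of_ne I.shape.start_ne
    exact h ▸ tail_mem_stripVerts (I.boundaryArcs_subset (Or.inl (by simp [e])))
  · exact head_mem_stripVerts (I.boundaryArcs_subset (Or.inl ha))

lemma start_mem (I : G.Solid C Q S) : S.start ∈ G.stripVerts C Q S :=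
  I.floorVerts_subset start_mem_verts

lemma finish_mem (I : G.Solid C Q S) : S.finish ∈ G.stripVerts C Q S :=
  I.floorVerts_subset I.shape.floor_path.1.end_mem_verts

lemma ceilingVerts_subset (I : G.Solid C Q S) (hU : S.ceiling = some U)
    (hx : x ∈ G.verts S.start U) : x ∈ G.stripVerts C Q S := by
  rcases mem_verts_iff_head.1 hx with rfl | ⟨a, ha, rfl⟩
  · exact I.start_mem
  · exact head_mem_stripVerts (I.boundaryArcs_subset (mem_boundaryArcs_of_ceiling hU ha))

lemma boundaryVerts_subset (I : G.Solid C Q S) : G.boundaryVerts S ⊆ G.stripVerts C Q S := by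
  rintro x (hx | hx)
  · exact I.floorVerts_subset hx
  · obtain ⟨U, hU, hx⟩ := mem_ceilingInnerVerts.1 hx
    exact I.ceilingVerts_subset hU ((I.shape.some_path U hU).1.mem_verts_iff_internalVerts.2
      (Or.inr (Or.inr hx)))

lemma mem_boundaryVerts_of_ceiling (I : G.Solid C Q S) (hU : S.ceiling = some U)
    (hx : x ∈ G.verts S.start U) : x ∈ G.boundaryVerts S := by
  rcases (I.shape.some_path U hU).1.mem_verts_iff_internalVerts.1 hx with rfl | rfl | h
  · exact Or.inl start_mem_verts
  · exact Or.inl I.shape.floor_path.1.end_mem_verts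
  · exact Or.inr (mem_ceilingInnerVerts.2 ⟨U, hU, h⟩)

lemma notMem_boundaryArcs (I : G.Solid C Q S) (hx : G.base d ∉ G.boundaryVerts S) :
    d.1 ∉ boundaryArcs S := by
  rintro (h | ⟨U, hU, h⟩)
  · exact I.shape.floor_path.1.notMem_of_base (fun h' => hx (Or.inl h')) rfl h
  · exact (I.shape.some_path U hU).1.notMem_of_base
      (fun h' => hx (I.mem_boundaryVerts_of_ceiling hU h')) rfl h

lemma notMem_stripCurve (I : G.Solid C Q S) (hx : G.base d ∉ G.boundaryVerts S)
    (hQ : ¬ (S.ceiling = none ∧ G.base d ∈ G.internalVerts Q)) : d.1 ∉ stripCurve Q S := by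
  intro hd
  have boundary := I.notMem_boundaryArcs hx
  cases hU : S.ceiling with
  | some U =>
    exact boundary (((mem_stripCurve_some hU).1 hd).imp_right fun h => ⟨U, hU, h⟩)
  | none =>
    rcases (mem_stripCurve_none hU).1 hd with h | h
    · exact boundary (Or.inl h)
    · refine (I.shape.none_path hU).1.notMem_of_base (fun h' => ?_) rfl h
      rcases (I.shape.none_path hU).1.mem_verts_iff_internalVerts.1 h' with h' | h' | h'
      · exact hx (Or.inl (h' ▸ I.shape.floor_path.1.end_mem_verts))
      · exact hx (Or.inl (h' ▸ start_mem_verts))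
      · exact hQ ⟨hU, h'⟩

/- The arc would have the unbounded region on its left, hence a negative potential on its right. -/
lemma notMem_closed_walk [Finite V] [Finite A] [Finite Φ] (I : G.Solid C Q S)
    (no_clockwise : ∀ c : List A, ¬ G.IsClockwiseCycle c) (hp : G.IsWalk x p x)
    (hin : ∀ a ∈ p, a ∈ G.stripArcs C Q S) (hU : S.ceiling = some U) (ha : a ∈ U) : a ∉ p := by
  intro hap
  obtain ⟨h, hh, nonneg⟩ := hp.exists_nonneg_potential no_clockwise
  have outer : G.InOuterRegion {b | b ∈ p} (G.leftFace a) :=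
    (I.ceiling_sides hU ha).1.mono fun b hb _ => (hin b hb).2
  have left : h G.outer = h (G.leftFace a) := Joined.apply_eq outer fun b hb =>
    sub_eq_zero.1 ((hh.2 b).trans (mult_of_notMem hb))
  have jump := hh.2 a
  rw [← left, hh.1] at jump
  linarith [one_le_mult hap, nonneg (G.rightFace a)]

end Solid

namespace Regular

lemma exists_head_notMem_innerArcs (H : G.Setting s t C Q) (I : G.Regular s t C Q S)
    (hx : x ∈ G.boundaryVerts S) : ∃ a, G.head a = x ∧ a ∉ G.innerArcs C Q S := by
  obtain ⟨E₀, E₁, hE⟩ := I.approach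
  rcases hx with hx | hx
  · rcases mem_verts_iff_head.1 hx with rfl | ⟨a, ha, rfl⟩
    · have ne : E₀ ≠ [] := by
        rintro rfl
        have : s = S.start := hE.walk_in
        exact H.source.1 (this ▸ stripVerts_subset I.start_mem)
      obtain ⟨q, a, rfl, -, ha⟩ := hE.walk_in.exists_concat_of_ne_nil ne
      exact ⟨a, ha, fun hin => hE.tail_notMem a (by simp) (tail_mem_stripVerts hin.1)⟩
    · exact ⟨a, rfl, fun hin => hin.2 (Or.inl ha)⟩
  · obtain ⟨U, hU, hx⟩ := mem_ceilingInnerVerts.1 hx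
    obtain ⟨a, ha, rfl⟩ := List.mem_map.1 (List.dropLast_subset _ hx)
    exact ⟨a, rfl, fun hin => hin.2 (mem_boundaryArcs_of_ceiling hU ha)⟩

lemma exists_tail_notMem_innerArcs (H : G.Setting s t C Q) (I : G.Regular s t C Q S)
    (hx : x ∈ G.boundaryVerts S) : ∃ a, G.tail a = x ∧ a ∉ G.innerArcs C Q S := by
  obtain ⟨E₀, E₁, hE⟩ := I.approach
  rcases hx with hx | hx
  · rcases I.shape.floor_path.1.mem_verts_iff_tail.1 hx with rfl | ⟨a, ha, rfl⟩
    · have ne : S.finish ≠ t := fun h => H.sink.1 (h ▸ stripVerts_subset I.finish_mem)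
      obtain ⟨a, q, rfl, ha, -⟩ := hE.walk_out.exists_cons_of_ne ne
      exact ⟨a, ha, fun hin => hE.head_notMem a (by simp) (head_mem_stripVerts hin.1)⟩
    · exact ⟨a, rfl, fun hin => hin.2 (Or.inl ha)⟩
  · obtain ⟨U, hU, hx⟩ := mem_ceilingInnerVerts.1 hx
    obtain ⟨p₁, a, b, p₂, rfl, -, hb⟩ :=
      (I.shape.some_path U hU).1.exists_consecutive_of_mem_internalVerts hx
    exact ⟨b, hb, fun hin => hin.2 (mem_boundaryArcs_of_ceiling hU (by simp))⟩

lemma innerArcs_unique [Finite A] (H : G.Setting s t C Q) (I : G.Regular s t C Q S)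
    (hx : x ∈ G.boundaryVerts S) (hd : G.base d = x) (he : G.base e = x)
    (hd' : d.1 ∈ G.innerArcs C Q S) (he' : e.1 ∈ G.innerArcs C Q S) : d = e := by
  obtain ⟨a, ha, ha'⟩ := I.exists_head_notMem_innerArcs H hx
  obtain ⟨b, hb, hb'⟩ := I.exists_tail_notMem_innerArcs H hx
  have ne : ∀ {c c' : A × Bool}, c.1 ∉ G.innerArcs C Q S → c'.1 ∈ G.innerArcs C Q S → c ≠ c' := by
    rintro c _ hc hc' rfl
    exact hc hc'
  rcases eq_of_three (H.degree x (stripVerts_subset (I.boundaryVerts_subset hx)))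
    (d₁ := (a, false)) (d₂ := (b, true)) ha hb hd (by simp) (ne ha' hd') (ne hb' hd') he
    with h | h | h
  · exact absurd h.symm (ne ha' he')
  · exact absurd h.symm (ne hb' he')
  · exact h.symm

lemma notMem_boundaryVerts_of_internal [Finite A] (H : G.Setting s t C Q) (I : G.Regular s t C Q S)
    (hp : G.IsWalk u p v) (hin : ∀ a ∈ p, a ∈ G.innerArcs C Q S) (hx : x ∈ G.internalVerts p) :
    x ∉ G.boundaryVerts S := by
  intro hb
  obtain ⟨p₁, a, b, p₂, rfl, h₁, h₂⟩ := hp.exists_consecutive_of_mem_internalVerts hx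
  simpa using I.innerArcs_unique H hb (d := (a, false)) (e := (b, true)) h₁ h₂
    (hin a (by simp)) (hin b (by simp))

lemma isLink [Finite A] (H : G.Setting s t C Q) (I : G.Regular s t C Q S) (hp : G.IsPath u p v)
    (ne : p ≠ []) (hin : ∀ a ∈ p, a ∈ G.innerArcs C Q S) (hu : u ∈ G.boundaryVerts S)
    (hv : v ∈ G.boundaryVerts S) : G.IsLink C Q S u p v :=
  ⟨ne, hp, hin, hu, hv, fun _ hx => I.notMem_boundaryVerts_of_internal H hp.1 hin hx⟩

lemma face_notMem_outer [Finite A] (I : G.Regular s t C Q S) (hx : x ∉ G.boundaryVerts S)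
    (hQ : ¬ (S.ceiling = none ∧ x ∈ G.internalVerts Q)) (hd : G.base d = x) (he : G.base e = x)
    (hd' : d.1 ∈ G.innerArcs C Q S) : ¬ G.InOuterRegion (stripCurve Q S) (G.face e) := by
  intro outer
  have off_curve : ∀ c, G.base c = x → c.1 ∉ stripCurve Q S := by
    rintro c rfl
    exact I.notMem_stripCurve hx hQ
  exact notMem_stripVerts off_curve he outer ⟨d, hd, hd'.1⟩

/- At an inner vertex either all faces are enclosed by the curve of the strip, or the vertex lies on
`Q` and then `none_strip` applies. -/
lemma mem_innerArcs_of_base [Finite A] (I : G.Regular s t C Q S) (hx : x ∉ G.boundaryVerts S)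
    (hd : G.base d = x) (he : G.base e = x) (hd' : d.1 ∈ G.innerArcs C Q S)
    (he' : e.1 ∈ G.arcsOf C) : e.1 ∈ G.innerArcs C Q S := by
  refine ⟨?_, I.notMem_boundaryArcs (he ▸ hx)⟩
  by_cases hQ : S.ceiling = none ∧ x ∈ G.internalVerts Q
  · exact I.none_strip hQ.1 x hQ.2 e he he'
  · exact mem_stripArcs_iff_face.2 ⟨he', Or.inl (I.face_notMem_outer hx hQ hd he hd')⟩

lemma mem_innerArcs_of_walk [Finite A] (I : G.Regular s t C Q S)
    (hp : G.IsWalk (G.head a) p y) (ha : a ∈ G.innerArcs C Q S)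
    (hb : ∀ b ∈ p, G.tail b ∉ G.boundaryVerts S) (hC : ∀ b ∈ p, b ∈ G.arcsOf C) :
    ∀ b ∈ p, b ∈ G.innerArcs C Q S := by
  induction p generalizing a with
  | nil => simp
  | cons c p ih =>
    rw [List.forall_mem_cons] at hb hC ⊢
    have hc : c ∈ G.innerArcs C Q S := I.mem_innerArcs_of_base hb.1 (d := (a, false))
      (e := (c, true)) hp.1.symm rfl ha hC.1
    exact ⟨hc, ih hp.2 hc hb.2 hC.2⟩

/- Follow a path in `C` from the head of `a` to the start of the strip until it meets the boundary;
up to that point it cannot leave the strip. -/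
theorem exists_isLink [Finite A] (H : G.Setting s t C Q) (I : G.Regular s t C Q S)
    (ha : a ∈ G.innerArcs C Q S) (hx : G.tail a ∈ G.boundaryVerts S) :
    ∃ p y, G.IsLink C Q S (G.tail a) (a :: p) y := by
  have start_mem : S.start ∈ C := stripVerts_subset I.start_mem
  obtain ⟨w, hw⟩ := H.scc.reaches ha.1.1.2 start_mem
  obtain ⟨q, hq, -⟩ := hw.exists_isPath
  have hqC := fun b hb => H.scc.mem_arcsOf_of_walk hq.1 ha.1.1.2 start_mem (a := b) hb
  obtain ⟨p, q', y, rfl, hp, -, hy, hpb⟩ := hq.1.exists_split_at_first (· ∈ G.boundaryVerts S)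
    (Or.inl start_mem_verts)
  have inner : ∀ b ∈ a :: p, b ∈ G.innerArcs C Q S :=
    List.forall_mem_cons.2 ⟨ha, I.mem_innerArcs_of_walk hp ha hpb fun b hb => hqC b (by simp [hb])⟩
  have hap : G.IsWalk (G.tail a) (a :: p) y := ⟨rfl, hp⟩
  have notMem : G.tail a ∉ G.verts (G.head a) p := fun hmem => by
    rcases hp.mem_verts_iff_tail.1 hmem with h | ⟨b, hb, h⟩
    · obtain ⟨r, c, e, -, hc⟩ := hap.exists_concat_of_ne_nil (by simp)
      simpa using I.innerArcs_unique H hx (d := (a, true)) (e := (c, false)) rfl (hc.trans h.symm)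
        ha (inner c (by simp [e]))
    · exact hpb b hb (h ▸ hx)
  have nodup : (G.verts (G.tail a) (a :: p)).Nodup :=
    List.nodup_cons.2 ⟨notMem, (hq.of_append_left hp).2⟩
  exact ⟨p, y, I.isLink H ⟨hap, nodup⟩ (by simp) inner hx hy⟩

end Regular

end Strips

/-! ### Strips inside strips -/

/-- The curve of the strip `S'` runs inside the strip `S`. -/
def Inside (G : PlaneDigraph V A Φ) (C : Set V) (Q : List A) (S' S : Strip V A) : Prop :=
  ∀ a ∈ stripCurve Q S', a ∉ stripCurve Q S → a ∈ G.stripArcs C Q S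

section Inside

variable {u v : V} {C : Set V} {Q p : List A} {S S' : Strip V A} {a : A} {f : Φ}

lemma Solid.mem_boundaryArcs_of_mem_stripCurve (I : G.Solid C Q S)
    (hn : S'.ceiling = none → S.ceiling = none) (hc : a ∈ stripCurve Q S')
    (hb : a ∈ boundaryArcs S) : a ∈ boundaryArcs S' := by
  cases hU : S'.ceiling with
  | some U =>
    exact ((mem_stripCurve_some hU).1 hc).imp_right fun h => ⟨U, hU, h⟩
  | none =>
    refine ((mem_stripCurve_none hU).1 hc).imp_right fun h => ?_
    rcases hb with hb | ⟨U, hU', -⟩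
    · exact absurd hb (I.shape.none_disjoint (hn hU) h)
    · simp [hn hU] at hU'

namespace Inside

lemma inOuterRegion (h : G.Inside C Q S' S) (hf : G.InOuterRegion (stripCurve Q S) f) :
    G.InOuterRegion (stripCurve Q S') f := hf.mono fun a ha ha' => (h a ha ha').2

lemma stripArcs_subset (h : G.Inside C Q S' S) : G.stripArcs C Q S' ⊆ G.stripArcs C Q S :=
  fun _ ha => ⟨ha.1, ha.2.imp (mt h.inOuterRegion) (mt h.inOuterRegion)⟩

lemma stripVerts_subset (h : G.Inside C Q S' S) : G.stripVerts C Q S' ⊆ G.stripVerts C Q S := by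
  rintro _ ⟨d, hd, hd'⟩
  exact ⟨d, hd, h.stripArcs_subset hd'⟩

lemma innerArcs_subset (h : G.Inside C Q S' S) (I : G.Solid C Q S)
    (hn : S'.ceiling = none → S.ceiling = none) : G.innerArcs C Q S' ⊆ G.innerArcs C Q S := by
  refine fun a ha => ⟨h.stripArcs_subset ha.1, fun hb => ?_⟩
  have hc : a ∉ stripCurve Q S' := fun hc => ha.2 (I.mem_boundaryArcs_of_mem_stripCurve hn hc hb)
  have sides := inOuterRegion_left_iff_right (G := G) hc
  have left : G.InOuterRegion (stripCurve Q S') (G.leftFace a) := by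
    rcases hb with h' | ⟨U, hU, h'⟩
    · exact sides.2 (h.inOuterRegion (I.floor_sides h').1)
    · exact h.inOuterRegion (I.ceiling_sides hU h').1
  exact ha.1.2.elim (fun h' => h' left) fun h' => h' (sides.1 left)

end Inside

lemma IsLink.inside (hp : G.IsLink C Q S u p v)
    (h : ∀ a ∈ stripCurve Q S', a ∈ p ∨ a ∈ stripCurve Q S) : G.Inside C Q S' S :=
  fun a ha hn => (hp.2.2.1 a ((h a ha).resolve_right hn)).1

end Inside

/-! ### Slicing a strip -/

section Slicing

variable {s t u v x : V} {C : Set V} {Q p E₀ E₁ A₀ A₁ F₁ M F₃ U₁ U₂ : List A}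
  {S S' S₁ S₂ : Strip V A} {a : A}

lemma Approach.extend [Finite A] (hE : G.Approach s t C Q S E₀ E₁) (hin : G.Inside C Q S' S)
    (w₀ : G.IsWalk S.start A₀ S'.start) (w₁ : G.IsWalk S'.finish A₁ S.finish)
    (s₀ : ∀ x ∈ G.verts S.start A₀, x ∈ G.stripVerts C Q S)
    (s₁ : ∀ x ∈ G.verts S'.finish A₁, x ∈ G.stripVerts C Q S)
    (disj : ∀ x ∈ G.verts S.start A₀, x ∉ G.verts S'.finish A₁)
    (c₀ : ∀ a ∈ A₀, ∀ d, G.base d = G.tail a → d.1 ∉ stripCurve Q S')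
    (c₁ : ∀ a ∈ A₁, ∀ d, G.base d = G.head a → d.1 ∉ stripCurve Q S')
    (r₀ : ∀ a ∈ A₀, G.InOuterRegion (stripCurve Q S') (G.rightFace a))
    (r₁ : ∀ a ∈ A₁, G.InOuterRegion (stripCurve Q S') (G.rightFace a)) :
    G.Approach s t C Q S' (E₀ ++ A₀) (A₁ ++ E₁) where
  walk_in := hE.walk_in.append w₀
  walk_out := w₁.append hE.walk_out
  disjoint x hx hx' := by
    rcases hE.walk_in.mem_verts_append.1 hx with h | h <;>
      rcases w₁.mem_verts_append.1 hx' with h' | h'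
    · exact disj x (hE.eq_start h (s₁ x h') ▸ start_mem_verts) h'
    · exact hE.disjoint x h h'
    · exact disj x h h'
    · exact disj x h (hE.eq_finish h' (s₀ x h) ▸ w₁.end_mem_verts)
  tail_notMem := List.forall_mem_append.2
    ⟨fun a ha => mt (hin.stripVerts_subset ·) (hE.tail_notMem a ha),
      fun a ha => notMem_stripVerts (c₀ a ha) (d := (a, true)) rfl
        ((inOuterRegion_left_iff_right (c₀ a ha (a, true) rfl)).2 (r₀ a ha))⟩
  head_notMem := List.forall_mem_append.2
    ⟨fun a ha => notMem_stripVerts (c₁ a ha) (d := (a, false)) rfl (r₁ a ha),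
      fun a ha => mt (hin.stripVerts_subset ·) (hE.head_notMem a ha)⟩
  right_in := List.forall_mem_append.2
    ⟨fun a ha => hin.inOuterRegion (hE.right_in a ha), r₀⟩
  right_out := List.forall_mem_append.2
    ⟨r₁, fun a ha => hin.inOuterRegion (hE.right_out a ha)⟩

lemma Shape.solid_of_inside [Finite V] [Finite A] [Finite Φ] (H : G.Shape C Q S')
    (I : G.Solid C Q S) (h : G.Inside C Q S' S) (ha : a ∈ stripCurve Q S)
    (hj : stripJump Q S' a = stripJump Q S a) : G.Solid C Q S' := by
  have left (jump : stripJump Q S a = 1) : G.Solid C Q S' :=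
    ⟨H, H.region_of_left (hj.trans jump) (h.inOuterRegion (I.region.of_left jump).1)⟩
  have right (jump : stripJump Q S a = -1) : G.Solid C Q S' :=
    ⟨H, H.region_of_right (hj.trans jump) (h.inOuterRegion (I.region.of_right jump).1)⟩
  cases hU : S.ceiling with
  | none =>
    exact left (((mem_stripCurve_none hU).1 ha).elim I.shape.jump_floor (I.shape.jump_none hU))
  | some U =>
    exact ((mem_stripCurve_some hU).1 ha).elim (fun h => left (I.shape.jump_floor h))
      fun h => right (I.shape.jump_some hU h)

lemma Shape.notMem_boundaryVerts (H : G.Shape C Q S) (hU : S.ceiling = none)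
    (hx : x ∈ G.internalVerts Q) : x ∉ G.boundaryVerts S := by
  rintro (h | ⟨U, hU', -⟩)
  · exact H.none_internal hU x hx h
  · simp [hU] at hU'

/- The winding number of the curve of `S` is the sum of those of the curves of `S₁` and `S₂`. -/
lemma Region.stripArcs_subset (R : G.Region Q S) (R₁ : G.Region Q S₁) (R₂ : G.Region Q S₂)
    (hj : stripJump Q S = stripJump Q S₁ + stripJump Q S₂) :
    G.stripArcs C Q S ⊆ G.stripArcs C Q S₁ ∪ G.stripArcs C Q S₂ := by
  obtain ⟨h, hh, zero_iff, -⟩ := R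
  obtain ⟨h₁, hh₁, zero_iff₁, -⟩ := R₁
  obtain ⟨h₂, hh₂, zero_iff₂, -⟩ := R₂
  have sum : h = h₁ + h₂ := hh.unique (hj ▸ hh₁.add hh₂)
  have outer : ∀ f, G.InOuterRegion (stripCurve Q S₁) f → G.InOuterRegion (stripCurve Q S₂) f →
      G.InOuterRegion (stripCurve Q S) f := fun f o₁ o₂ => by
    rw [← zero_iff₁] at o₁
    rw [← zero_iff₂] at o₂
    exact (zero_iff f).1 (by rw [sum, Pi.add_apply, o₁, o₂, add_zero])
  rintro a ⟨hC, ha⟩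
  by_contra! hn
  simp only [Set.mem_union, stripArcs, Set.mem_ofPred_eq, hC, true_and, not_or, not_not] at hn
  exact ha.elim (fun h => h (outer _ hn.1.1 hn.2.1)) fun h => h (outer _ hn.1.2 hn.2.2)

/-- The link `p` from `u` to `v` is a forward path of the strip `S`, where `u` and `v` divide the
floor of `S` into `F₁`, `M` and `F₃`. It slices `S` into the up-strip
`{ S with floor := F₁ ++ p ++ F₃ }` and the down-strip `⟨u, v, some p, M⟩`. -/
structure IsForward (G : PlaneDigraph V A Φ) (C : Set V) (Q : List A) (S : Strip V A) (u : V)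
    (p : List A) (v : V) (F₁ M F₃ : List A) : Prop where
  solid : G.Solid C Q S
  link : G.IsLink C Q S u p v
  floor_eq : S.floor = F₁ ++ M ++ F₃
  walk₁ : G.IsWalk S.start F₁ u
  walk₂ : G.IsWalk u M v
  walk₃ : G.IsWalk v F₃ S.finish
  ne_nil : M ≠ []

namespace IsForward

variable (h : G.IsForward C Q S u p v F₁ M F₃)

include h

lemma isPath : G.IsPath S.start (F₁ ++ M ++ F₃) S.finish := h.floor_eq ▸ h.solid.shape.floor_path

lemma mem_floor : a ∈ S.floor ↔ a ∈ F₁ ∨ a ∈ M ∨ a ∈ F₃ := by simp [h.floor_eq]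

lemma mem_floorVerts : x ∈ G.floorVerts S ↔
    x ∈ G.verts S.start F₁ ∨ x ∈ G.verts u M ∨ x ∈ G.verts v F₃ := by
  rw [floorVerts, Set.mem_ofPred_eq, h.floor_eq, (h.walk₁.append h.walk₂).mem_verts_append,
    h.walk₁.mem_verts_append, or_assoc]

lemma internal_notMem (hx : x ∈ G.internalVerts p) : x ∉ G.floorVerts S :=
  fun hx' => h.link.2.2.2.2.2 x hx (Or.inl hx')

lemma notMem_link (hx : x ∈ G.floorVerts S) (hu : x ≠ u) (hv : x ≠ v) : x ∉ G.verts u p := by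
  intro h'
  rcases h.link.2.1.1.mem_verts_iff_internalVerts.1 h' with h' | h' | h'
  exacts [hu h', hv h', h.internal_notMem h' hx]

lemma tail_notMem (ha : a ∈ F₁) : G.tail a ∉ G.verts u (M ++ F₃) :=
  (List.append_assoc F₁ M F₃ ▸ h.isPath).tail_notMem_of_append h.walk₁ ha

lemma head_notMem (ha : a ∈ F₃) : G.head a ∉ G.verts S.start (F₁ ++ M) :=
  h.isPath.head_notMem_of_append ha

lemma end_notMem : v ∉ G.verts S.start F₁ := by
  obtain ⟨r, b, hM, -, rfl⟩ := h.walk₂.exists_concat_of_ne_nil h.ne_nil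
  exact (h.isPath.of_append_left (h.walk₁.append h.walk₂)).head_notMem_of_append (by simp [hM])

lemma inside_up : G.Inside C Q { S with floor := F₁ ++ p ++ F₃ } S := by
  refine h.link.inside ?_
  rintro a (ha | ha)
  · rcases List.mem_append.1 ha with ha | ha
    · exact (List.mem_append.1 ha).symm.imp_right fun ha => Or.inl (h.mem_floor.2 (Or.inl ha))
    · exact Or.inr (Or.inl (h.mem_floor.2 (Or.inr (Or.inr ha))))
  · exact Or.inr (Or.inr ha)

lemma inside_down : G.Inside C Q ⟨u, v, some p, M⟩ S := by
  refine h.link.inside fun a ha => ?_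
  exact ((mem_stripCurve_some rfl).1 ha).symm.imp_right
    fun ha => Or.inl (h.mem_floor.2 (Or.inr (Or.inl ha)))

lemma isPath_up : G.IsPath S.start (F₁ ++ p ++ F₃) S.finish := by
  have path₁₂ := h.isPath.of_append_left (h.walk₁.append h.walk₂)
  have path_F₁p : G.IsPath S.start (F₁ ++ p) v :=
    (path₁₂.of_append_left h.walk₁).append_of_internalVerts h.link.2.1 h.end_notMem
      fun x hx hx' => h.internal_notMem hx (h.mem_floorVerts.2 (Or.inl hx'))
  have path₃ := h.isPath.of_append_right (h.walk₁.append h.walk₂)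
  refine path_F₁p.append path₃ fun a ha hx => ?_
  have notMem := h.head_notMem ha
  rw [h.walk₁.mem_verts_append, not_or] at notMem
  refine ((h.walk₁.mem_verts_append.1 hx).resolve_left notMem.1) |> h.notMem_link
    (h.mem_floorVerts.2 (Or.inr (Or.inr (head_mem_verts ha)))) (fun e => ?_)
    (path₃.head_ne_start ha)
  exact notMem.2 (e ▸ start_mem_verts)

lemma mem_verts_up (hx : x ∈ G.verts S.start (F₁ ++ p ++ F₃)) :
    x ∈ G.floorVerts S ∨ x ∈ G.internalVerts p := by
  rw [(h.walk₁.append h.link.2.1.1).mem_verts_append, h.walk₁.mem_verts_append,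
    h.link.2.1.1.mem_verts_iff_internalVerts] at hx
  rw [h.mem_floorVerts]
  rcases hx with (hx | rfl | rfl | hx) | hx
  exacts [Or.inl (Or.inl hx), Or.inl (Or.inl h.walk₁.end_mem_verts),
    Or.inl (Or.inr (Or.inl h.walk₂.end_mem_verts)), Or.inr hx, Or.inl (Or.inr (Or.inr hx))]

lemma shape_down : G.Shape C Q ⟨u, v, some p, M⟩ where
  floor_path := (h.isPath.of_append_left (h.walk₁.append h.walk₂)).of_append_right h.walk₁
  floor_ne := h.ne_nil
  floor_arcs a ha := h.solid.shape.floor_arcs a (h.mem_floor.2 (Or.inr (Or.inl ha)))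
  some_path := by rintro _ ⟨⟩; exact h.link.2.1
  some_arcs := by rintro _ ⟨⟩ a ha; exact (h.link.2.2.1 a ha).1.1
  some_internal := by
    rintro _ ⟨⟩ x hx hx'
    exact h.internal_notMem hx (h.mem_floorVerts.2 (Or.inr (Or.inl hx')))
  some_disjoint := by
    rintro _ ⟨⟩ a ha ha'
    exact (h.link.2.2.1 a ha).2 (Or.inl (h.mem_floor.2 (Or.inr (Or.inl ha'))))
  none_path := by rintro ⟨⟩
  none_arcs := h.solid.shape.none_arcs
  none_internal := by rintro ⟨⟩

lemma approach_up [Finite A] (hE : G.Approach s t C Q S E₀ E₁) :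
    G.Approach s t C Q { S with floor := F₁ ++ p ++ F₃ } (E₀ ++ []) ([] ++ E₁) :=
  hE.extend h.inside_up rfl rfl (by simpa [verts] using h.solid.start_mem)
    (by simpa [verts] using h.solid.finish_mem) (by simpa [verts] using h.solid.shape.start_ne)
    (by simp) (by simp) (by simp) (by simp)

lemma approach_down [Finite A] (hE : G.Approach s t C Q S E₀ E₁) :
    G.Approach s t C Q ⟨u, v, some p, M⟩ (E₀ ++ F₁) (F₃ ++ E₁) := by
  have floor₁ {x} (hx : x ∈ G.verts S.start F₁) : x ∈ G.floorVerts S :=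
    h.mem_floorVerts.2 (Or.inl hx)
  have floor₃ {x} (hx : x ∈ G.verts v F₃) : x ∈ G.floorVerts S :=
    h.mem_floorVerts.2 (Or.inr (Or.inr hx))
  have head_notMem {a} (ha : a ∈ F₃) := mt h.walk₁.mem_verts_append.2 (h.head_notMem ha)
  have tail_notMem {a} (ha : a ∈ F₁) := mt h.walk₂.mem_verts_append.2 (h.tail_notMem ha)
  refine hE.extend h.inside_down h.walk₁ h.walk₃
    (fun x hx => h.solid.floorVerts_subset (floor₁ hx))
    (fun x hx => h.solid.floorVerts_subset (floor₃ hx)) (fun x hx hx' => ?_)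
    (fun a ha => ?_) (fun a ha => ?_)
    (fun a ha => h.inside_down.inOuterRegion (h.solid.floor_sides (h.mem_floor.2 (Or.inl ha))).1)
    (fun a ha => h.inside_down.inOuterRegion
      (h.solid.floor_sides (h.mem_floor.2 (Or.inr (Or.inr ha)))).1)
  · rcases mem_verts_iff_head.1 hx' with rfl | ⟨a, ha, rfl⟩
    · exact h.end_notMem hx
    · exact head_notMem ha (Or.inl hx)
  · refine h.shape_down.base_notMem rfl (fun hx => tail_notMem ha (Or.inl hx))
      (h.notMem_link (floor₁ (h.walk₁.tail_mem_verts ha)) (fun e => ?_) fun e => ?_)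
    · exact tail_notMem ha (Or.inl (e ▸ start_mem_verts))
    · exact tail_notMem ha (Or.inl (e ▸ h.walk₂.end_mem_verts))
  · refine h.shape_down.base_notMem rfl (fun hx => head_notMem ha (Or.inr hx))
      (h.notMem_link (floor₃ (head_mem_verts ha)) (fun e => ?_) fun e => ?_)
    · exact head_notMem ha (Or.inr (e ▸ start_mem_verts))
    · exact head_notMem ha (Or.inr (e ▸ h.walk₂.end_mem_verts))

variable [Finite V] [Finite A] [Finite Φ]

lemma solid_down : G.Solid C Q ⟨u, v, some p, M⟩ := by
  obtain ⟨a, M, rfl⟩ := List.exists_cons_of_ne_nil h.ne_nil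
  have ha : a ∈ S.floor := by simp [h.floor_eq]
  refine h.shape_down.solid_of_inside h.solid h.inside_down (a := a) (Or.inl ha) ?_
  rw [h.shape_down.jump_floor (List.mem_cons_self ..), h.solid.shape.jump_floor ha]

/- At a common inner vertex the path `p` and the path `Q` would have four arcs. -/
lemma notMem_of_none (H : G.Setting s t C Q) (hU : S.ceiling = none)
    (hx : x ∈ G.internalVerts Q) : x ∉ G.verts u p := by
  have off_Q : ∀ a ∈ p, a ∉ Q := fun a ha haQ => (h.solid_down.ceiling_sides rfl ha).2
    (h.inside_down.inOuterRegion (h.solid.dummy_sides hU haQ).1)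
  have notMem := h.solid.shape.notMem_boundaryVerts hU hx
  intro hx'
  rcases h.link.2.1.1.mem_verts_iff_internalVerts.1 hx' with rfl | rfl | hx'
  · exact notMem h.link.2.2.2.1
  · exact notMem h.link.2.2.2.2.1
  · obtain ⟨p₁, a, a', p₂, rfl, ha, ha'⟩ :=
      h.link.2.1.1.exists_consecutive_of_mem_internalVerts hx'
    obtain ⟨q₁, b, b', q₂, rfl, hb, hb'⟩ :=
      (h.solid.shape.none_path hU).1.exists_consecutive_of_mem_internalVerts hx
    have hxC : x ∈ C := hb ▸ (h.solid.shape.none_arcs b (by simp)).2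
    have ne : ∀ {c c'}, c ∈ p₁ ++ a :: a' :: p₂ → c' ∈ q₁ ++ b :: b' :: q₂ → c' ≠ c := by
      rintro c _ hc hc' rfl
      exact off_Q _ hc hc'
    rcases eq_of_three (H.degree x hxC) (d₁ := (a, false)) (d₂ := (a', true)) (d₃ := (b, false))
      (d := (b', true)) ha ha' hb (by simp) (by simpa using (ne (by simp) (by simp)).symm)
      (by simp) hb' with e | e | e
    · simp at e
    · exact ne (by simp) (by simp) (congrArg Prod.fst e)
    · simp at e

lemma shape_up (H : G.Setting s t C Q) : G.Shape C Q { S with floor := F₁ ++ p ++ F₃ } where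
  floor_path := h.isPath_up
  floor_ne := by simp [h.link.1]
  floor_arcs a ha := by
    rcases List.mem_append.1 ha with ha | ha
    · exact (List.mem_append.1 ha).elim
        (fun ha => h.solid.shape.floor_arcs a (h.mem_floor.2 (Or.inl ha)))
        fun ha => (h.link.2.2.1 a ha).1.1
    · exact h.solid.shape.floor_arcs a (h.mem_floor.2 (Or.inr (Or.inr ha)))
  some_path := h.solid.shape.some_path
  some_arcs := h.solid.shape.some_arcs
  some_internal U hU x hx hx' := (h.mem_verts_up hx').elim (h.solid.shape.some_internal U hU x hx)
    fun h' => h.link.2.2.2.2.2 x h' (Or.inr ⟨U, hU, hx⟩)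
  some_disjoint U hU a ha ha' := by
    have off := h.solid.shape.some_disjoint U hU a ha
    rw [h.mem_floor, not_or, not_or] at off
    rcases List.mem_append.1 ha' with ha' | ha'
    · exact (List.mem_append.1 ha').elim off.1
        fun ha' => (h.link.2.2.1 a ha').2 (Or.inr ⟨U, hU, ha⟩)
    · exact off.2.2 ha'
  none_path := h.solid.shape.none_path
  none_arcs := h.solid.shape.none_arcs
  none_internal hU x hx hx' := (h.mem_verts_up hx').elim (h.solid.shape.none_internal hU x hx)
    fun h' => h.notMem_of_none H hU hx
      (h.link.2.1.1.mem_verts_iff_internalVerts.2 (Or.inr (Or.inr h')))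

lemma solid_up (H : G.Setting s t C Q) : G.Solid C Q { S with floor := F₁ ++ p ++ F₃ } := by
  have shape := h.shape_up H
  have shape' := h.solid.shape
  obtain ⟨a, ha, jump⟩ : ∃ a ∈ stripCurve Q S,
      stripJump Q { S with floor := F₁ ++ p ++ F₃ } a = stripJump Q S a := by
    rcases hU : S.ceiling with _ | U
    · obtain ⟨a, ha⟩ := List.exists_mem_of_ne_nil _ (shape'.none_ne hU)
      exact ⟨a, (mem_stripCurve_none hU).2 (Or.inr ha),
        hU ▸ (shape.jump_none hU ha).trans (shape'.jump_none hU ha).symm⟩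
    · obtain ⟨a, ha⟩ := List.exists_mem_of_ne_nil _ (shape'.some_ne hU)
      exact ⟨a, (mem_stripCurve_some hU).2 (Or.inr ha),
        hU ▸ (shape.jump_some hU ha).trans (shape'.jump_some hU ha).symm⟩
  exact shape.solid_of_inside h.solid h.inside_up ha jump

lemma stripArcs_subset (H : G.Setting s t C Q) : G.stripArcs C Q S ⊆
    G.stripArcs C Q { S with floor := F₁ ++ p ++ F₃ } ∪ G.stripArcs C Q ⟨u, v, some p, M⟩ := by
  refine h.solid.region.stripArcs_subset (h.solid_up H).region h.solid_down.region ?_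
  ext a
  simp only [stripJump, h.floor_eq, mult_append, Option.elim_some, Pi.add_apply]
  ring

lemma none_strip_up (H : G.Setting s t C Q) (hU : S.ceiling = none) (hx : x ∈ G.internalVerts Q)
    {d : A × Bool} (hd : G.base d = x) (hdS : d.1 ∈ G.stripArcs C Q S) :
    d.1 ∈ G.stripArcs C Q { S with floor := F₁ ++ p ++ F₃ } := by
  refine (h.stripArcs_subset H hdS).resolve_right fun hdown => ?_
  obtain ⟨b, hb, rfl⟩ := List.mem_map.1 (List.dropLast_subset _ hx)
  have notMem_floor : G.head b ∉ G.verts u M := fun hx' =>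
    h.solid.shape.none_internal hU _ hx (h.mem_floorVerts.2 (Or.inr (Or.inl hx')))
  refine notMem_stripVerts (h.shape_down.base_notMem rfl notMem_floor (h.notMem_of_none H hU hx))
    (d := (b, false)) rfl ?_ ⟨d, hd, hdown⟩
  exact h.inside_down.inOuterRegion (h.solid.dummy_sides hU hb).1

lemma regular_up (H : G.Setting s t C Q) (I : G.Regular s t C Q S) :
    G.Regular s t C Q { S with floor := F₁ ++ p ++ F₃ } where
  toSolid := h.solid_up H
  none_strip hU x hx d hd hdC := h.none_strip_up H hU hx hd (I.none_strip hU x hx d hd hdC)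
  approach :=
    let ⟨_, _, hE⟩ := I.approach
    ⟨_, _, h.approach_up hE⟩

lemma regular_down (I : G.Regular s t C Q S) : G.Regular s t C Q ⟨u, v, some p, M⟩ where
  toSolid := h.solid_down
  none_strip := by rintro ⟨⟩
  approach :=
    let ⟨_, _, hE⟩ := I.approach
    ⟨_, _, h.approach_down hE⟩

end IsForward

/-- The link `p` from `u` to `v` is an up-cross path of the strip `S`, where `u` divides the floor
of `S` into `F₁` and `M` and `v` divides its ceiling into `U₁` and `U₂`. It slices `S` into the
up-strip `⟨S.start, v, some U₁, F₁ ++ p⟩` and the down-strip `⟨u, S.finish, some (p ++ U₂), M⟩`. -/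
structure IsUpCross (G : PlaneDigraph V A Φ) (C : Set V) (Q : List A) (S : Strip V A) (u : V)
    (p : List A) (v : V) (F₁ M U₁ U₂ : List A) : Prop where
  solid : G.Solid C Q S
  link : G.IsLink C Q S u p v
  floor_eq : S.floor = F₁ ++ M
  ceiling_eq : S.ceiling = some (U₁ ++ U₂)
  floor₁ : G.IsWalk S.start F₁ u
  floor₂ : G.IsWalk u M S.finish
  ceiling₁ : G.IsWalk S.start U₁ v
  ceiling₂ : G.IsWalk v U₂ S.finish
  ne_nil : M ≠ []
  ceiling₁_ne : U₁ ≠ []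
  ceiling₂_ne : U₂ ≠ []

namespace IsUpCross

variable (h : G.IsUpCross C Q S u p v F₁ M U₁ U₂)

include h

lemma floor_path : G.IsPath S.start (F₁ ++ M) S.finish := h.floor_eq ▸ h.solid.shape.floor_path

lemma ceiling_path : G.IsPath S.start (U₁ ++ U₂) S.finish :=
  h.solid.shape.some_path _ h.ceiling_eq

lemma mem_floor : a ∈ S.floor ↔ a ∈ F₁ ∨ a ∈ M := by simp [h.floor_eq]

lemma mem_floorVerts :
    x ∈ G.floorVerts S ↔ x ∈ G.verts S.start F₁ ∨ x ∈ G.verts u M := by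
  rw [floorVerts, Set.mem_ofPred_eq, h.floor_eq, h.floor₁.mem_verts_append]

lemma mem_boundaryArcs_of_mem (ha : a ∈ U₁ ∨ a ∈ U₂) : a ∈ boundaryArcs S :=
  mem_boundaryArcs_of_ceiling h.ceiling_eq (List.mem_append.2 ha)

lemma ceiling_notMem_floor (ha : a ∈ U₁ ∨ a ∈ U₂) : a ∉ S.floor :=
  h.solid.shape.some_disjoint _ h.ceiling_eq a (List.mem_append.2 ha)

lemma internal_notMem (hx : x ∈ G.internalVerts p) :
    x ∉ G.floorVerts S ∧ x ∉ G.verts S.start (U₁ ++ U₂) :=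
  ⟨fun h' => h.link.2.2.2.2.2 x hx (Or.inl h'), fun h' => h.link.2.2.2.2.2 x hx
    (h.solid.mem_boundaryVerts_of_ceiling h.ceiling_eq h')⟩

lemma ceiling_internal_notMem (hx : x ∈ G.internalVerts U₁ ∨ x = v ∨ x ∈ G.internalVerts U₂) :
    x ∉ G.floorVerts S := by
  refine h.solid.shape.some_internal _ h.ceiling_eq x ?_
  rcases hx with hx | rfl | hx
  exacts [mem_internalVerts_append_left hx,
    h.ceiling₁.end_mem_internalVerts_append h.ceiling₁_ne h.ceiling₂_ne,
    mem_internalVerts_append_right hx]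

lemma end_notMem : v ∉ G.floorVerts S := h.ceiling_internal_notMem (Or.inr (Or.inl rfl))

lemma finish_notMem : S.finish ∉ G.verts S.start F₁ := by
  obtain ⟨r, b, hM, -, hb⟩ := h.floor₂.exists_concat_of_ne_nil h.ne_nil
  exact hb ▸ h.floor_path.head_notMem_of_append (by simp [hM])

lemma head_notMem (ha : a ∈ U₂) : G.head a ∉ G.verts S.start F₁ := by
  intro h'
  rcases h.ceiling₂.head_eq_or_mem_internalVerts ha with e | e
  · exact h.finish_notMem (e ▸ h')
  · exact h.ceiling_internal_notMem (Or.inr (Or.inr e)) (h.mem_floorVerts.2 (Or.inl h'))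

lemma head_notMem_link (ha : a ∈ U₂) : G.head a ∉ G.verts u p := by
  intro h'
  rcases h.link.2.1.1.mem_verts_iff_internalVerts.1 h' with e | e | h'
  · exact h.head_notMem ha (e ▸ h.floor₁.end_mem_verts)
  · exact (h.ceiling_path.of_append_right h.ceiling₁).head_ne_start ha e
  · exact (h.internal_notMem h').2 (h.ceiling₁.mem_verts_append.2 (Or.inr (head_mem_verts ha)))

lemma tail_notMem (ha : a ∈ F₁) : G.tail a ∉ G.verts u (p ++ U₂) := by
  have notMem := h.floor_path.tail_notMem_of_append h.floor₁ ha
  have mem : G.tail a ∈ G.floorVerts S := h.mem_floorVerts.2 (Or.inl (h.floor₁.tail_mem_verts ha))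
  intro h'
  rcases mem_verts_iff_head.1 h' with e | ⟨b, hb, e⟩
  · exact notMem (e ▸ start_mem_verts)
  rcases List.mem_append.1 hb with hb | hb
  · rcases h.link.2.1.1.head_eq_or_mem_internalVerts hb with e' | e'
    · exact h.end_notMem (e' ▸ e ▸ mem)
    · exact (h.internal_notMem e').1 (e ▸ mem)
  · rcases h.ceiling₂.head_eq_or_mem_internalVerts hb with e' | e'
    · exact notMem ((e.symm.trans e') ▸ h.floor₂.end_mem_verts)
    · exact h.ceiling_internal_notMem (Or.inr (Or.inr e')) (e ▸ mem)

lemma inside_up : G.Inside C Q ⟨S.start, v, some U₁, F₁ ++ p⟩ S := by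
  refine h.link.inside fun a ha => ?_
  rcases (mem_stripCurve_some rfl).1 ha with ha | ha
  · exact (List.mem_append.1 ha).symm.imp_right fun ha => Or.inl (h.mem_floor.2 (Or.inl ha))
  · exact Or.inr (boundaryArcs_subset_stripCurve (h.mem_boundaryArcs_of_mem (Or.inl ha)))

lemma inside_down : G.Inside C Q ⟨u, S.finish, some (p ++ U₂), M⟩ S := by
  refine h.link.inside fun a ha => ?_
  rcases (mem_stripCurve_some rfl).1 ha with ha | ha
  · exact Or.inr (Or.inl (h.mem_floor.2 (Or.inr ha)))
  · exact (List.mem_append.1 ha).imp_right fun ha =>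
      boundaryArcs_subset_stripCurve (h.mem_boundaryArcs_of_mem (Or.inr ha))

lemma isPath_up : G.IsPath S.start (F₁ ++ p) v :=
  (h.floor_path.of_append_left h.floor₁).append_of_internalVerts h.link.2.1
    (fun h' => h.end_notMem (h.mem_floorVerts.2 (Or.inl h')))
    fun _ hx h' => (h.internal_notMem hx).1 (h.mem_floorVerts.2 (Or.inl h'))

lemma shape_up : G.Shape C Q ⟨S.start, v, some U₁, F₁ ++ p⟩ where
  floor_path := h.isPath_up
  floor_ne := by simp [h.link.1]
  floor_arcs a ha := (List.mem_append.1 ha).elim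
    (fun ha => h.solid.shape.floor_arcs a (h.mem_floor.2 (Or.inl ha)))
    fun ha => (h.link.2.2.1 a ha).1.1
  some_path := by rintro _ ⟨⟩; exact h.ceiling_path.of_append_left h.ceiling₁
  some_arcs := by
    rintro _ ⟨⟩ a ha
    exact h.solid.shape.some_arcs _ h.ceiling_eq a (List.mem_append_left _ ha)
  some_internal := by
    rintro _ ⟨⟩ x hx hx'
    have notMem := h.ceiling_internal_notMem (Or.inl hx)
    rcases h.floor₁.mem_verts_append.1 hx' with h' | h'
    · exact notMem (h.mem_floorVerts.2 (Or.inl h'))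
    rcases h.link.2.1.1.mem_verts_iff_internalVerts.1 h' with rfl | rfl | h'
    · exact notMem (h.mem_floorVerts.2 (Or.inr start_mem_verts))
    · exact ((h.ceiling_path.of_append_left h.ceiling₁).ne_ends_of_mem_internalVerts hx).2 rfl
    · exact (h.internal_notMem h').2 (h.ceiling₁.mem_verts_append.2
        (Or.inl (h.ceiling₁.mem_verts_iff_internalVerts.2 (Or.inr (Or.inr hx)))))
  some_disjoint := by
    rintro _ ⟨⟩ a ha ha'
    rcases List.mem_append.1 ha' with ha' | ha'
    · exact h.ceiling_notMem_floor (Or.inl ha) (h.mem_floor.2 (Or.inl ha'))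
    · exact (h.link.2.2.1 a ha').2 (h.mem_boundaryArcs_of_mem (Or.inl ha))
  none_path := by rintro ⟨⟩
  none_arcs := h.solid.shape.none_arcs
  none_internal := by rintro ⟨⟩

lemma shape_down : G.Shape C Q ⟨u, S.finish, some (p ++ U₂), M⟩ where
  floor_path := h.floor_path.of_append_right h.floor₁
  floor_ne := h.ne_nil
  floor_arcs a ha := h.solid.shape.floor_arcs a (h.mem_floor.2 (Or.inr ha))
  some_path := by
    rintro _ ⟨⟩
    exact h.link.2.1.append (h.ceiling_path.of_append_right h.ceiling₁)
      fun a ha => h.head_notMem_link ha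
  some_arcs := by
    rintro _ ⟨⟩ a ha
    exact (List.mem_append.1 ha).elim (fun ha => (h.link.2.2.1 a ha).1.1)
      fun ha => h.solid.shape.some_arcs _ h.ceiling_eq a (List.mem_append_right _ ha)
  some_internal := by
    rintro _ ⟨⟩ x hx hx'
    replace hx' := h.mem_floorVerts.2 (Or.inr hx')
    rcases h.link.2.1.1.mem_internalVerts_of_append hx with hx | rfl | hx
    exacts [(h.internal_notMem hx).1 hx', h.end_notMem hx',
      h.ceiling_internal_notMem (Or.inr (Or.inr hx)) hx']
  some_disjoint := by
    rintro _ ⟨⟩ a ha ha'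
    replace ha' := h.mem_floor.2 (Or.inr ha')
    exact (List.mem_append.1 ha).elim (fun ha => (h.link.2.2.1 a ha).2 (Or.inl ha'))
      fun ha => h.ceiling_notMem_floor (Or.inr ha) ha'
  none_path := by rintro ⟨⟩
  none_arcs := h.solid.shape.none_arcs
  none_internal := by rintro ⟨⟩

variable [Finite A]

lemma approach_up (hE : G.Approach s t C Q S E₀ E₁) :
    G.Approach s t C Q ⟨S.start, v, some U₁, F₁ ++ p⟩ (E₀ ++ []) (U₂ ++ E₁) := by
  have avoids : ∀ a ∈ U₂, ∀ d, G.base d = G.head a →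
      d.1 ∉ stripCurve Q ⟨S.start, v, some U₁, F₁ ++ p⟩ := fun a ha =>
    h.shape_up.base_notMem rfl
      (fun h' => (h.floor₁.mem_verts_append.1 h').elim (h.head_notMem ha) (h.head_notMem_link ha))
      (h.ceiling_path.head_notMem_of_append ha)
  refine hE.extend h.inside_up rfl h.ceiling₂ (by simpa [verts] using h.solid.start_mem)
    (fun x hx => h.solid.ceilingVerts_subset h.ceiling_eq
      (h.ceiling₁.mem_verts_append.2 (Or.inr hx))) ?_ (by simp) avoids (by simp)
    fun a ha => (inOuterRegion_left_iff_right (avoids a ha (a, false) rfl)).1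
      (h.inside_up.inOuterRegion (h.solid.ceiling_sides h.ceiling_eq
        (List.mem_append_right _ ha)).1)
  intro x hx hx'
  obtain rfl : x = S.start := by simpa [verts] using hx
  have start_eq : S.start = v := h.ceiling_path.eq_of_mem_of_mem start_mem_verts hx'
  exact h.end_notMem (start_eq ▸ start_mem_verts)

lemma approach_down (hE : G.Approach s t C Q S E₀ E₁) :
    G.Approach s t C Q ⟨u, S.finish, some (p ++ U₂), M⟩ (E₀ ++ F₁) ([] ++ E₁) := by
  refine hE.extend h.inside_down h.floor₁ rfl
    (fun x hx => h.solid.floorVerts_subset (h.mem_floorVerts.2 (Or.inl hx)))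
    (by simpa [verts] using h.solid.finish_mem) (fun x hx hx' => ?_)
    (fun a ha => h.shape_down.base_notMem rfl (h.floor_path.tail_notMem_of_append h.floor₁ ha)
      (h.tail_notMem ha)) (by simp)
    (fun a ha => h.inside_down.inOuterRegion (h.solid.floor_sides (h.mem_floor.2 (Or.inl ha))).1)
    (by simp)
  obtain rfl : x = S.finish := by simpa [verts] using hx'
  exact h.finish_notMem hx

variable [Finite V] [Finite Φ]

lemma solid_up : G.Solid C Q ⟨S.start, v, some U₁, F₁ ++ p⟩ := by
  obtain ⟨a, ha⟩ := List.exists_mem_of_ne_nil _ h.ceiling₁_ne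
  have ha' := List.mem_append_left U₂ ha
  refine h.shape_up.solid_of_inside h.solid h.inside_up
    ((mem_stripCurve_some h.ceiling_eq).2 (Or.inr ha')) ?_
  rw [h.shape_up.jump_some rfl ha, h.solid.shape.jump_some h.ceiling_eq ha']

lemma solid_down : G.Solid C Q ⟨u, S.finish, some (p ++ U₂), M⟩ := by
  obtain ⟨a, ha⟩ := List.exists_mem_of_ne_nil _ h.ne_nil
  have ha' := h.mem_floor.2 (Or.inr ha)
  refine h.shape_down.solid_of_inside h.solid h.inside_down (Or.inl ha') ?_
  rw [h.shape_down.jump_floor ha, h.solid.shape.jump_floor ha']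

lemma stripArcs_subset : G.stripArcs C Q S ⊆
    G.stripArcs C Q ⟨S.start, v, some U₁, F₁ ++ p⟩ ∪
      G.stripArcs C Q ⟨u, S.finish, some (p ++ U₂), M⟩ := by
  refine h.solid.region.stripArcs_subset h.solid_up.region h.solid_down.region ?_
  ext a
  simp only [stripJump, h.floor_eq, h.ceiling_eq, mult_append, Option.elim_some, Pi.add_apply]
  ring

lemma regular_up (I : G.Regular s t C Q S) :
    G.Regular s t C Q ⟨S.start, v, some U₁, F₁ ++ p⟩ where
  toSolid := h.solid_up
  none_strip := by rintro ⟨⟩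
  approach :=
    let ⟨_, _, hE⟩ := I.approach
    ⟨_, _, h.approach_up hE⟩

lemma regular_down (I : G.Regular s t C Q S) :
    G.Regular s t C Q ⟨u, S.finish, some (p ++ U₂), M⟩ where
  toSolid := h.solid_down
  none_strip := by rintro ⟨⟩
  approach :=
    let ⟨_, _, hE⟩ := I.approach
    ⟨_, _, h.approach_down hE⟩

end IsUpCross

end Slicing

/-! ### Right-most slicing -/

/-- No inner arc of the strip `S` leaves an inner vertex of its ceiling. The choice of right-most
slicing paths preserves this property. -/
def CeilingClosed (G : PlaneDigraph V A Φ) (C : Set V) (Q : List A) (S : Strip V A) : Prop :=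
  ∀ a ∈ G.innerArcs C Q S, G.tail a ∉ G.ceilingInnerVerts S

section Rightmost

variable {s t u v w x y : V} {C : Set V} {Q p q U W M c r r' r₁ r₂ F₁ F₂ F₃ U₁ U₂ : List A}
  {a f i o : A} {S S₁ S₂ : Strip V A}

namespace Regular

lemma exists_slices_forward [Finite A] (H : G.Setting s t C Q) (I : G.Regular s t C Q S)
    (hF : S.floor = F₁ ++ f :: F₂) (h₁ : G.IsWalk S.start F₁ u)
    (h₂ : G.IsWalk u (f :: F₂) S.finish) (hp : G.IsPath u p y) (ne : p ≠ [])
    (hin : ∀ b ∈ p, b ∈ G.innerArcs C Q S) (hy : y ∈ G.verts u (f :: F₂)) :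
    ∃ S₁ S₂, G.Slices C Q S u f p S₁ S₂ := by
  have mem_floor {x} (hx : x ∈ G.verts u (f :: F₂)) : x ∈ G.boundaryVerts S := by
    refine Or.inl ?_
    rw [floorVerts, Set.mem_ofPred_eq, hF]
    exact h₁.mem_verts_append.2 (Or.inr hx)
  have link := I.isLink H hp ne hin (mem_floor start_mem_verts) (mem_floor hy)
  obtain ⟨s', t', U, F⟩ := S
  obtain ⟨_ | ⟨g, M⟩, F₃, e, walk, walk₃⟩ := h₂.exists_split_of_mem hy
  · exact absurd walk (hp.ne ne)
  obtain ⟨rfl, rfl⟩ := List.cons.inj e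
  obtain rfl : F = F₁ ++ f :: M ++ F₃ := by simpa using hF
  exact ⟨_, _, .forward link h₁ walk walk₃⟩

lemma exists_slices_upCross [Finite A] (H : G.Setting s t C Q) (I : G.Regular s t C Q S)
    (hF : S.floor = F₁ ++ f :: F₂) (h₁ : G.IsWalk S.start F₁ u)
    (h₂ : G.IsWalk u (f :: F₂) S.finish) (hp : G.IsPath u p y) (ne : p ≠ [])
    (hin : ∀ b ∈ p, b ∈ G.innerArcs C Q S) (hy : y ∈ G.ceilingInnerVerts S) :
    ∃ S₁ S₂, G.Slices C Q S u f p S₁ S₂ := by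
  have hu : u ∈ G.floorVerts S := by
    rw [floorVerts, Set.mem_ofPred_eq, hF]
    exact h₁.mem_verts_append.2 (Or.inr start_mem_verts)
  have link := I.isLink H hp ne hin (Or.inl hu) (Or.inr hy)
  obtain ⟨U, hU, hy⟩ := mem_ceilingInnerVerts.1 hy
  obtain ⟨U₁, U₂, ne₁, ne₂, rfl, k₁, k₂⟩ := (I.shape.some_path U hU).1.mem_internalVerts.1 hy
  obtain ⟨s', t', _, F⟩ := S
  obtain rfl := hF
  obtain rfl := hU
  exact ⟨_, _, .upCross link h₁ h₂ k₁ k₂ ne₁ ne₂⟩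

end Regular

lemma Solid.branchesRight [Finite A] (I : G.Solid C Q S) (hU : S.ceiling = some U)
    (hdeg : G.degree (G.tail a) = 3) (ha : a ∈ G.innerArcs C Q S) (hi : i ∈ U) (ho : o ∈ U)
    (head_i : G.head i = G.tail a) (tail_o : G.tail o = G.tail a) :
    G.BranchesRight f (c ++ [i] ++ a :: r') (c ++ [i] ++ o :: r) := by
  have ne : o ≠ a := fun e => ha.2 (mem_boundaryArcs_of_ceiling hU (e ▸ ho))
  obtain ⟨-, rot_i, rot_a⟩ := rot_of_three hdeg (d₁ := (o, true)) (d₂ := (i, false))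
    (d₃ := (a, true)) tail_o head_i rfl (by simp) (by simpa using ne) (by simp)
    (I.ceiling_sides hU ho).1 (I.ceiling_sides hU hi).1
    fun outer => ha.1.2.elim (fun h => h outer.1) fun h => h outer.2
  refine ⟨c ++ [i], r, r', o, a, rfl, rfl, 1, 2, one_pos, one_lt_two, ?_⟩
  simp only [List.getLast?_append, List.getLast?_singleton, Option.some_or, Option.map_some,
    Option.getD_some, pow_one, pow_two, Equiv.Perm.coe_mul, Function.comp_apply, rot_i, rot_a,
    true_and]
  intro j hj hj'
  interval_cases j
  · simp [rot_i]
  · simp [pow_two, rot_i, rot_a]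

/- Otherwise the ceiling and the walk would contain a closed walk with an arc of the ceiling. -/
lemma Solid.notMem_verts_of_walk [Finite V] [Finite A] [Finite Φ] (I : G.Solid C Q S)
    (no_clockwise : ∀ c : List A, ¬ G.IsClockwiseCycle c) (hU : S.ceiling = some (c ++ r))
    (hc : G.IsWalk S.start c x) (hp : G.IsWalk x p y) (hin : ∀ a ∈ p, a ∈ G.stripArcs C Q S)
    (ne : x ≠ y) : y ∉ G.verts S.start c := by
  intro hy
  obtain ⟨c₁, c₂, rfl, -, walk⟩ := hc.exists_split_of_mem hy
  obtain ⟨b, c₂, rfl, -⟩ := walk.exists_cons_of_ne ne.symm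
  refine I.notMem_closed_walk no_clockwise (walk.append hp) (List.forall_mem_append.2 ⟨?_, hin⟩)
    hU (a := b) (by simp) (by simp)
  exact fun d hd => I.boundaryArcs_subset (mem_boundaryArcs_of_ceiling hU
    (List.mem_append_left _ (List.mem_append_right _ hd)))

lemma IsPath.reroute (h : G.IsPath u (c ++ r₁ ++ r₂) v) (hc : G.IsWalk u c x)
    (hr : G.IsWalk x r₁ y) (hp : G.IsPath u (c ++ p) y)
    (hi : ∀ z ∈ G.internalVerts p, z ∉ G.verts y r₂) : G.IsPath u (c ++ p ++ r₂) v := by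
  have path := h.of_append_right (hc.append hr)
  have walk : G.IsWalk x p y := (hp.of_append_right hc).1
  refine hp.append path fun b hb hx => ?_
  have notMem : G.head b ∉ G.verts u c := fun hx' =>
    h.head_notMem_of_append hb (hc.mem_verts_append.2 (Or.inl hx'))
  rcases walk.mem_verts_iff_internalVerts.1 ((hc.mem_verts_append.1 hx).resolve_left notMem)
    with e | e | hx'
  · exact notMem (e ▸ hc.end_mem_verts)
  · exact path.head_ne_start hb e
  · exact hi _ hx' (head_mem_verts hb)

lemma Slices.isForward_or_isUpCross (I : G.Solid C Q S) (hs : G.Slices C Q S u f p S₁ S₂) :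
    (∃ v F₁ F₂ F₃, G.IsForward C Q S u p v F₁ (f :: F₂) F₃ ∧
      S₁ = { S with floor := F₁ ++ p ++ F₃ } ∧ S₂ = ⟨u, v, some p, f :: F₂⟩) ∨
    ∃ v F₁ F₂ U₁ U₂, G.IsUpCross C Q S u p v F₁ (f :: F₂) U₁ U₂ ∧
      S₁ = ⟨S.start, v, some U₁, F₁ ++ p⟩ ∧ S₂ = ⟨u, S.finish, some (p ++ U₂), f :: F₂⟩ := by
  cases hs with
  | forward hp h₁ h₂ h₃ =>
    exact Or.inl ⟨_, _, _, _, ⟨I, hp, rfl, h₁, h₂, h₃, by simp⟩, rfl, rfl⟩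
  | upCross hp h₁ h₂ k₁ k₂ n₁ n₂ =>
    exact Or.inr ⟨_, _, _, _, _, ⟨I, hp, rfl, rfl, h₁, h₂, k₁, k₂, by simp, n₁, n₂⟩, rfl, rfl⟩

lemma IsForward.ceilingClosed_up (h : G.IsForward C Q S u p v F₁ M F₃)
    (hc : G.CeilingClosed C Q S) : G.CeilingClosed C Q { S with floor := F₁ ++ p ++ F₃ } :=
  fun a ha => hc a (h.inside_up.innerArcs_subset h.solid id ha)

lemma IsUpCross.mem_ceiling_internal (h : G.IsUpCross C Q S u p v F₁ M U₁ U₂)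
    (hx : x ∈ G.internalVerts U₁ ∨ x = v ∨ x ∈ G.internalVerts U₂) :
    x ∈ G.ceilingInnerVerts S := by
  refine mem_ceilingInnerVerts.2 ⟨_, h.ceiling_eq, ?_⟩
  rcases hx with hx | rfl | hx
  exacts [mem_internalVerts_append_left hx,
    h.ceiling₁.end_mem_internalVerts_append h.ceiling₁_ne h.ceiling₂_ne,
    mem_internalVerts_append_right hx]

lemma IsUpCross.ceilingClosed_up (h : G.IsUpCross C Q S u p v F₁ M U₁ U₂)
    (hc : G.CeilingClosed C Q S) : G.CeilingClosed C Q ⟨S.start, v, some U₁, F₁ ++ p⟩ := by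
  intro a ha hx
  obtain ⟨_, ⟨⟩, hx⟩ := mem_ceilingInnerVerts.1 hx
  exact hc a (h.inside_up.innerArcs_subset h.solid (by rintro ⟨⟩) ha)
    (h.mem_ceiling_internal (Or.inl hx))

variable [Finite V] [Finite A] [Finite Φ]

lemma Regular.exists_isLink_of_ceiling (H : G.Setting s t C Q) (I : G.Regular s t C Q S)
    (hU : S.ceiling = some (c ++ r)) (hc : G.IsWalk S.start c (G.tail a))
    (ha : a ∈ G.innerArcs C Q S) :
    ∃ q y, G.IsLink C Q S (G.tail a) (a :: q) y ∧ G.IsPath S.start (c ++ a :: q) y := by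
  have mem_boundary {z} (hz : z ∈ G.verts S.start c) : z ∈ G.boundaryVerts S :=
    I.mem_boundaryVerts_of_ceiling hU (hc.mem_verts_append.2 (Or.inl hz))
  obtain ⟨q, y, link⟩ := I.exists_isLink H ha (mem_boundary hc.end_mem_verts)
  have notMem : y ∉ G.verts S.start c := I.notMem_verts_of_walk H.no_clockwise hU hc link.2.1.1
    (fun b hb => (link.2.2.1 b hb).1) (link.2.1.ne link.1)
  exact ⟨q, y, link, ((I.shape.some_path _ hU).of_append_left hc).append_of_internalVerts link.2.1
    notMem fun z hz hz' => link.2.2.2.2.2 z hz (mem_boundary hz')⟩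

/- Follow `p` until `a` branches off and then a link that starts with `a`; if this link returns to
`p`, follow `p` to its end. -/
theorem Regular.exists_branchesRight (H : G.Setting s t C Q)
    (I : G.Regular s t C Q ⟨u, w, some (p ++ W), M⟩) (hp : G.IsWalk u p v)
    (ha : a ∈ G.innerArcs C Q ⟨u, w, some (p ++ W), M⟩) (hx : G.tail a ∈ G.internalVerts p) :
    ∃ p' y, G.IsPath u p' y ∧ p' ≠ [] ∧ G.BranchesRight f p' p ∧
      (∀ b ∈ p', b ∈ p ∨ b ∈ G.innerArcs C Q ⟨u, w, some (p ++ W), M⟩) ∧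
      (y = v ∨ y ∈ G.verts u M ∨ y ∈ G.internalVerts W) := by
  have path := (I.shape.some_path _ rfl).of_append_left hp
  obtain ⟨c, i, o, r, eq, hi, ho⟩ := hp.exists_consecutive_of_mem_internalVerts hx
  rw [List.append_cons] at eq
  subst eq
  have branch r' : G.BranchesRight f (c ++ [i] ++ a :: r') (c ++ [i] ++ o :: r) :=
    I.branchesRight rfl (H.degree _ (stripVerts_subset (tail_mem_stripVerts ha.1))) ha
      (by simp) (by simp) hi ho
  obtain ⟨_, hc, rfl, hr⟩ := isWalk_append.1 hp
  replace hr : G.IsWalk (G.tail a) (o :: r) v := ⟨ho, hr⟩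
  rw [ho] at hc
  obtain ⟨q, y, link, path'⟩ :=
    I.exists_isLink_of_ceiling (r := o :: r ++ W) H (by simp) hc ha
  by_cases hy : y = v ∨ y ∈ G.verts u M ∨ y ∈ G.internalVerts W
  · exact ⟨_, y, path', by simp, branch q,
      fun b hb => (List.mem_append.1 hb).imp (List.mem_append_left _) (link.2.2.1 b), hy⟩
  have returns : y ∈ G.internalVerts (c ++ [i] ++ o :: r) := by
    simp only [not_or] at hy
    obtain ⟨_, ⟨⟩, hy'⟩ := mem_ceilingInnerVerts.1 (link.2.2.2.2.1.resolve_left hy.2.1)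
    exact (hp.mem_internalVerts_of_append hy').resolve_right (not_or.2 ⟨hy.1, hy.2.2⟩)
  have off_c : y ∉ G.verts u (c ++ [i]) := fun h =>
    link.2.1.ne link.1 (path'.eq_of_mem_of_mem h link.2.1.1.end_mem_verts).symm
  obtain ⟨r₁, r₂, eq, walk₁, -⟩ := hr.exists_split_of_mem ((hc.mem_verts_append.1
    (hp.mem_verts_iff_internalVerts.2 (Or.inr (Or.inr returns)))).resolve_left off_c)
  have arcs₂ : r₂ ⊆ o :: r := eq ▸ List.subset_append_right ..
  have verts₂ {z} (hz : z ∈ G.verts y r₂) : z ∈ G.verts u (c ++ [i] ++ o :: r) :=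
    hc.mem_verts_append.2 (Or.inr (eq ▸ walk₁.mem_verts_append.2 (Or.inr hz)))
  rw [eq, ← List.append_assoc] at path
  refine ⟨c ++ [i] ++ a :: q ++ r₂, v, path.reroute hc walk₁ path' fun z hz hz' => ?_, by simp,
    by simpa using branch (q ++ r₂), fun b hb => ?_, Or.inl rfl⟩
  · exact link.2.2.2.2.2 z hz
      (I.mem_boundaryVerts_of_ceiling rfl (hp.mem_verts_append.2 (Or.inl (verts₂ hz'))))
  · rcases List.mem_append.1 hb with hb | hb
    · exact (List.mem_append.1 hb).imp (List.mem_append_left _) (link.2.2.1 b)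
    · exact Or.inl (List.mem_append_right _ (arcs₂ hb))

theorem Slices.regular (H : G.Setting s t C Q) (hs : G.Slices C Q S u f p S₁ S₂)
    (I : G.Regular s t C Q S) : G.Regular s t C Q S₁ ∧ G.Regular s t C Q S₂ := by
  obtain ⟨_, _, _, _, h, rfl, rfl⟩ | ⟨_, _, _, _, _, h, rfl, rfl⟩ :=
    hs.isForward_or_isUpCross I.toSolid
  · exact ⟨h.regular_up H I, h.regular_down I⟩
  · exact ⟨h.regular_up I, h.regular_down I⟩

theorem Slices.stripArcs_subset (H : G.Setting s t C Q) (hs : G.Slices C Q S u f p S₁ S₂)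
    (I : G.Solid C Q S) : G.stripArcs C Q S ⊆ G.stripArcs C Q S₁ ∪ G.stripArcs C Q S₂ := by
  obtain ⟨_, _, _, _, h, rfl, rfl⟩ | ⟨_, _, _, _, _, h, rfl, rfl⟩ := hs.isForward_or_isUpCross I
  · exact h.stripArcs_subset H
  · exact h.stripArcs_subset

/- By `Regular.exists_branchesRight`, such an arc would give a slicing path to the right of `p`. -/
lemma Solid.tail_notMem_of_rightmost (H : G.Setting s t C Q) (I : G.Solid C Q S)
    (hp : G.IsLink C Q S u p v) (I₂ : G.Regular s t C Q ⟨u, w, some (p ++ W), M⟩)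
    (inside : G.Inside C Q ⟨u, w, some (p ++ W), M⟩ S)
    (slices : ∀ p' y, G.IsPath u p' y → p' ≠ [] → (∀ b ∈ p', b ∈ G.innerArcs C Q S) →
      (y = v ∨ y ∈ G.verts u M ∨ y ∈ G.internalVerts W) →
      ∃ T₁ T₂, G.Slices C Q S u f p' T₁ T₂)
    (rightmost : ∀ p' T₁ T₂, G.Slices C Q S u f p' T₁ T₂ → ¬ G.BranchesRight f p' p)
    (ha : a ∈ G.innerArcs C Q ⟨u, w, some (p ++ W), M⟩) : G.tail a ∉ G.internalVerts p := by
  intro hx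
  obtain ⟨p', y, path, ne, branch, arcs, hy⟩ := I₂.exists_branchesRight H hp.2.1.1 ha hx
  obtain ⟨T₁, T₂, hT⟩ := slices p' y path ne (fun b hb => (arcs b hb).elim (hp.2.2.1 b)
    fun hb => inside.innerArcs_subset I (by rintro ⟨⟩) hb) hy
  exact rightmost p' T₁ T₂ hT branch

lemma IsForward.ceilingClosed_down (H : G.Setting s t C Q) (I : G.Regular s t C Q S)
    (h : G.IsForward C Q S u p v F₁ (f :: F₂) F₃)
    (rightmost : ∀ p' T₁ T₂, G.Slices C Q S u f p' T₁ T₂ → ¬ G.BranchesRight f p' p) :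
    G.CeilingClosed C Q ⟨u, v, some p, f :: F₂⟩ := by
  intro a ha hx
  obtain ⟨_, ⟨⟩, hx⟩ := mem_ceilingInnerVerts.1 hx
  refine I.tail_notMem_of_rightmost (W := []) H h.link (by simpa using h.regular_down I)
    (by simpa using h.inside_down) (fun p' y path ne arcs hy => ?_) rightmost (by simpa using ha) hx
  refine I.exists_slices_forward H (F₂ := F₂ ++ F₃) (by simpa using h.floor_eq) h.walk₁
    (h.walk₂.append h.walk₃) path ne arcs (h.walk₂.mem_verts_append.2 (Or.inl ?_))
  rcases hy with rfl | hy | hy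
  exacts [h.walk₂.end_mem_verts, hy, absurd hy (by simp [internalVerts])]

lemma IsUpCross.ceilingClosed_down (H : G.Setting s t C Q) (I : G.Regular s t C Q S)
    (h : G.IsUpCross C Q S u p v F₁ (f :: F₂) U₁ U₂) (hc : G.CeilingClosed C Q S)
    (rightmost : ∀ p' T₁ T₂, G.Slices C Q S u f p' T₁ T₂ → ¬ G.BranchesRight f p' p) :
    G.CeilingClosed C Q ⟨u, S.finish, some (p ++ U₂), f :: F₂⟩ := by
  intro a ha hx
  obtain ⟨_, ⟨⟩, hx⟩ := mem_ceilingInnerVerts.1 hx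
  rcases h.link.2.1.1.mem_internalVerts_of_append hx with hx | hx
  · refine I.tail_notMem_of_rightmost H h.link (h.regular_down I) h.inside_down
      (fun p' y path ne arcs hy => ?_) rightmost ha hx
    rcases or_left_comm.1 hy with hy | hy
    · exact I.exists_slices_forward H h.floor_eq h.floor₁ h.floor₂ path ne arcs hy
    · exact I.exists_slices_upCross H h.floor_eq h.floor₁ h.floor₂ path ne arcs
        (h.mem_ceiling_internal (Or.inr hy))
  · exact hc a (h.inside_down.innerArcs_subset h.solid (by rintro ⟨⟩) ha)
      (h.mem_ceiling_internal (Or.inr hx))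

theorem RightmostSlices.ceilingClosed (H : G.Setting s t C Q)
    (hs : G.RightmostSlices C Q S p S₁ S₂) (I : G.Regular s t C Q S)
    (hc : G.CeilingClosed C Q S) : G.CeilingClosed C Q S₁ ∧ G.CeilingClosed C Q S₂ := by
  obtain ⟨u, f, hs, rightmost⟩ := hs
  obtain ⟨_, _, _, _, h, rfl, rfl⟩ | ⟨_, _, _, _, _, h, rfl, rfl⟩ :=
    hs.isForward_or_isUpCross I.toSolid
  · exact ⟨h.ceilingClosed_up hc, h.ceilingClosed_down H I rightmost⟩
  · exact ⟨h.ceilingClosed_up hc, h.ceilingClosed_down H I hc rightmost⟩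

end Rightmost

/-! ### The strips of a decomposition -/

namespace Decomposition

variable {s t : V} {C : Set V} {Q : List A} {S T : Strip V A} {𝒮 : List (Strip V A)} {a : A}

lemma not_slices (hd : G.Decomposition C Q S 𝒮) (hT : T ∈ 𝒮) {u : V} {f : A} {p : List A}
    {S₁ S₂ : Strip V A} : ¬ G.Slices C Q T u f p S₁ S₂ := by
  induction hd with
  | minimal h => exact List.mem_singleton.1 hT ▸ h u f p S₁ S₂
  | slice _ _ _ ih₁ ih₂ => exact (List.mem_append.1 hT).elim ih₁ ih₂

variable [Finite V] [Finite A] [Finite Φ]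

lemma regular_and_ceilingClosed (hd : G.Decomposition C Q S 𝒮) (H : G.Setting s t C Q)
    (I : G.Regular s t C Q S) (hc : G.CeilingClosed C Q S) (hT : T ∈ 𝒮) :
    G.Regular s t C Q T ∧ G.CeilingClosed C Q T := by
  induction hd with
  | minimal => exact List.mem_singleton.1 hT ▸ ⟨I, hc⟩
  | slice h _ _ ih₁ ih₂ =>
    obtain ⟨closed₁, closed₂⟩ := h.ceilingClosed H I hc
    obtain ⟨_, _, hs, -⟩ := h
    obtain ⟨I₁, I₂⟩ := hs.regular H I
    exact (List.mem_append.1 hT).elim (ih₁ I₁ closed₁) (ih₂ I₂ closed₂)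

lemma exists_mem_stripArcs (hd : G.Decomposition C Q S 𝒮) (H : G.Setting s t C Q)
    (I : G.Regular s t C Q S) (ha : a ∈ G.stripArcs C Q S) : ∃ T ∈ 𝒮, a ∈ G.stripArcs C Q T := by
  induction hd with
  | minimal => exact ⟨_, List.mem_singleton_self _, ha⟩
  | slice h _ _ ih₁ ih₂ =>
    obtain ⟨_, _, hs, -⟩ := h
    obtain ⟨I₁, I₂⟩ := hs.regular H I
    rcases hs.stripArcs_subset H I.toSolid ha with ha | ha
    · obtain ⟨T, hT, ha⟩ := ih₁ I₁ ha
      exact ⟨T, List.mem_append_left _ hT, ha⟩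
    · obtain ⟨T, hT, ha⟩ := ih₂ I₂ ha
      exact ⟨T, List.mem_append_right _ hT, ha⟩

end Decomposition

/-! ### Links on paths from the source to the sink -/

section Links

variable {s t u v x : V} {C : Set V} {Q p L P₁ P₂ E₀ E₁ F₁ F₂ F₃ : List A} {S : Strip V A}
  {a b e i o l : A} {f : Φ}

lemma flat_of_notMem (hx : x ∉ C) : G.Flat (G.InOuterRegion (G.arcsOf C)) x := by
  refine Flat.of_notMem ?_
  rintro ⟨a, _ | _⟩ rfl h
  exacts [hx h.2, hx h.1]

namespace LiesOutside

lemma inOuterRegion_of_tails [Finite A] (hs : G.LiesOutside C s) (hp : G.IsWalk s p v)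
    (h : ∀ a ∈ p, G.tail a ∉ C) (ha : a ∈ p) : G.InOuterRegion (G.arcsOf C) (G.rightFace a) := by
  obtain ⟨-, d, hd, outer⟩ := hs
  exact (hp.flat_tails (fun a ha => flat_of_notMem (h a ha)) hd a ha).2 ▸ outer

lemma inOuterRegion_of_heads [Finite A] (ht : G.LiesOutside C t) (hp : G.IsWalk v p t)
    (h : ∀ a ∈ p, G.head a ∉ C) (ha : a ∈ p) :
    G.InOuterRegion (G.arcsOf C) (G.leftFace a) ∧
      G.InOuterRegion (G.arcsOf C) (G.rightFace a) := by
  obtain ⟨-, d, hd, outer⟩ := ht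
  obtain ⟨left, right⟩ := hp.flat_heads (fun a ha => flat_of_notMem (h a ha)) hd a ha
  exact ⟨left ▸ outer, right ▸ outer⟩

end LiesOutside

namespace IsSCC

lemma head_notMem_of_walk (hC : G.IsSCC C) (hu : u ∈ C) (hp : G.IsWalk u (b :: p) t)
    (hb : b ∉ G.arcsOf C) : ∀ a ∈ b :: p, G.head a ∉ C := by
  intro a ha haC
  have tail_mem : G.tail b ∈ C := hp.1 ▸ hu
  have reach : G.Reaches (G.head b) (G.head a) := (hp.2.reaches_of_mem <|
    (List.mem_cons.1 ha).elim (fun e => e ▸ start_mem_verts) head_mem_verts).1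
  exact hb ⟨tail_mem, hC.mem_of_reaches tail_mem haC ⟨[b], rfl, rfl⟩ reach⟩

lemma tail_notMem_of_walk (hC : G.IsSCC C) (hv : v ∈ C) (hp : G.IsWalk s (p ++ [b]) v)
    (hb : b ∉ G.arcsOf C) : ∀ a ∈ p ++ [b], G.tail a ∉ C := by
  intro a ha haC
  obtain ⟨walk, hbv⟩ := isWalk_concat.1 hp
  have head_mem : G.head b ∈ C := hbv ▸ hv
  have reach : G.Reaches (G.tail a) (G.tail b) := (walk.reaches_of_mem <|
    (List.mem_append.1 ha).elim walk.tail_mem_verts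
      fun h => List.mem_singleton.1 h ▸ walk.end_mem_verts).2
  exact hb ⟨hC.mem_of_reaches haC head_mem reach ⟨[b], rfl, rfl⟩, head_mem⟩

end IsSCC

lemma Solid.inOuterRegion_of_arcsOf (I : G.Solid C Q S) (hf : G.InOuterRegion (G.arcsOf C) f) :
    G.InOuterRegion (stripCurve Q S) f :=
  hf.mono fun _ ha hn => absurd (I.shape.curve_arcs ha) hn

namespace Regular

/- A path that leaves `C` at an inner vertex of the strip would make this vertex an exit on `Q` or
the strip a part of the outer region of `C`. -/
lemma mem_arcsOf_of_path_out [Finite A] (H : G.Setting s t C Q) (I : G.Regular s t C Q S)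
    (ha : a ∈ G.innerArcs C Q S) (hx : G.head a ∉ G.boundaryVerts S)
    (hp : G.IsPath (G.head a) (b :: p) t) : b ∈ G.arcsOf C := by
  by_contra hb
  have outside := H.scc.head_notMem_of_walk ha.1.1.2 hp.1 hb
  refine I.face_notMem_outer hx (fun hQ => (H.internal _ hQ.2).2 ⟨ha.1.1.2, b :: p, hp, ?_⟩)
    (d := (a, false)) (e := (b, true)) rfl hp.1.1 ha (I.inOuterRegion_of_arcsOf
      (H.sink.inOuterRegion_of_heads hp.1 outside List.mem_cons_self).1)
  intro x hx hxC
  refine (mem_verts_iff_head.1 hx).resolve_right ?_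
  rintro ⟨c, hc, rfl⟩
  exact outside c hc hxC

lemma mem_arcsOf_of_path_in [Finite A] (H : G.Setting s t C Q) (I : G.Regular s t C Q S)
    (ha : a ∈ G.innerArcs C Q S) (hx : G.tail a ∉ G.boundaryVerts S)
    (hp : G.IsPath s (p ++ [b]) (G.tail a)) : b ∈ G.arcsOf C := by
  by_contra hb
  have outside := H.scc.tail_notMem_of_walk ha.1.1.1 hp.1 hb
  refine I.face_notMem_outer hx (fun hQ => (H.internal _ hQ.2).1 ⟨ha.1.1.1, p ++ [b], hp, ?_⟩)
    (d := (a, true)) (e := (b, false)) rfl (isWalk_concat.1 hp.1).2 ha (I.inOuterRegion_of_arcsOf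
      (H.source.inOuterRegion_of_tails hp.1 outside List.mem_concat_self))
  intro x hx hxC
  refine (hp.1.mem_verts_iff_tail.1 hx).resolve_right ?_
  rintro ⟨c, hc, rfl⟩
  exact outside c hc hxC

lemma exists_boundaryVerts_after [Finite A] (H : G.Setting s t C Q) (I : G.Regular s t C Q S)
    (ha : a ∈ G.innerArcs C Q S) (hp : G.IsPath (G.head a) p t) :
    ∃ p₁ p₂ y, p = p₁ ++ p₂ ∧ G.IsWalk (G.head a) p₁ y ∧ G.IsWalk y p₂ t ∧
      y ∈ G.boundaryVerts S ∧ ∀ b ∈ p₁, b ∈ G.innerArcs C Q S := by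
  induction p generalizing a with
  | nil => exact absurd (hp.1 ▸ ha.1.1.2) H.sink.1
  | cons b p ih =>
    by_cases hx : G.head a ∈ G.boundaryVerts S
    · exact ⟨[], b :: p, _, rfl, rfl, hp.1, hx, by simp⟩
    · have hb : b ∈ G.innerArcs C Q S := I.mem_innerArcs_of_base hx (d := (a, false))
        (e := (b, true)) rfl hp.1.1 ha (I.mem_arcsOf_of_path_out H ha hx hp)
      obtain ⟨p₁, p₂, y, rfl, walk₁, walk₂, hy, hin⟩ :=
        ih hb (hp.of_append_right (p := [b]) ⟨hp.1.1, rfl⟩)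
      exact ⟨b :: p₁, p₂, y, rfl, ⟨hp.1.1, walk₁⟩, walk₂, hy, List.forall_mem_cons.2 ⟨hb, hin⟩⟩

lemma exists_boundaryVerts_before [Finite A] (H : G.Setting s t C Q) (I : G.Regular s t C Q S)
    (ha : a ∈ G.innerArcs C Q S) (hp : G.IsPath s p (G.tail a)) :
    ∃ p₁ p₂ y, p = p₁ ++ p₂ ∧ G.IsWalk s p₁ y ∧ G.IsWalk y p₂ (G.tail a) ∧
      y ∈ G.boundaryVerts S ∧ ∀ b ∈ p₂, b ∈ G.innerArcs C Q S := by
  induction p using List.reverseRecOn generalizing a with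
  | nil => exact absurd ((show s = G.tail a from hp.1) ▸ ha.1.1.1) H.source.1
  | append_singleton p b ih =>
    by_cases hx : G.tail a ∈ G.boundaryVerts S
    · exact ⟨p ++ [b], [], _, by simp, hp.1, rfl, hx, by simp⟩
    · obtain ⟨walk, hbx⟩ := isWalk_concat.1 hp.1
      have hb : b ∈ G.innerArcs C Q S := I.mem_innerArcs_of_base hx (d := (a, true))
        (e := (b, false)) rfl hbx ha (I.mem_arcsOf_of_path_in H ha hx hp)
      obtain ⟨p₁, p₂, y, rfl, walk₁, walk₂, hy, hin⟩ := ih hb (hp.of_append_left walk)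
      exact ⟨p₁, p₂ ++ [b], y, by simp, walk₁, isWalk_concat.2 ⟨walk₂, hbx⟩, hy,
        List.forall_mem_append.2 ⟨hin, by simpa using hb⟩⟩

lemma exists_isLink_of_useful [Finite A] (H : G.Setting s t C Q) (I : G.Regular s t C Q S)
    (he : e ∈ G.innerArcs C Q S) (useful : G.Useful s t e) :
    ∃ u v P₁ L P₂, G.IsLink C Q S u L v ∧ G.IsWalk s P₁ u ∧ G.IsWalk v P₂ t ∧
      G.IsPath s (P₁ ++ (L ++ P₂)) t := by
  obtain ⟨P, hP, heP⟩ := useful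
  obtain ⟨p, q, rfl⟩ := List.append_of_mem heP
  obtain ⟨_, hp, rfl, hq⟩ := isWalk_append.1 hP.1
  have path_out : G.IsPath (G.head e) q t :=
    (hP.of_append_right hp).of_append_right (p := [e]) ⟨rfl, rfl⟩
  obtain ⟨P₁, L₁, u, rfl, hP₁, hL₁, hu, hin₁⟩ :=
    I.exists_boundaryVerts_before H he (hP.of_append_left hp)
  obtain ⟨L₂, P₂, v, rfl, hL₂, hP₂, hv, hin₂⟩ := I.exists_boundaryVerts_after H he path_out
  have path : G.IsPath s (P₁ ++ ((L₁ ++ e :: L₂) ++ P₂)) t := by simpa using hP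
  have walk : G.IsWalk u (L₁ ++ e :: L₂) v := hL₁.append ⟨rfl, hL₂⟩
  exact ⟨u, v, P₁, L₁ ++ e :: L₂, P₂,
    I.isLink H ((path.of_append_right hP₁).of_append_left walk) (by simp)
      (List.forall_mem_append.2 ⟨hin₁, List.forall_mem_cons.2 ⟨he, hin₂⟩⟩) hu hv,
    hP₁, hP₂, path⟩

end Regular

/-- The link `L` from `u` to `v` goes backward along the floor of the strip `S`, which `v` and `u`
divide into `F₁`, `F₂` and `F₃`. -/
structure IsBackward (G : PlaneDigraph V A Φ) (C : Set V) (Q : List A) (S : Strip V A) (u : V)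
    (L : List A) (v : V) (F₁ F₂ F₃ : List A) : Prop where
  solid : G.Solid C Q S
  link : G.IsLink C Q S u L v
  floor_eq : S.floor = F₁ ++ (F₂ ++ F₃)
  walk₁ : G.IsWalk S.start F₁ v
  walk₂ : G.IsWalk v F₂ u
  walk₃ : G.IsWalk u F₃ S.finish

namespace IsBackward

variable (h : G.IsBackward C Q S u L v F₁ F₂ F₃)

include h

lemma mem_floor : a ∈ S.floor ↔ a ∈ F₁ ∨ a ∈ F₂ ∨ a ∈ F₃ := by simp [h.floor_eq]

lemma mem_floorVerts : x ∈ G.floorVerts S ↔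
    x ∈ G.verts S.start F₁ ∨ x ∈ G.verts v F₂ ∨ x ∈ G.verts u F₃ := by
  rw [floorVerts, Set.mem_ofPred_eq, h.floor_eq, h.walk₁.mem_verts_append,
    h.walk₂.mem_verts_append]

lemma floor_path : G.IsPath S.start (F₁ ++ (F₂ ++ F₃)) S.finish :=
  h.floor_eq ▸ h.solid.shape.floor_path

lemma ne : v ≠ u := (h.link.2.1.ne h.link.1).symm

lemma floor_disjoint (hx : x ∈ G.verts S.start F₁) : x ∉ G.verts u F₃ := by
  intro hx'
  have eq_end : x = v :=
    h.floor_path.eq_of_mem_of_mem hx (h.walk₂.mem_verts_append.2 (Or.inr hx'))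
  have path : G.IsPath S.start ((F₁ ++ F₂) ++ F₃) S.finish := by simpa using h.floor_path
  have eq_start : x = u := path.eq_of_mem_of_mem (h.walk₁.mem_verts_append.2 (Or.inl hx)) hx'
  exact h.ne (eq_end.symm.trans eq_start)

lemma start_mem : u ∈ G.stripVerts C Q S := h.solid.boundaryVerts_subset h.link.2.2.2.1

lemma end_mem : v ∈ G.stripVerts C Q S := h.solid.boundaryVerts_subset h.link.2.2.2.2.1

lemma internal_mem (hx : x ∈ G.internalVerts L) : x ∈ G.stripVerts C Q S := by
  obtain ⟨L₁, a, b, L₂, rfl, rfl, -⟩ := h.link.2.1.1.exists_consecutive_of_mem_internalVerts hx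
  exact head_mem_stripVerts (h.link.2.2.1 a (by simp)).1

lemma disjoint (hE : G.Approach s t C Q S E₀ E₁) (hx : x ∈ G.verts s (E₀ ++ F₁)) :
    x ∉ G.verts u (F₃ ++ E₁) := by
  intro hx'
  have mem_strip {y} (hy : y ∈ G.verts S.start F₁ ∨ y ∈ G.verts v F₂ ∨ y ∈ G.verts u F₃) :
      y ∈ G.stripVerts C Q S := h.solid.floorVerts_subset (h.mem_floorVerts.2 hy)
  rcases hE.walk_in.mem_verts_append.1 hx with hx | hx <;>
    rcases h.walk₃.mem_verts_append.1 hx' with hx' | hx'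
  · obtain rfl := hE.eq_start hx (mem_strip (Or.inr (Or.inr hx')))
    exact h.floor_disjoint start_mem_verts hx'
  · exact hE.disjoint x hx hx'
  · exact h.floor_disjoint hx hx'
  · obtain rfl := hE.eq_finish hx' (mem_strip (Or.inl hx))
    exact h.floor_disjoint hx h.walk₃.end_mem_verts

lemma tail_ne (hE : G.Approach s t C Q S E₀ E₁) (ha : a ∈ E₀ ++ F₁) : G.tail a ≠ v := by
  rcases List.mem_append.1 ha with ha | ha
  · exact fun e => hE.tail_notMem a ha (e ▸ h.end_mem)
  · exact (h.floor_path.of_append_left h.walk₁).tail_ne_end ha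

lemma internal_in (hE : G.Approach s t C Q S E₀ E₁) (hx : x ∈ G.internalVerts L) :
    x ∉ G.verts s (E₀ ++ F₁) := by
  have hxS := h.link.2.2.2.2.2 x hx
  rw [hE.walk_in.mem_verts_append]
  rintro (hx' | hx')
  · exact hxS (hE.eq_start hx' (h.internal_mem hx) ▸ Or.inl start_mem_verts)
  · exact hxS (Or.inl (h.mem_floorVerts.2 (Or.inl hx')))

lemma internal_out (hE : G.Approach s t C Q S E₀ E₁) (hx : x ∈ G.internalVerts L) :
    x ∉ G.verts u (F₃ ++ E₁) := by
  have hxS := h.link.2.2.2.2.2 x hx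
  rw [h.walk₃.mem_verts_append]
  rintro (hx' | hx')
  · exact hxS (Or.inl (h.mem_floorVerts.2 (Or.inr (Or.inr hx'))))
  · exact hxS (hE.eq_finish hx' (h.internal_mem hx) ▸
      Or.inl h.solid.shape.floor_path.1.end_mem_verts)

lemma right_in (hE : G.Approach s t C Q S E₀ E₁) (ha : a ∈ E₀ ++ F₁) :
    G.InOuterRegion (stripCurve Q S) (G.rightFace a) :=
  (List.mem_append.1 ha).elim (hE.right_in a)
    fun ha => (h.solid.floor_sides (h.mem_floor.2 (Or.inl ha))).1

lemma right_out (hE : G.Approach s t C Q S E₀ E₁) (ha : a ∈ F₃ ++ E₁) :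
    G.InOuterRegion (stripCurve Q S) (G.rightFace a) :=
  (List.mem_append.1 ha).elim
    (fun ha => (h.solid.floor_sides (h.mem_floor.2 (Or.inr (Or.inr ha)))).1) (hE.right_out a)

lemma link_notMem_in (hE : G.Approach s t C Q S E₀ E₁) (hl : l ∈ L) : l ∉ E₀ ++ F₁ := by
  have inner := h.link.2.2.1 l hl
  exact fun hl' => (List.mem_append.1 hl').elim
    (fun hl' => hE.tail_notMem l hl' (tail_mem_stripVerts inner.1))
    fun hl' => inner.2 (Or.inl (h.mem_floor.2 (Or.inl hl')))

lemma link_notMem_out (hE : G.Approach s t C Q S E₀ E₁) (hl : l ∈ L) : l ∉ F₃ ++ E₁ := by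
  have inner := h.link.2.2.1 l hl
  exact fun hl' => (List.mem_append.1 hl').elim
    (fun hl' => inner.2 (Or.inl (h.mem_floor.2 (Or.inr (Or.inr hl')))))
    fun hl' => hE.head_notMem l hl' (head_mem_stripVerts inner.1)

/- The arcs at `u` are the floor arc `k`, the arc `o` and the link arc `l`, in this cyclic order. -/
lemma faces_start [Finite A] (H : G.Setting s t C Q) (hE : G.Approach s t C Q S E₀ E₁)
    (ho : o ∈ F₃ ++ E₁) (tail_o : G.tail o = u) (hl : l ∈ L) (tail_l : G.tail l = u) :
    (∀ k, G.head k = u → G.leftFace l = G.leftFace k) ∧ G.rightFace l = G.leftFace o := by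
  have ne_nil : F₂ ≠ [] := by rintro rfl; exact h.ne h.walk₂
  obtain ⟨M, k, rfl, -, head_k⟩ := h.walk₂.exists_concat_of_ne_nil ne_nil
  have deg := H.degree u (stripVerts_subset h.start_mem)
  have ne : (o, true) ≠ (l, true) := fun e => by
    obtain rfl : o = l := congrArg Prod.fst e
    exact h.link_notMem_out hE hl ho
  obtain ⟨-, rot_o, rot_l⟩ := rot_of_three deg (d₁ := (k, false)) (d₂ := (o, true))
    (d₃ := (l, true)) head_k tail_o tail_l (by simp) (by simp) ne
    (h.solid.floor_sides (h.mem_floor.2 (Or.inr (Or.inl List.mem_concat_self)))).1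
    (h.right_out hE ho)
    fun outer => (h.link.2.2.1 l hl).1.2.elim (· outer.1) (· outer.2)
  refine ⟨fun k' head_k' => ?_, ?_⟩
  · rcases eq_of_three deg (d₁ := (k, false)) (d₂ := (o, true)) (d₃ := (l, true))
      (d := (k', false)) head_k tail_o tail_l (by simp) (by simp) ne head_k' with e | e | e
    · obtain rfl : k' = k := congrArg Prod.fst e
      have face := G.face_rot (l, true)
      rw [rot_l] at face
      exact face.symm
    · simp at e
    · simp at e
  · have face := G.face_rot (o, true)
    rwa [rot_o] at face

/- The arcs at `v` are the arc `i`, the floor arc `g` and the link arc `l`, in this cyclic order. -/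
lemma face_end [Finite A] (H : G.Setting s t C Q) (hE : G.Approach s t C Q S E₀ E₁)
    (hi : i ∈ E₀ ++ F₁) (head_i : G.head i = v) (hl : l ∈ L) (head_l : G.head l = v) :
    G.rightFace l = G.leftFace i := by
  obtain ⟨g, M, rfl, tail_g, -⟩ := h.walk₂.exists_cons_of_ne h.ne
  have ne : (i, false) ≠ (l, false) := fun e => by
    obtain rfl : i = l := congrArg Prod.fst e
    exact h.link_notMem_in hE hl hi
  obtain ⟨-, -, rot_l⟩ := rot_of_three (H.degree v (stripVerts_subset h.end_mem))
    (d₁ := (i, false)) (d₂ := (g, true)) (d₃ := (l, false)) head_i tail_g head_l (by simp) ne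
    (by simp) (h.right_in hE hi)
    (h.solid.floor_sides (h.mem_floor.2 (Or.inr (Or.inl List.mem_cons_self)))).1
    fun outer => (h.link.2.2.1 l hl).1.2.elim (· outer.2) (· outer.1)
  have face := G.face_rot (l, false)
  rw [rot_l] at face
  exact face.symm

lemma exists_isBackwardLink [Finite A] (H : G.Setting s t C Q)
    (hE : G.Approach s t C Q S E₀ E₁) :
    ∃ I O l l' i o, G.IsBackwardLink s t u v L I O l l' i o := by
  have walk_in := hE.walk_in.append h.walk₁
  have walk_out := h.walk₃.append hE.walk_out
  have in_ne : E₀ ++ F₁ ≠ [] := fun e => by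
    rw [e] at walk_in
    exact H.source.1 ((show s = v from walk_in) ▸ stripVerts_subset h.end_mem)
  have ne_sink : u ≠ t := fun e => H.sink.1 (e ▸ stripVerts_subset h.start_mem)
  obtain ⟨I, i, hI, -, head_i⟩ := walk_in.exists_concat_of_ne_nil in_ne
  obtain ⟨o, O, hO, tail_o, -⟩ := walk_out.exists_cons_of_ne ne_sink
  obtain ⟨l, L₁, hl, tail_l, -⟩ := h.link.2.1.1.exists_cons_of_ne h.ne.symm
  obtain ⟨L₂, l', hl', -, head_l'⟩ := h.link.2.1.1.exists_concat_of_ne_nil h.link.1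
  have first_mem : l ∈ L := hl ▸ List.mem_cons_self
  have last_mem : l' ∈ L := hl' ▸ List.mem_concat_self
  obtain ⟨left_start, right_start⟩ := h.faces_start H hE
    (hO ▸ List.mem_cons_self) tail_o first_mem tail_l
  exact ⟨I, O, l, l', i, o,
    { walk_in := hI ▸ walk_in
      walk_out := hO ▸ walk_out
      disjoint := fun x hx => hO ▸ h.disjoint hE (hI ▸ hx)
      tail_ne := fun a ha => h.tail_ne hE (hI ▸ ha)
      first_mem := first_mem
      last_mem := last_mem
      head_last := head_l'
      internal_in := fun x hx => hI ▸ h.internal_in hE hx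
      internal_out := fun x hx => hO ▸ h.internal_out hE hx
      left_start := left_start
      right_start := right_start
      right_end := h.face_end H hE (hI ▸ List.mem_concat_self) head_i last_mem head_l' }⟩

theorem not_isPath [Finite V] [Finite A] [Finite Φ] (H : G.Setting s t C Q)
    (hE : G.Approach s t C Q S E₀ E₁) (hP₁ : G.IsWalk s P₁ u) (hP₂ : G.IsWalk v P₂ t) :
    ¬ G.IsPath s (P₁ ++ (L ++ P₂)) t := by
  obtain ⟨I, O, l, l', i, o, B⟩ := h.exists_isBackwardLink H hE
  exact B.not_isPath H.no_clockwise H.scc (stripVerts_subset h.start_mem)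
    (stripVerts_subset h.end_mem) H.source H.sink hP₁ h.link.2.1.1 hP₂

end IsBackward

/- Otherwise the link and the part of the ceiling after `v` would form a closed walk. -/
lemma Solid.ne_finish_of_isLink [Finite V] [Finite A] [Finite Φ] (I : G.Solid C Q S)
    (no_clockwise : ∀ c : List A, ¬ G.IsClockwiseCycle c) (hL : G.IsLink C Q S u L v)
    (hv : v ∈ G.ceilingInnerVerts S) : u ≠ S.finish := by
  rintro rfl
  obtain ⟨U, hU, hv⟩ := mem_ceilingInnerVerts.1 hv
  obtain ⟨U₁, U₂, -, ne, rfl, -, walk⟩ := (I.shape.some_path U hU).1.mem_internalVerts.1 hv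
  obtain ⟨b, U₂, rfl⟩ := List.exists_cons_of_ne_nil ne
  refine I.notMem_closed_walk no_clockwise (hL.2.1.1.append walk) (List.forall_mem_append.2
    ⟨fun a ha => (hL.2.2.1 a ha).1, fun a ha => ?_⟩) hU (a := b) (by simp) (by simp)
  exact I.boundaryArcs_subset (mem_boundaryArcs_of_ceiling hU (List.mem_append_right _ ha))

namespace Regular

variable [Finite V] [Finite A] [Finite Φ]

lemma exists_slices_of_isPath (H : G.Setting s t C Q) (I : G.Regular s t C Q S)
    (hc : G.CeilingClosed C Q S) (hL : G.IsLink C Q S u L v) (hP₁ : G.IsWalk s P₁ u)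
    (hP₂ : G.IsWalk v P₂ t) (hP : G.IsPath s (P₁ ++ (L ++ P₂)) t) :
    ∃ f S₁ S₂, G.Slices C Q S u f L S₁ S₂ := by
  obtain ⟨ne, path, inner, hu, hv, -⟩ := id hL
  have u_mem : u ∈ G.verts S.start S.floor := by
    obtain ⟨l, L, rfl, rfl, -⟩ := path.1.exists_cons_of_ne (path.ne ne)
    exact hu.resolve_right (hc l (inner l (by simp)))
  obtain ⟨F₁, F₂, hF, walk₁, walk₂⟩ := I.shape.floor_path.1.exists_split_of_mem u_mem
  rcases hv with hv | hv
  · rw [floorVerts, Set.mem_ofPred_eq, hF, walk₁.mem_verts_append] at hv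
    rcases hv with hv | hv
    · obtain ⟨E₀, E₁, hE⟩ := I.approach
      obtain ⟨M₁, M₂, rfl, h₁, h₂⟩ := walk₁.exists_split_of_mem hv
      have back : G.IsBackward C Q S u L v M₁ M₂ F₂ :=
        ⟨I.toSolid, hL, by simpa using hF, h₁, h₂, walk₂⟩
      exact absurd hP (back.not_isPath H hE hP₁ hP₂)
    · obtain _ | ⟨f, F₂⟩ := F₂
      · exact absurd (List.mem_singleton.1 hv).symm (path.ne ne)
      · exact ⟨f, I.exists_slices_forward H hF walk₁ walk₂ path ne inner hv⟩
  · obtain ⟨f, F₂, rfl, -⟩ :=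
      walk₂.exists_cons_of_ne (I.ne_finish_of_isLink H.no_clockwise hL hv)
    exact ⟨f, I.exists_slices_upCross H hF walk₁ walk₂ path ne inner hv⟩

theorem not_useful_of_not_slices (H : G.Setting s t C Q) (I : G.Regular s t C Q S)
    (hc : G.CeilingClosed C Q S) (minimal : ∀ u f p S₁ S₂, ¬ G.Slices C Q S u f p S₁ S₂)
    (he : e ∈ G.innerArcs C Q S) : ¬ G.Useful s t e := by
  intro useful
  obtain ⟨u, v, P₁, L, P₂, hL, hP₁, hP₂, hP⟩ := I.exists_isLink_of_useful H he useful
  obtain ⟨f, S₁, S₂, hs⟩ := I.exists_slices_of_isPath H hc hL hP₁ hP₂ hP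
  exact minimal u f L S₁ S₂ hs

end Regular

end Links

/-! ### The component as a strip -/

lemma inOuterRegion_componentBoundary {C : Set V} {f : Φ}
    (h : G.InOuterRegion (G.componentBoundary C) f) : G.InOuterRegion (G.arcsOf C) f := by
  induction h with
  | refl => exact inOuterRegion_outer _
  | tail _ hd ih =>
    obtain ⟨⟨a, β⟩, ha, rfl, rfl⟩ := hd
    refine (inOuterRegion_rev (d := (a, β)) fun haC => ha ⟨haC, ?_⟩).1 ih
    cases β
    exacts [Or.inr ih, Or.inl ih]

namespace IsLowestFloor

variable {s t sC tC : V} {C : Set V} {F Q : List A} {a : A}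

lemma stripCurve_eq (h : G.IsLowestFloor s t C sC tC F Q) :
    stripCurve Q ⟨sC, tC, none, F⟩ = G.componentBoundary C :=
  Set.ext fun a => List.mem_append.symm.trans (h.2.1 a)

lemma shape (h : G.IsLowestFloor s t C sC tC F Q) : G.Shape C Q ⟨sC, tC, none, F⟩ := by
  obtain ⟨⟨cycle_ne, -, cycle_nodup⟩, boundary, hF, hQ, -⟩ := h
  refine
    { floor_path := hF
      floor_ne := ?_
      floor_arcs := fun a ha => ((boundary a).1 (List.mem_append_left _ ha)).1
      some_path := by rintro _ ⟨⟩
      some_arcs := by rintro _ ⟨⟩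
      some_internal := by rintro _ ⟨⟩
      some_disjoint := by rintro _ ⟨⟩
      none_path := fun _ => hQ
      none_arcs := fun a ha => ((boundary a).1 (List.mem_append_right _ ha)).1
      none_internal := fun _ x hx hxF => ?_ }
  · rintro rfl
    exact hQ.ne (by simpa using cycle_ne) (show sC = tC from hF.1).symm
  · obtain ⟨q₁, a, b, q₂, rfl, -, hb⟩ := hQ.1.exists_consecutive_of_mem_internalVerts hx
    rcases hF.1.mem_verts_iff_tail.1 hxF with h | ⟨c, hc, h⟩
    · exact (hQ.ne_ends_of_mem_internalVerts hx).1 h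
    · rw [List.map_append, List.nodup_append] at cycle_nodup
      exact cycle_nodup.2.2 _ (List.mem_map_of_mem hc) _ (List.mem_map_of_mem (a := b) (by simp))
        (h.trans hb.symm)

variable [Finite V] [Finite A] [Finite Φ]

lemma solid (no_clockwise : ∀ c : List A, ¬ G.IsClockwiseCycle c)
    (h : G.IsLowestFloor s t C sC tC F Q) : G.Solid C Q ⟨sC, tC, none, F⟩ := by
  obtain ⟨g, hg⟩ := h.shape.exists_potential
  exact ⟨h.shape, g, hg, (h.shape.jordan hg).1, h.1.potential_eq_zero_or_one no_clockwise
    ⟨hg.1, fun a => (hg.2 a).trans (by simp [stripJump, mult_append])⟩⟩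

lemma arcsOf_subset_stripArcs (no_clockwise : ∀ c : List A, ¬ G.IsClockwiseCycle c)
    (h : G.IsLowestFloor s t C sC tC F Q) :
    G.arcsOf C ⊆ G.stripArcs C Q ⟨sC, tC, none, F⟩ := by
  refine fun a ha => ⟨ha, ?_⟩
  by_contra! outer
  have left_outer := inOuterRegion_componentBoundary (h.stripCurve_eq ▸ outer.1)
  have on_curve : a ∈ stripCurve Q ⟨sC, tC, none, F⟩ :=
    h.stripCurve_eq.symm ▸ ⟨ha, Or.inl left_outer⟩
  exact ((h.solid no_clockwise).stripCurve_subset on_curve).2.elim (· outer.1) (· outer.2)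

theorem regular (H : G.Setting s t C Q) (h : G.IsLowestFloor s t C sC tC F Q) :
    G.Regular s t C Q ⟨sC, tC, none, F⟩ := by
  have I := h.solid H.no_clockwise
  have arcs_subset := h.arcsOf_subset_stripArcs H.no_clockwise
  obtain ⟨-, -, -, -, ⟨hs, E₀, hE₀, entrance⟩, ⟨ht, E₁, hE₁, exit⟩, -⟩ := h
  have tails : ∀ a ∈ E₀, G.tail a ∉ C := fun a ha hC =>
    hE₀.tail_ne_end ha (entrance _ (hE₀.1.tail_mem_verts ha) hC)
  have heads : ∀ a ∈ E₁, G.head a ∉ C := fun a ha hC =>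
    hE₁.head_ne_start ha (exit _ (head_mem_verts ha) hC)
  exact
    { I with
      none_strip := fun _ _ _ _ _ hd => arcs_subset hd
      approach := ⟨E₀, E₁,
        { walk_in := hE₀.1
          walk_out := hE₁.1
          disjoint := fun x hx hx' =>
            have hxC := H.scc.mem_of_reaches ht hs (hE₁.1.reaches_of_mem hx').1
              (hE₀.1.reaches_of_mem hx).2
            I.shape.start_ne ((entrance x hx hxC).symm.trans (exit x hx' hxC))
          tail_notMem := fun a ha hS => tails a ha (stripVerts_subset hS)
          head_notMem := fun a ha hS => heads a ha (stripVerts_subset hS)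
          right_in := fun a ha =>
            I.inOuterRegion_of_arcsOf (H.source.inOuterRegion_of_tails hE₀.1 tails ha)
          right_out := fun a ha =>
            I.inOuterRegion_of_arcsOf (H.sink.inOuterRegion_of_heads hE₁.1 heads ha).2 }⟩ }

end IsLowestFloor

end PlaneDigraph

open PlaneDigraph in
theorem mainTheorem4_general {V A Φ : Type*} [Finite V] [Finite A] [Finite Φ]
    (G : PlaneDigraph V A Φ) (s t : V)
    (no_clockwise : ∀ c : List A, ¬ G.IsClockwiseCycle c)
    (C : Set V) (component : G.IsSCC C) (degree_three : ∀ v ∈ C, G.degree v = 3)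
    (source_outside : G.LiesOutside C s) (sink_outside : G.LiesOutside C t)
    (sC tC : V) (F Q : List A) (floor : G.IsLowestFloor s t C sC tC F Q)
    (𝒮 : List (Strip V A))
    (decomposition : G.Decomposition C Q ⟨sC, tC, none, F⟩ 𝒮) :
    (∀ S ∈ 𝒮, ∀ e ∈ G.innerArcs C Q S, ¬ G.Useful s t e) ∧
    (∀ e ∈ G.arcsOf C, G.Useful s t e → ∃ S ∈ 𝒮, e ∈ boundaryArcs S) := by
  have H : G.Setting s t C Q := ⟨no_clockwise, degree_three, component, source_outside,
    sink_outside, floor.2.2.2.2.2.2⟩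
  have regular := floor.regular H
  have ceiling_closed : G.CeilingClosed C Q ⟨sC, tC, none, F⟩ := fun a _ hx => by
    obtain ⟨U, hU, -⟩ := mem_ceilingInnerVerts.1 hx
    cases hU
  have useless : ∀ S ∈ 𝒮, ∀ e ∈ G.innerArcs C Q S, ¬ G.Useful s t e := fun S hS e he =>
    have ⟨regular_S, ceiling_closed_S⟩ :=
      decomposition.regular_and_ceilingClosed H regular ceiling_closed hS
    regular_S.not_useful_of_not_slices H ceiling_closed_S
      (fun _ _ _ _ _ => decomposition.not_slices hS) he
  refine ⟨useless, fun e he useful => ?_⟩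
  obtain ⟨S, hS, e_mem⟩ := decomposition.exists_mem_stripArcs H regular
    (floor.arcsOf_subset_stripArcs no_clockwise he)
  exact ⟨S, hS, by_contra fun not_boundary => useless S hS e ⟨e_mem, not_boundary⟩ useful⟩

theorem mainTheorem4 {V A Φ : Type*} [Finite V] [Finite A] [Finite Φ]
    (G : PlaneDigraph V A Φ) (s t : V)
    (no_clockwise : ∀ c : List A, ¬ G.IsClockwiseCycle c)
    (source_in : ∀ a : A, G.head a ≠ s)
    (source_out : ∃! a : A, G.tail a = s)
    (degree_three : ∀ v : V, v ≠ s → v ≠ t → G.degree v = 3)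
    (sink_outer : G.OnOuterFace t)
    (C : Set V) (component : G.IsSCC C)
    (source_outside : G.LiesOutside C s) (sink_notMem : t ∉ C)
    (sC tC : V) (F Q : List A) (floor : G.IsLowestFloor s t C sC tC F Q)
    (𝒮 : List (Strip V A))
    (decomposition : G.Decomposition C Q ⟨sC, tC, none, F⟩ 𝒮) :
    (∀ S ∈ 𝒮, ∀ e ∈ G.innerArcs C Q S, ¬ G.Useful s t e) ∧
    (∀ e ∈ G.arcsOf C, G.Useful s t e → ∃ S ∈ 𝒮, e ∈ PlaneDigraph.boundaryArcs S) := by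
  have sink_outside : G.LiesOutside C t :=
    ⟨sink_notMem, sink_outer.imp fun _ ⟨base_eq, face_eq⟩ =>
      ⟨base_eq, face_eq ▸ PlaneDigraph.inOuterRegion_outer _⟩⟩
  exact mainTheorem4_general G s t no_clockwise C component
    (fun v hv => degree_three v (fun h => source_outside.1 (h ▸ hv)) fun h => sink_notMem (h ▸ hv))
    source_outside sink_outside sC tC F Q floor 𝒮 decomposition
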